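/- **Setting.** A (finite-dimensional real) Lie algebra $\mathfrak g$ is stratified of step $\ell$ if $\mathfrak g=\mathfrak g_{-1}\oplus\dots\oplus\mathfrak g_{-\ell}$ with $\mathfrak g_{-\ell}\neq\{0\}$ and $[\mathfrak g_{-j},\mathfrak g_{-1}]=\mathfrak g_{-j-1}$ for $1\le j\le \ell$, where $\mathfrak g_{-\ell-1}=\{0\}$. It is totally nonabelian if $\mathfrak g_{-1}$ meets the centre of $\mathfrak g$ only in $0$. A homogeneous ideal is an ideal $\mathfrak a$ with $\mathfrak a=\bigoplus_j(\mathfrak a\cap\mathfrak g_{-j})$. A direct sum decomposition $\mathfrak g=\mathfrak g^1\oplus\dots\oplus\mathfrak g^m$ into nonzero homogeneous ideals is the finest one if, for every direct sum decomposition $\mathfrak g=\tilde{\mathfrak g}^1\oplus\dots\oplus\tilde{\mathfrak g}^L$ into homogeneous ideals, $\{1,\dots,m\}$ may be partitioned into (possibly empty) sets $J_1,\dots,J_L$ with $\tilde{\mathfrak g}^l=\bigoplus_{j\in J_l}\mathfrak g^j$ for all $l$. Let $G$ be the connected, simply connected Lie group with Lie algebra $\mathfrak g$, identified with $\mathfrak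 g$ by the exponential map, its product being given by the Baker–Campbell–Hausdorff formula, and let $G^j=\exp\mathfrak g^j$, so that $G=G^1\times\dots\times G^m$. Fix a scalar product on $\mathfrak g_{-1}$, and let $\varrho(p,q)$ be the associated left-invariant Carnot–Carathéodory distance, that is, the infimum of the lengths of the smooth curves from $p$ to $q$ tangent to the left translates of $\mathfrak g_{-1}$; $G$ with $\varrho$ is a Carnot group. For $f:G\to G$, $p\in G$ and $s>0$ put $$H(f,p,s)=\frac{\sup\{\varrho(f(x),f(p)):\varrho(x,p)\le s\}}{\inf\{\varrho(f(x),f(p)):\varrho(x,p)\ge s\}},$$ understood as $+\infty$ when the denominator is $0$ (in particular for constant $f$). The map $f$ is quasiconformal if there is $\lambda>0$ such that $\limsup_{s\to0+}H(f,p,s)\le\lambda$ for all $p\in G$. **Theorem.** Suppose that $G$ is a Carnot group whose Lie algebra $\mathfrak g$ is totally nonabelian, with finest direct sum decomposition $\mathfrak g=\mathfrak g^1\oplus\dots\oplus\mathfrak g^m$, where $m>1$. Let $f:G\to G$ be a $C^1$ quasiconformal map. Then $f=A\circ\Phi$, where * $A$ is an automorphism of $G$ of the form $\exp\circ T\circ\log$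 for a Lie algebra automorphism $T$ of $\mathfrak g$ with $T\mathfrak g_{-i}=\mathfrak g_{-i}$ for all $i$, and there is a permutation $\sigma$ of $\{1,\dots,m\}$ such that $A(G^j)=G^{\sigma(j)}$ for all $j$; * $\Phi$ is a product bi-Lipschitz map: there are maps $\varphi^j:G^j\to G^j$ such that $\Phi(p^1\cdots p^m)=\varphi^1(p^1)\cdots\varphi^m(p^m)$ whenever $p^j\in G^j$ for all $j$, and $\Phi$ and every $\varphi^j$ are bi-Lipschitz for $\varrho$: there is $K>0$ such that $K^{-1}\varrho(p,q)\le\varrho(\Phi(p),\Phi(q))\le K\varrho(p,q)$ for all $p,q\in G$, and likewise for each $\varphi^j$ on $G^j$. -/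

import Mathlib

open scoped ENNReal Topology

/-! ### Stratified Lie algebras -/

/-- A stratification `g = g₋₁ ⊕ ⋯ ⊕ g₋ℓ` of a real Lie algebra: `layer j` is `g₋ⱼ` and `step` is
`ℓ`; the layers with index `0` or greater than `ℓ` are zero, and `[g₋ⱼ, g₋₁] = g₋ⱼ₋₁`. -/
structure Stratification (g : Type*) [LieRing g] [LieAlgebra ℝ g] where
  step : ℕ
  layer : ℕ → Submodule ℝ g
  isInternal : DirectSum.IsInternal layer
  layer_zero : layer 0 = ⊥
  layer_step : layer step ≠ ⊥
  layer_of_lt : ∀ j, step < j → layer j = ⊥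
  layer_succ : ∀ j, 1 ≤ j →
    layer (j + 1) = Submodule.span ℝ {z | ∃ x ∈ layer j, ∃ y ∈ layer 1, z = ⁅x, y⁆}

namespace Stratification

variable {g : Type*} [LieRing g] [LieAlgebra ℝ g]

/-- `g₋₁ ∩ Z(g) = 0`. -/
def IsTotallyNonabelian (S : Stratification g) : Prop :=
  S.layer 1 ⊓ (LieAlgebra.center ℝ g).toSubmodule = ⊥

/-- An ideal is homogeneous (dilation-invariant) when it is the sum of its intersections with the
layers. -/
def IsHomogeneous (S : Stratification g) (I : LieIdeal ℝ g) : Prop :=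
  I.toSubmodule = ⨆ j, I.toSubmodule ⊓ S.layer j

/-- `g` is the direct sum of the homogeneous ideals `I j`. Distinct ideals in such a sum commute,
and each of them is stratified by its intersections with the layers. -/
structure IsDecomposition (S : Stratification g) {m : ℕ} (I : Fin m → LieIdeal ℝ g) : Prop where
  homogeneous : ∀ j, S.IsHomogeneous (I j)
  isInternal : DirectSum.IsInternal fun j => (I j).toSubmodule

/-- The finest direct sum decomposition: the summands are nonzero, and the summands of any other
decomposition are obtained by grouping the `I j` along a partition `{j | c j = l}` of the index
set. -/
structure IsFinestDecomposition (S : Stratification g) {m : ℕ} (I : Fin m → LieIdeal ℝ g) :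
    Prop where
  isDecomposition : S.IsDecomposition I
  ne_bot : ∀ j, I j ≠ ⊥
  finest : ∀ (L : ℕ) (J : Fin L → LieIdeal ℝ g), S.IsDecomposition J →
    ∃ c : Fin m → Fin L, ∀ l, J l = ⨆ j, ⨆ _ : c j = l, I j

/-- A Lie algebra automorphism is strata-preserving when it maps each layer onto itself. -/
def IsStrataPreserving (S : Stratification g) (T : g ≃ₗ⁅ℝ⁆ g) : Prop :=
  ∀ j, (S.layer j).map (T : g →ₗ[ℝ] g) = S.layer j

end Stratification

/-! ### The simply connected group of a stratified Lie algebra -/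

section BCH

variable {g : Type*} [LieRing g] [LieAlgebra ℝ g]

/-- The right-nested bracket `[x₁, [x₂, ⋯ [xₖ₋₁, xₖ] ⋯ ]]` of a word. -/
def nestedBracket : List g → g
  | [] => 0
  | [x] => x
  | x :: y :: l => ⁅x, nestedBracket (y :: l)⁆

/-- The Baker-Campbell-Hausdorff series `log (exp X exp Y)` in Dynkin's form
`∑ₙ (-1)ⁿ⁻¹/n ∑_{rᵢ + sᵢ > 0} [X^r₁ Y^s₁ ⋯ X^rₙ Y^sₙ] / (∑ᵢ (rᵢ + sᵢ) · ∏ᵢ rᵢ! sᵢ!)`.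
All the words with at most `N` letters are included; those with more than `N` letters have
bracket zero if `g` is nilpotent of step `N`. -/
noncomputable def bch (N : ℕ) (X Y : g) : g :=
  ∑ n ∈ Finset.Icc 1 N,
    ∑ w : Fin n → Fin (N + 1) × Fin (N + 1) with ∀ i, 0 < (w i).1.val + (w i).2.val,
      ((-1 : ℝ) ^ (n - 1) / (n : ℝ) /
        ((∑ i, (((w i).1.val : ℝ) + ((w i).2.val : ℝ))) *
          ∏ i, (((w i).1.val.factorial : ℝ) * ((w i).2.val.factorial : ℝ)))) •
        nestedBracket (List.ofFn fun i =>
          List.replicate (w i).1.val X ++ List.replicate (w i).2.val Y).flatten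

end BCH

/-- The connected simply connected Lie group `G` whose Lie algebra is the stratified Lie algebra
`g`. Its elements are `exp X` with `X ∈ g`, the exponential map being a diffeomorphism; its
product is given by the Baker-Campbell-Hausdorff formula. -/
structure StratifiedGroup {g : Type*} [LieRing g] [LieAlgebra ℝ g] (S : Stratification g) where
  exp ::
  log : g

namespace StratifiedGroup

variable {g : Type*} [LieRing g] [LieAlgebra ℝ g] {S : Stratification g}

noncomputable instance : Mul (StratifiedGroup S) := ⟨fun p q => exp (bch S.step p.log q.log)⟩

instance : One (StratifiedGroup S) := ⟨exp 0⟩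

/-- The subgroup `exp I` of `G` with Lie algebra `I`. -/
def factor (S : Stratification g) (I : LieIdeal ℝ g) : Set (StratifiedGroup S) := {p | p.log ∈ I}

/-- Linear coordinates on `g`. Composed with `log`, they form the exponential coordinates of the
first kind, which are a global chart of `G`. -/
noncomputable def coords (g : Type*) [LieRing g] [LieAlgebra ℝ g] [FiniteDimensional ℝ g] :
    g ≃ₗ[ℝ] (Fin (Module.finrank ℝ g) → ℝ) := (Module.finBasis ℝ g).equivFun

/-- The exponential coordinates of the first kind. -/
noncomputable def chart [FiniteDimensional ℝ g] (p : StratifiedGroup S) :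
    Fin (Module.finrank ℝ g) → ℝ := coords g p.log

/-- The value at `p` of the left-invariant vector field `X`, that is, the velocity at `ε = 0` of
the curve `p exp (ε X)`, in exponential coordinates. -/
noncomputable def leftInvariantField [FiniteDimensional ℝ g] (X : g) (p : StratifiedGroup S) :
    Fin (Module.finrank ℝ g) → ℝ :=
  deriv (fun ε : ℝ => chart (p * exp (ε • X))) 0

/-- `f : G → G` is continuously differentiable. -/
def IsC1 [FiniteDimensional ℝ g] (f : StratifiedGroup S → StratifiedGroup S) : Prop :=
  ContDiff ℝ 1 fun v => chart (f (exp ((coords g).symm v)))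

/-- A map `Φ : G → G` is the product of the maps `φ j : Gʲ → Gʲ`, where `Gʲ = exp (I j)`:
`Φ (p¹ ⋯ pᵐ) = φ¹ (p¹) ⋯ φᵐ (pᵐ)` whenever `pʲ ∈ Gʲ`. -/
def IsProductMap {m : ℕ} (I : Fin m → LieIdeal ℝ g) (Φ : StratifiedGroup S → StratifiedGroup S)
    (φ : Fin m → StratifiedGroup S → StratifiedGroup S) : Prop :=
  (∀ j, Set.MapsTo (φ j) (factor S (I j)) (factor S (I j))) ∧
    ∀ p : Fin m → StratifiedGroup S, (∀ j, p j ∈ factor S (I j)) →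
      Φ (List.ofFn p).prod = (List.ofFn fun j => φ j (p j)).prod

end StratifiedGroup

/-! ### Carnot groups and quasiconformal maps -/

/-- A stratification together with a scalar product on the first layer. -/
structure CarnotStructure (g : Type*) [LieRing g] [LieAlgebra ℝ g] extends Stratification g where
  inner : LinearMap.BilinForm ℝ (layer 1)
  inner_symm : ∀ x y, inner x y = inner y x
  inner_pos : ∀ x, x ≠ 0 → 0 < inner x x

namespace CarnotStructure

variable {g : Type*} [LieRing g] [LieAlgebra ℝ g]

/-- The Carnot group. -/
abbrev Group (C : CarnotStructure g) : Type _ := StratifiedGroup C.toStratification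

variable [FiniteDimensional ℝ g]

/-- `γ : [0, 1] → G` is a smooth horizontal curve from `p` to `q`, and `u t ∈ g₋₁` is its velocity
at time `t`, translated back to the identity. -/
structure IsHorizontalCurve (C : CarnotStructure g) (p q : C.Group) (γ : ℝ → C.Group)
    (u : ℝ → C.layer 1) : Prop where
  smooth : ContDiffOn ℝ (⊤ : ℕ∞) (fun t => (γ t).chart) (Set.Icc 0 1)
  velocity : ∀ t ∈ Set.Icc (0 : ℝ) 1,
    HasDerivWithinAt (fun t => (γ t).chart)
      (StratifiedGroup.leftInvariantField (u t : g) (γ t)) (Set.Icc 0 1) t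
  source : γ 0 = p
  target : γ 1 = q

/-- The Carnot-Carathéodory distance: the infimum of the lengths of the smooth horizontal curves
from `p` to `q`. -/
noncomputable def dist (C : CarnotStructure g) (p q : C.Group) : ℝ :=
  sInf {r | ∃ γ u, C.IsHorizontalCurve p q γ u ∧ r = ∫ t in (0 : ℝ)..1, √(C.inner (u t) (u t))}

open Classical in
/-- The distortion `H(f, p, s)`. It is infinite when the denominator vanishes, even if the
numerator vanishes too; so constant maps are not quasiconformal. -/
noncomputable def distortion (C : CarnotStructure g) (f : C.Group → C.Group) (p : C.Group)
    (s : ℝ) : ℝ≥0∞ :=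
  if (⨅ x, ⨅ _ : s ≤ C.dist x p, ENNReal.ofReal (C.dist (f x) (f p))) = 0 then ⊤
  else (⨆ x, ⨆ _ : C.dist x p ≤ s, ENNReal.ofReal (C.dist (f x) (f p))) /
    (⨅ x, ⨅ _ : s ≤ C.dist x p, ENNReal.ofReal (C.dist (f x) (f p)))

/-- `f : G → G` is `K`-quasiconformal for some `K > 0`. -/
def IsQuasiconformal (C : CarnotStructure g) (f : C.Group → C.Group) : Prop :=
  ∃ K : ℝ, 0 < K ∧
    ∀ p, Filter.limsup (fun s => C.distortion f p s) (𝓝[>] (0 : ℝ)) ≤ ENNReal.ofReal K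

/-- `φ` is bi-Lipschitz on `s` for the Carnot-Carathéodory distance. -/
def IsBiLipschitzOn (C : CarnotStructure g) (φ : C.Group → C.Group) (s : Set C.Group) : Prop :=
  ∃ K : ℝ, 0 < K ∧ ∀ p ∈ s, ∀ q ∈ s,
    K⁻¹ * C.dist p q ≤ C.dist (φ p) (φ q) ∧ C.dist (φ p) (φ q) ≤ K * C.dist p q

end CarnotStructure

/-! Quasiconformality bounds only ratios of distances at one point. When the group has at least two
factors, these ratios turn into uniform upper and lower bounds for the differential, because the
differential along one factor does not see the position in the others.

Differentials are read in the left trivialization. A C¹ quasiconformal map `f` preserves the first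
layer (`IsQuasiconformal.isContact`), and at every point it stretches any two horizontal vectors by
comparable factors, with one constant for all points (`IsQuasiconformal.exists_conformal`). The
blow-ups of a contact map converge to a group homomorphism, whose leading part, the block diagonal
of the differential, is a graded Lie algebra homomorphism (`exists_lieHom_differential`). Where the
differential is not zero on the first layer, comparability makes it injective there, so the block
diagonal is a graded automorphism. It carries the finest decomposition to another decomposition,
hence permutes the summands (`IsFinestDecomposition.exists_perm`).

Rigidity: let the differential at `p` send the summand `j` to the summand `k`. Near `p` the
component `k` of `f` is constant in the directions of the other factors, because its velocity there
is zero. These directions commute with the factor `j`, so the differential on the first layer of the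
summand `j` is also constant along them, first locally and then, by a connectedness argument,
globally (`IsQuasiconformal.differential_mul_exp`). Since there is a second factor, it follows that
the differential vanishes nowhere, that the permutation is the same at all points, and, comparing
through a fixed vector of another factor, that the differential is uniformly bounded above and below
on the first layer (`IsQuasiconformal.exists_differential_bounds`).

The upper bound makes `f` Lipschitz, by mapping curves forward. For the lower bound horizontal
curves are lifted through `f`; a continuity argument shows that they never leave its range
(`forall_mem_range`), so surjectivity is not needed in advance. Finally `A` is the automorphism
given by the diagonal part at the identity and `Φ` is `A⁻¹ ∘ f`; the component `j` of `Φ` depends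
only on the component `j` of the point.

Two foundations come before this. The group law is Dynkin's series, so even associativity needs a
proof: `IsNilpotentRep.exp_bch` identifies the product with multiplication of operators in a
faithful nilpotent representation. The distance is then compared with the homogeneous sizes of the
layers by the ball-box estimates (`exists_dist_le`, `exists_norm_proj_le_dist`). -/

/-! ### The Baker-Campbell-Hausdorff theorem for nilpotent Lie algebras of operators -/

section CommutingOperators

variable {B : Type*} [NormedRing B] [NormedAlgebra ℝ B]

/-- The sum `∑ xⁱ yʲ` over `i + j + 1 = n`, for commuting `x` and `y`. -/
noncomputable def geomSumTwo (x y : B) : ℕ → B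
  | 0 => 0
  | n + 1 => x ^ n + y * geomSumTwo x y n

theorem hasDerivAt_add_smul_pow {r d : B} (h : Commute r d) (n : ℕ) (s : ℝ) :
    HasDerivAt (fun s : ℝ => (r + s • d) ^ (n + 1)) ((n + 1 : ℝ) • (d * (r + s • d) ^ n)) s := by
  have h1 : HasDerivAt (fun s : ℝ => r + s • d) d s := by
    simpa using ((hasDerivAt_id s).smul_const d).const_add r
  have hc : Commute d (r + s • d) := (h.symm).add_right ((Commute.refl d).smul_right s)
  induction n with
  | zero => simpa using h1
  | succ n ih =>
    have := ih.mul h1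
    refine (this.congr_deriv ?_).congr_of_eventuallyEq (.of_forall fun s => pow_succ _ _)
    rw [smul_mul_assoc, mul_assoc, ← pow_succ, ← (hc.pow_right (n + 1)).eq]
    push_cast
    module

/-- Formally the function is `((r + s d) ^ (n + 1) - r ^ (n + 1)) / d`. As `d` need not be
invertible, the recursion defining `geomSumTwo` is differentiated instead. -/
theorem hasDerivAt_smul_geomSumTwo {r d : B} (h : Commute r d) (n : ℕ) (s : ℝ) :
    HasDerivAt (fun s : ℝ => s • geomSumTwo (r + s • d) r (n + 1))
      ((n + 1 : ℝ) • (r + s • d) ^ n) s := by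
  induction n with
  | zero => simpa [geomSumTwo] using (hasDerivAt_id s).smul_const (1 : B)
  | succ n ih =>
    have h1 := ((hasDerivAt_id s).smul (hasDerivAt_add_smul_pow h n s)).add (ih.const_mul r)
    refine (h1.congr_deriv ?_).congr_of_eventuallyEq (.of_forall fun s => ?_)
    · rw [pow_succ' _ n]
      push_cast
      simp only [id, one_smul, add_mul, smul_mul_assoc, mul_smul_comm, smul_add]
      module
    · beta_reduce
      rw [show geomSumTwo (r + s • d) r (n + 1 + 1) = (r + s • d) ^ (n + 1) +
        r * geomSumTwo (r + s • d) r (n + 1) from rfl, smul_add, ← mul_smul_comm]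
      rfl

theorem sum_neg_pow_mul_one_add {x : B} {K : ℕ} (h : x ^ K = 0) :
    (1 + x) * ∑ n ∈ Finset.range K, (-1 : ℝ) ^ n • x ^ n = 1 := by
  have h1 : ∀ n, (-1 : ℝ) ^ n • x ^ n = (-x) ^ n := fun n => by
    rw [neg_pow x, Algebra.smul_def]; simp
  simp only [h1]
  have := mul_neg_geom_sum (-x) K
  rw [sub_neg_eq_add] at this
  rw [this, neg_pow, h]; simp

theorem add_smul_sub_pow_eq_zero {l r : B} (h : Commute l r) {M K : ℕ} (hl : l ^ M = 0)
    (hr : r ^ M = 0) (hK : M + M ≤ K + 1) (s : ℝ) : (r + s • (l - r)) ^ K = 0 := by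
  have e : r + s • (l - r) = (1 - s) • r + s • l := by module
  have hc : Commute ((1 - s) • r) (s • l) := (h.symm.smul_left _).smul_right _
  rw [e]
  refine hc.add_pow_eq_zero_of_add_le_succ_of_pow_eq_zero (m := M) (n := M) ?_ ?_ hK
  · rw [smul_pow, hr, smul_zero]
  · rw [smul_pow, hl, smul_zero]

/-- The formal identity `(log (1 + l) - log (1 + r)) / (l - r) * (1 + r) = log (1 + z) / z`, where
`1 + l = (1 + z) (1 + r)`. -/
theorem sum_geomSumTwo_mul {r z : B} (h : Commute r z) {K : ℕ} (hz : z ^ K = 0)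
    (hr : ∀ s : ℝ, (r + s • (z * (1 + r))) ^ K = 0) :
    ∑ n ∈ Finset.range K, ((-1 : ℝ) ^ n / (n + 1)) •
        (geomSumTwo (r + z * (1 + r)) r (n + 1) * (1 + r)) =
      ∑ n ∈ Finset.range K, ((-1 : ℝ) ^ n / (n + 1)) • z ^ n := by
  set d := z * (1 + r) with hd
  have hrd : Commute r d := h.mul_right ((Commute.one_right r).add_right (Commute.refl r))
  -- `α s` is `log (1 + s z) / z`, and `β s` is the left side along the segment from `r` in the
  -- direction `d`. Both vanish at `0`; the claim is their equality at `1`, so it suffices to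
  -- compare derivatives.
  let α : ℝ → B := fun s => ∑ n ∈ Finset.range K, ((-1 : ℝ) ^ n / (n + 1)) • (s ^ (n + 1) • z ^ n)
  let β : ℝ → B := fun s => ∑ n ∈ Finset.range K, ((-1 : ℝ) ^ n / (n + 1)) •
        ((s • geomSumTwo (r + s • d) r (n + 1)) * (1 + r))
  have hα : ∀ s, HasDerivAt α (∑ n ∈ Finset.range K, (-1 : ℝ) ^ n • (s • z) ^ n) s := by
    intro s
    refine HasDerivAt.fun_sum fun n _ => ?_
    have := ((hasDerivAt_pow (n + 1) s).smul_const (z ^ n)).const_smul ((-1 : ℝ) ^ n / (n + 1))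
    refine this.congr_deriv ?_
    rw [smul_smul, smul_pow, smul_smul]
    congr 1
    push_cast
    field_simp
  have hβ : ∀ s, HasDerivAt β
      (∑ n ∈ Finset.range K, (-1 : ℝ) ^ n • ((r + s • d) ^ n * (1 + r))) s := by
    intro s
    refine HasDerivAt.fun_sum fun n _ => ?_
    have := ((hasDerivAt_smul_geomSumTwo hrd n s).mul_const (1 + r)).const_smul
      ((-1 : ℝ) ^ n / (n + 1))
    refine this.congr_deriv ?_
    rw [smul_mul_assoc, smul_smul]
    congr 1
    field_simp
  -- Both sides are inverse to `1 + s z`, because `1 + r + s d = (1 + s z) (1 + r)`.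
  have heq : ∀ s : ℝ, ∑ n ∈ Finset.range K, (-1 : ℝ) ^ n • ((r + s • d) ^ n * (1 + r)) =
      ∑ n ∈ Finset.range K, (-1 : ℝ) ^ n • (s • z) ^ n := by
    intro s
    have hsz : (s • z) ^ K = 0 := by rw [smul_pow, hz, smul_zero]
    have e1 := sum_neg_pow_mul_one_add hsz
    have e2 := sum_neg_pow_mul_one_add (hr s)
    have e3 : 1 + (r + s • d) = (1 + s • z) * (1 + r) := by
      rw [hd, add_mul, one_mul, smul_mul_assoc]; abel
    have c1 : Commute (1 + s • z) (∑ n ∈ Finset.range K, (-1 : ℝ) ^ n • (s • z) ^ n) :=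
      Commute.sum_right _ _ _ fun n _ =>
        (((Commute.one_left _).add_left (Commute.refl (s • z))).pow_right n).smul_right _
    have c2 : Commute (1 + r) (∑ n ∈ Finset.range K, (-1 : ℝ) ^ n • (r + s • d) ^ n) :=
      Commute.sum_right _ _ _ fun n _ => (((Commute.one_left _).add_left
        ((Commute.refl r).add_right (hrd.smul_right s))).pow_right n).smul_right _
    have e4 : ∑ n ∈ Finset.range K, (-1 : ℝ) ^ n • ((r + s • d) ^ n * (1 + r)) =
        (1 + r) * ∑ n ∈ Finset.range K, (-1 : ℝ) ^ n • (r + s • d) ^ n := by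
      rw [c2.eq, Finset.sum_mul]; simp only [smul_mul_assoc]
    rw [e3, mul_assoc, ← e4] at e2
    rw [c1.eq] at e1
    calc _ = ((∑ n ∈ Finset.range K, (-1 : ℝ) ^ n • (s • z) ^ n) * (1 + s • z)) * _ := by
            rw [e1, one_mul]
      _ = _ := by rw [mul_assoc, e2, mul_one]
  have hconst := is_const_of_deriv_eq_zero (f := β - α)
    (fun s => ((hβ s).sub (hα s)).differentiableAt)
    (fun s => by rw [((hβ s).sub (hα s)).deriv, heq, sub_self]) 1 0
  have h0 : β 0 - α 0 = 0 := by simp [α, β]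
  rw [Pi.sub_apply, Pi.sub_apply, h0, sub_eq_zero] at hconst
  simpa [α, β] using hconst

end CommutingOperators

/-! ### Exponentials and logarithms in a nilpotent algebra of operators. -/

section NilpotentRepresentation

variable {g : Type*} [LieRing g] [LieAlgebra ℝ g]
variable {A : Type*} [NormedRing A] [NormedAlgebra ℝ A]

/-- A faithful representation of a Lie algebra in an associative algebra such that all the products
of more than `N` operators vanish. -/
structure IsNilpotentRep (N : ℕ) (ρ : g →ₗ[ℝ] A) : Prop where
  map_lie : ∀ x y, ρ ⁅x, y⁆ = ρ x * ρ y - ρ y * ρ x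
  prod_eq_zero : ∀ l : List g, N < l.length → (l.map ρ).prod = 0
  injective : Function.Injective ρ

/-- The span of the products of at least `k` operators. -/
noncomputable def repFiltration (ρ : g →ₗ[ℝ] A) (k : ℕ) : Submodule ℝ A :=
  Submodule.span ℝ {x | ∃ l : List g, k ≤ l.length ∧ (l.map ρ).prod = x}

/-- The truncated logarithm series `log (1 + x)`. -/
noncomputable def truncLog (K : ℕ) (x : A) : A :=
  ∑ n ∈ Finset.range K, ((-1 : ℝ) ^ n / (n + 1)) • x ^ (n + 1)

theorem repFiltration_anti (ρ : g →ₗ[ℝ] A) {a b : ℕ} (h : a ≤ b) :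
    repFiltration ρ b ≤ repFiltration ρ a :=
  Submodule.span_mono fun _ ⟨l, hl, e⟩ => ⟨l, h.trans hl, e⟩

theorem mul_mem_repFiltration {ρ : g →ₗ[ℝ] A} {a b : ℕ} {x y : A} (hx : x ∈ repFiltration ρ a)
    (hy : y ∈ repFiltration ρ b) : x * y ∈ repFiltration ρ (a + b) := by
  have := Submodule.mul_mem_mul hx hy
  rw [repFiltration, repFiltration, Submodule.span_mul_span] at this
  refine Submodule.span_mono ?_ this
  rintro _ ⟨_, ⟨l, hl, rfl⟩, _, ⟨l', hl', rfl⟩, rfl⟩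
  exact ⟨l ++ l', by rw [List.length_append]; omega, by simp⟩

theorem one_mem_repFiltration (ρ : g →ₗ[ℝ] A) : (1 : A) ∈ repFiltration ρ 0 :=
  Submodule.subset_span ⟨[], by simp, by simp⟩

theorem map_mem_repFiltration (ρ : g →ₗ[ℝ] A) (x : g) : ρ x ∈ repFiltration ρ 1 :=
  Submodule.subset_span ⟨[x], by simp, by simp⟩

theorem pow_mem_repFiltration {ρ : g →ₗ[ℝ] A} {x : A} (hx : x ∈ repFiltration ρ 1) (n : ℕ) :
    x ^ n ∈ repFiltration ρ n := by
  induction n with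
  | zero => simpa using one_mem_repFiltration ρ
  | succ n ih => rw [pow_succ]; exact mul_mem_repFiltration ih hx

theorem mul_mem_repFiltration_right {ρ : g →ₗ[ℝ] A} {a : ℕ} {x y : A}
    (hx : x ∈ repFiltration ρ a) (hy : y ∈ repFiltration ρ 0) : x * y ∈ repFiltration ρ a := by
  simpa using mul_mem_repFiltration hx hy

namespace IsNilpotentRep

variable {N : ℕ} {ρ : g →ₗ[ℝ] A}

theorem filtration_eq_bot (hρ : IsNilpotentRep N ρ) {k : ℕ} (hk : N < k) :
    repFiltration ρ k = ⊥ := by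
  rw [repFiltration, Submodule.span_eq_bot]
  rintro _ ⟨l, hl, rfl⟩
  exact hρ.prod_eq_zero l (hk.trans_le hl)

theorem eq_zero_of_mem (hρ : IsNilpotentRep N ρ) {k : ℕ} (hk : N < k) {x : A}
    (hx : x ∈ repFiltration ρ k) : x = 0 := by
  rw [hρ.filtration_eq_bot hk] at hx; simpa using hx

theorem map_pow_eq_zero (hρ : IsNilpotentRep N ρ) {k : ℕ} (hk : N < k) (x : g) :
    ρ x ^ k = 0 :=
  hρ.eq_zero_of_mem hk (pow_mem_repFiltration (map_mem_repFiltration ρ x) k)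

theorem exp_eq_sum (hρ : IsNilpotentRep N ρ) (x : g) :
    NormedSpace.exp (ρ x) =
      ∑ k ∈ Finset.range (N + 1), ((k.factorial : ℝ)⁻¹) • ρ x ^ k := by
  rw [NormedSpace.exp_eq_tsum ℝ]
  exact tsum_eq_sum fun k hk => by
    rw [hρ.map_pow_eq_zero (by simpa using hk), smul_zero]

theorem exp_sub_one_mem (hρ : IsNilpotentRep N ρ) (x : g) :
    NormedSpace.exp (ρ x) - 1 ∈ repFiltration ρ 1 := by
  rw [hρ.exp_eq_sum, Finset.sum_range_succ']
  simp only [Nat.factorial_zero, Nat.cast_one, inv_one, pow_zero, one_smul, add_sub_cancel_right]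
  exact Submodule.sum_mem _ fun k _ => Submodule.smul_mem _ _
    (repFiltration_anti ρ (by omega) (pow_mem_repFiltration (map_mem_repFiltration ρ x) (k + 1)))

theorem exp_mem (hρ : IsNilpotentRep N ρ) (x : g) :
    NormedSpace.exp (ρ x) ∈ repFiltration ρ 0 := by
  have := add_mem (repFiltration_anti ρ (zero_le_one) (hρ.exp_sub_one_mem x))
    (one_mem_repFiltration ρ)
  simpa using this

/-- The series begins with the linear term, and the difference of two higher powers lies one
filtration level above `x - y`. Equality of the logarithms therefore pushes `x - y` up one level at
a time, beyond level `N`. -/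
theorem truncLog_injOn (hρ : IsNilpotentRep N ρ) {K : ℕ} (hK : 0 < K) {x y : A}
    (hx : x ∈ repFiltration ρ 1) (hy : y ∈ repFiltration ρ 1)
    (h : truncLog K x = truncLog K y) : x = y := by
  have key : ∀ k, x - y ∈ repFiltration ρ (k + 1) := by
    intro k
    induction k with
    | zero => simpa using sub_mem hx hy
    | succ k ih =>
      have hpow : ∀ n, x ^ (n + 1 + 1) - y ^ (n + 1 + 1) ∈ repFiltration ρ (k + 1 + 1) := by
        intro n
        induction n with
        | zero =>
          have : x ^ (0 + 1 + 1) - y ^ (0 + 1 + 1) = x * (x - y) + (x - y) * y := by noncomm_ring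
          rw [this]
          exact add_mem (by simpa [add_comm, add_left_comm] using mul_mem_repFiltration hx ih)
            (mul_mem_repFiltration ih hy)
        | succ n ihn =>
          have : x ^ (n + 1 + 1 + 1) - y ^ (n + 1 + 1 + 1) =
              x ^ (n + 1 + 1) * (x - y) + (x ^ (n + 1 + 1) - y ^ (n + 1 + 1)) * y := by
            rw [pow_succ _ (n + 1 + 1), pow_succ y (n + 1 + 1)]; noncomm_ring
          rw [this]
          refine add_mem ?_ (repFiltration_anti ρ (by omega) (mul_mem_repFiltration ihn hy))
          exact repFiltration_anti ρ (by omega)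
            (mul_mem_repFiltration (pow_mem_repFiltration hx (n + 1 + 1)) ih)
      obtain ⟨K, rfl⟩ : ∃ K', K = K' + 1 := ⟨K - 1, by omega⟩
      rw [truncLog, truncLog, Finset.sum_range_succ', Finset.sum_range_succ'] at h
      have e : x - y = -∑ n ∈ Finset.range K, ((-1 : ℝ) ^ (n + 1) / ((n + 1 : ℕ) + 1)) •
          (x ^ (n + 1 + 1) - y ^ (n + 1 + 1)) := by
        simp only [smul_sub, Finset.sum_sub_distrib]
        simp only [zero_add, pow_zero, Nat.cast_zero, pow_one, div_one, one_smul] at h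
        rw [neg_sub, sub_eq_sub_iff_add_eq_add, add_comm, h, add_comm]
      rw [e]
      exact neg_mem (Submodule.sum_mem _ fun n _ => Submodule.smul_mem _ _ (hpow n))
  have := hρ.eq_zero_of_mem (Nat.lt_succ_self N) (key N)
  exact sub_eq_zero.1 this

variable [CompleteSpace A]

theorem _root_.NormedSpace.exp_mul_exp_neg_of_real (x : A) :
    NormedSpace.exp x * NormedSpace.exp (-x) = 1 := by
  let _ : NormedAlgebra ℚ A := NormedAlgebra.restrictScalars ℚ ℝ A
  rw [← NormedSpace.exp_add_of_commute (Commute.refl x).neg_right, add_neg_cancel,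
    NormedSpace.exp_zero]

theorem _root_.NormedSpace.exp_neg_mul_exp_of_real (x : A) :
    NormedSpace.exp (-x) * NormedSpace.exp x = 1 := by
  simpa using NormedSpace.exp_mul_exp_neg_of_real (-x)

/-- The derivative of `log (1 + n t)` when `n' = m (1 + n)`. -/
theorem hasDerivAt_truncLog {n : ℝ → A} {m q : A} {t : ℝ} {M : ℕ} (hnM : n t ^ M = 0)
    (hn : HasDerivAt n (m * (1 + n t)) t) (hq : (1 + n t) * q = 1) (hq' : q * (1 + n t) = 1)
    {K : ℕ} (hK : M + M ≤ K + 1) :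
    HasDerivAt (fun t => truncLog K (n t)) (∑ k ∈ Finset.range K, ((-1 : ℝ) ^ k / (k + 1)) •
      (fun x => (1 + n t) * x * q - x)^[k] m) t := by
  set ν := n t with hν
  -- `l` and `r` are left and right multiplication by `ν`, and `1 + z` is conjugation by `1 + ν`.
  -- They satisfy `1 + l = (1 + z) (1 + r)`. The derivative of `n ^ k` is `∑ νⁱ n' νʲ`, that is
  -- `geomSumTwo l r k` applied to `n'`, so `sum_geomSumTwo_mul` evaluates the derivative of the
  -- logarithm.
  let l : A →L[ℝ] A := ContinuousLinearMap.mul ℝ A ν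
  let r : A →L[ℝ] A := (ContinuousLinearMap.mul ℝ A).flip ν
  let z : A →L[ℝ] A := ContinuousLinearMap.mul ℝ A (1 + ν) *
    (ContinuousLinearMap.mul ℝ A).flip q - 1
  have hlr : Commute l r := by ext x; simp [l, r, mul_assoc]
  have hqν : ν * q = q * ν := by
    have h1 : ν * q = 1 - q := by rw [eq_sub_iff_add_eq, ← hq]; noncomm_ring
    have h2 : q * ν = 1 - q := by rw [eq_sub_iff_add_eq, ← hq']; noncomm_ring
    rw [h1, h2]
  have hzr : Commute r z := by
    ext x
    simp only [ContinuousLinearMap.mul_apply', ContinuousLinearMap.mul_def,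
      ContinuousLinearMap.comp_apply, ContinuousLinearMap.flip_apply, z, r,
      _root_.sub_apply, one_apply_eq_self, sub_mul, mul_assoc, hqν]
  have hl : l = r + z * (1 + r) := by
    ext x
    simp only [ContinuousLinearMap.mul_apply', ContinuousLinearMap.mul_def, l,
      ContinuousLinearMap.comp_apply, ContinuousLinearMap.flip_apply, z, r,
      _root_.sub_apply, one_apply_eq_self,
      _root_.add_apply]
    have : (x + x * ν) * q = x := by rw [← mul_one_add, mul_assoc, hq, mul_one]
    rw [this]; noncomm_ring
  have hrn : ∀ k (x : A), (r ^ k) x = x * ν ^ k := by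
    intro k
    induction k with
    | zero => intro x; simp
    | succ k ih => intro x; rw [pow_succ, mul_apply_eq_comp, ih, pow_succ']
                   simp [r, mul_assoc]
  have hln : ∀ k (x : A), (l ^ k) x = ν ^ k * x := by
    intro k
    induction k with
    | zero => intro x; simp
    | succ k ih => intro x; rw [pow_succ, mul_apply_eq_comp, ih, pow_succ]
                   simp [l, mul_assoc]
  have hrM : r ^ M = 0 := by ext x; rw [hrn, hnM, mul_zero]; rfl
  have hlM : l ^ M = 0 := by ext x; rw [hln, hnM, zero_mul]; rfl
  have hd : z * (1 + r) = l - r := by rw [hl]; abel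
  have hnil : ∀ s : ℝ, (r + s • (z * (1 + r))) ^ K = 0 := by
    intro s
    rw [hd]
    exact add_smul_sub_pow_eq_zero hlr hlM hrM hK s
  -- `z (1 + r) = l - r` is nilpotent as a difference of commuting nilpotents, and `1 + r` is
  -- invertible and commutes with `z`.
  have hzK : z ^ K = 0 := by
    have h1 : (z * (1 + r)) ^ K = 0 := by
      rw [hd]
      rw [sub_eq_add_neg]
      exact (Commute.neg_right hlr).add_pow_eq_zero_of_add_le_succ_of_pow_eq_zero hlM
        (by rw [neg_pow, hrM, mul_zero]) hK
    rw [(hzr.symm.add_right (Commute.one_right z) |> fun h => by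
      simpa [add_comm] using h : Commute z (1 + r)).mul_pow] at h1
    have h2 : (1 + r) * (ContinuousLinearMap.mul ℝ A).flip q = 1 := by
      ext x
      simp only [ContinuousLinearMap.mul_def, ContinuousLinearMap.comp_apply,
        ContinuousLinearMap.flip_apply, r, one_apply_eq_self,
        _root_.add_apply, ContinuousLinearMap.mul_apply']
      rw [← mul_one_add, mul_assoc, hq', mul_one]
    have h3 : ∀ k, (1 + r) ^ k * ((ContinuousLinearMap.mul ℝ A).flip q) ^ k = 1 := by
      intro k
      induction k with
      | zero => simp
      | succ k ih =>
        rw [pow_succ, pow_succ', mul_assoc, ← mul_assoc (1 + r), h2, one_mul, ih]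
    calc z ^ K = z ^ K * ((1 + r) ^ K * ((ContinuousLinearMap.mul ℝ A).flip q) ^ K) := by
          rw [h3, mul_one]
      _ = 0 := by rw [← mul_assoc, h1, zero_mul]
  have hpow : ∀ k, HasDerivAt (fun t => n t ^ k)
      (geomSumTwo l r k (m * (1 + ν))) t := by
    intro k
    induction k with
    | zero => simpa [geomSumTwo] using hasDerivAt_const t (1 : A)
    | succ k ih =>
      have := ih.mul hn
      refine (this.congr_deriv ?_).congr_of_eventuallyEq (.of_forall fun s => pow_succ _ _)
      rw [show geomSumTwo l r (k + 1) = l ^ k + r * geomSumTwo l r k from rfl,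
        _root_.add_apply, hln, mul_apply_eq_comp, add_comm]
      rfl
  have hid := sum_geomSumTwo_mul hzr hzK hnil
  rw [← hl] at hid
  have hm : m * (1 + ν) = (1 + r) m := by simp [r, mul_add]
  have hzm : ∀ k, (z ^ k) m = (fun x => (1 + ν) * x * q - x)^[k] m := by
    intro k
    rw [FunLike.coe_pow_eq_iterate]
    congr 1
    ext x
    simp [z, mul_assoc, add_mul]
  have := congrArg (fun T : A →L[ℝ] A => T m) hid
  simp only [_root_.sum_apply, _root_.smul_apply,
    mul_apply_eq_comp, hzm, ← hm] at this
  rw [← this]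
  exact HasDerivAt.fun_sum fun k _ => (hpow (k + 1)).fun_const_smul _

end IsNilpotentRep
end NilpotentRepresentation

/-! ### Dynkin's series and its derivative along rays. -/

section Dynkin

variable {g : Type*} [LieRing g] [LieAlgebra ℝ g]

theorem nestedBracket_cons (x : g) {l : List g} (h : l ≠ []) :
    nestedBracket (x :: l) = ⁅x, nestedBracket l⁆ := by
  cases l with
  | nil => exact absurd rfl h
  | cons y l => rfl

theorem nestedBracket_replicate_append (x : g) (r : ℕ) {l : List g} (h : l ≠ []) :
    nestedBracket (List.replicate r x ++ l) = (LieAlgebra.ad ℝ g x ^ r) (nestedBracket l) := by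
  induction r with
  | zero => simp
  | succ r ih =>
    rw [List.replicate_succ, List.cons_append, nestedBracket_cons _ (by simp [h]), ih, pow_succ']
    rfl

theorem nestedBracket_map_smul (t : ℝ) (l : List g) :
    nestedBracket (l.map (t • ·)) = t ^ l.length • nestedBracket l := by
  induction l with
  | nil => simp [nestedBracket]
  | cons x l ih =>
    by_cases h : l = []
    · subst h; simp [nestedBracket]
    · rw [List.map_cons, nestedBracket_cons _ (by simpa using h), nestedBracket_cons _ h, ih,
        smul_lie, lie_smul, smul_smul, List.length_cons, pow_succ']

/-- The innermost bracket of two equal letters is zero, so the last block of a word survives only if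
it is the letter `X` alone or ends in exactly one `Y`. -/
theorem nestedBracket_block (X Y : g) (r s : ℕ) :
    nestedBracket (List.replicate r X ++ List.replicate s Y) =
      (if s = 0 then if r = 1 then X else 0 else 0) +
        if s = 1 then (LieAlgebra.ad ℝ g X ^ r) Y else 0 := by
  have hself : ∀ (Z : g) n, nestedBracket (List.replicate n Z) = if n = 1 then Z else 0 := by
    intro Z n
    induction n with
    | zero => simp [nestedBracket]
    | succ n ih =>
      rcases Nat.eq_zero_or_pos n with rfl | hn
      · simp [nestedBracket]
      · rw [List.replicate_succ, nestedBracket_cons _ (by simp; omega), ih]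
        split_ifs with h1 h2 <;> first | (exfalso; omega) | simp
  rcases Nat.eq_zero_or_pos s with rfl | hs
  · simp [hself]
  · rw [nestedBracket_replicate_append _ _ (by simp; omega), hself]
    split_ifs <;> first | (exfalso; omega) | simp

/-- The truncated exponential of `ad X`. -/
noncomputable def expAd (N : ℕ) (X : g) : Module.End ℝ g :=
  ∑ k ∈ Finset.range (N + 1), ((k.factorial : ℝ)⁻¹) • LieAlgebra.ad ℝ g X ^ k

theorem expAd_smul (N : ℕ) (t : ℝ) (X : g) : expAd N (t • X) =
    ∑ k ∈ Finset.range (N + 1), (t ^ k * (k.factorial : ℝ)⁻¹) • LieAlgebra.ad ℝ g X ^ k := by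
  refine Finset.sum_congr rfl fun k _ => ?_
  rw [map_smul, smul_pow, smul_smul, mul_comm]

/-- The list of letters of a word with blocks `X^r Y^s`. -/
def blockWord {N n : ℕ} (X Y : g) (w : Fin n → Fin (N + 1) × Fin (N + 1)) : List g :=
  (List.ofFn fun i => List.replicate (w i).1.val X ++ List.replicate (w i).2.val Y).flatten

/-- The total number of letters of a word. -/
def blockDegree {N n : ℕ} (w : Fin n → Fin (N + 1) × Fin (N + 1)) : ℕ :=
  ∑ i, ((w i).1.val + (w i).2.val)

/-- The product of factorials in Dynkin's coefficients. -/
noncomputable def blockFactorial {N n : ℕ} (w : Fin n → Fin (N + 1) × Fin (N + 1)) : ℝ :=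
  ∏ i, (((w i).1.val.factorial : ℝ) * ((w i).2.val.factorial : ℝ))

theorem blockWord_length {N n : ℕ} (X Y : g) (w : Fin n → Fin (N + 1) × Fin (N + 1)) :
    (blockWord X Y w).length = blockDegree w := by
  simp [blockWord, blockDegree, List.length_flatten, List.sum_ofFn, List.map_ofFn]

theorem blockWord_map {N n : ℕ} (X Y : g) (t : ℝ) (w : Fin n → Fin (N + 1) × Fin (N + 1)) :
    blockWord (t • X) (t • Y) w = (blockWord X Y w).map (t • ·) := by
  simp [blockWord, List.map_flatten, List.map_ofFn, Function.comp_def]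

theorem blockDegree_pos {N n : ℕ} {w : Fin (n + 1) → Fin (N + 1) × Fin (N + 1)}
    (h : ∀ i, 0 < (w i).1.val + (w i).2.val) : 0 < blockDegree w := by
  rw [blockDegree, Fin.sum_univ_succ]
  have := h 0
  omega

theorem sum_fin_succ_cons {P M : Type*} [Fintype P] [AddCommMonoid M] {n : ℕ}
    (φ : (Fin (n + 1) → P) → M) :
    ∑ w, φ w = ∑ p : P, ∑ w : Fin n → P, φ (Fin.cons p w) := by
  rw [← Fintype.sum_prod_type' (f := fun p w => φ (Fin.cons p w))]
  exact (Fintype.sum_equiv (Fin.consEquiv fun _ => P) _ _ fun x => rfl).symm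

/-- The sum of the words with `n + 1` blocks in the derivative of Dynkin's series. -/
noncomputable def dynkinSum (N n : ℕ) (X Y : g) (t : ℝ) : g :=
  ∑ w : Fin (n + 1) → Fin (N + 1) × Fin (N + 1),
    if ∀ i, 0 < (w i).1.val + (w i).2.val then
      (t ^ (blockDegree w - 1) / blockFactorial w) • nestedBracket (blockWord X Y w) else 0

theorem dynkinSum_zero {N : ℕ} (hN : 1 ≤ N) (X Y : g) (t : ℝ) :
    dynkinSum N 0 X Y t = X + expAd N (t • X) Y := by
  rw [dynkinSum, ← (Equiv.funUnique (Fin 1) _).symm.sum_comp]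
  have : ∀ p : Fin (N + 1) × Fin (N + 1),
      (if ∀ i, 0 < (((Equiv.funUnique (Fin 1) _).symm p) i).1.val +
          (((Equiv.funUnique (Fin 1) _).symm p) i).2.val then
        (t ^ (blockDegree ((Equiv.funUnique (Fin 1) _).symm p) - 1) /
          blockFactorial ((Equiv.funUnique (Fin 1) _).symm p)) •
          nestedBracket (blockWord X Y ((Equiv.funUnique (Fin 1) _).symm p)) else 0) =
      (if p.2.val = 0 then if p.1.val = 1 then X else 0 else 0) +
        if p.2.val = 1 then (t ^ p.1.val * (p.1.val.factorial : ℝ)⁻¹) •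
          (LieAlgebra.ad ℝ g X ^ p.1.val) Y else 0 := by
    rintro ⟨⟨r, hr⟩, ⟨s, hs⟩⟩
    simp only [blockDegree, blockFactorial, blockWord, Equiv.funUnique_symm_apply, uniqueElim_const,
      Finset.univ_unique, Finset.sum_const, Finset.card_singleton, one_smul, Finset.prod_const,
      pow_one, List.ofFn_succ, List.ofFn_zero, List.flatten_cons, List.flatten_nil, List.append_nil,
      nestedBracket_block, forall_const]
    by_cases h0 : s = 0
    · by_cases h1 : r = 1
      · subst h0 h1; simp
      · subst h0; simp [h1]
    · by_cases h1 : s = 1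
      · subst h1; simp [div_eq_mul_inv]
      · simp [h0, h1]
  rw [Finset.sum_congr rfl fun p _ => this p, Finset.sum_add_distrib]
  congr 1
  · rw [Fintype.sum_prod_type, Finset.sum_eq_single ⟨1, by omega⟩,
      Finset.sum_eq_single ⟨0, by omega⟩]
    · simp
    · intro b _ hb
      rw [if_neg]
      exact fun h => hb (Fin.ext h)
    · simp
    · intro b _ hb
      refine Finset.sum_eq_zero fun c _ => ?_
      rw [if_neg (fun h => hb (Fin.ext h))]
      simp
    · simp
  · rw [Fintype.sum_prod_type, expAd_smul, LinearMap.sum_apply, Finset.sum_range]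
    refine Finset.sum_congr rfl fun r _ => ?_
    rw [Finset.sum_eq_single ⟨1, by omega⟩]
    · simp
    · intro b _ hb
      rw [if_neg]
      exact fun h => hb (Fin.ext h)
    · simp

/-- A block `X^r Y^s` put in front of a word acts by `(ad X)^r (ad Y)^s`. Summed with the factorial
weights over nonempty blocks this is `exp (t ad X) exp (t ad Y) - 1`, the `1` removing the empty
block. -/
theorem dynkinSum_succ (N n : ℕ) (X Y : g) (t : ℝ) :
    dynkinSum N (n + 1) X Y t =
      (expAd N (t • X) * expAd N (t • Y) - 1) (dynkinSum N n X Y t) := by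
  have hE : expAd N (t • X) * expAd N (t • Y) - 1 =
      ∑ p : Fin (N + 1) × Fin (N + 1), if 0 < p.1.val + p.2.val then
        (t ^ (p.1.val + p.2.val) / ((p.1.val.factorial : ℝ) * (p.2.val.factorial : ℝ))) •
          (LieAlgebra.ad ℝ g X ^ p.1.val * LieAlgebra.ad ℝ g Y ^ p.2.val) else 0 := by
    have h1 : ∀ p : Fin (N + 1) × Fin (N + 1), (if 0 < p.1.val + p.2.val then
        (t ^ (p.1.val + p.2.val) / ((p.1.val.factorial : ℝ) * (p.2.val.factorial : ℝ))) •
          (LieAlgebra.ad ℝ g X ^ p.1.val * LieAlgebra.ad ℝ g Y ^ p.2.val) else 0) =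
        ((t ^ p.1.val * (p.1.val.factorial : ℝ)⁻¹) • LieAlgebra.ad ℝ g X ^ p.1.val) *
        ((t ^ p.2.val * (p.2.val.factorial : ℝ)⁻¹) • LieAlgebra.ad ℝ g Y ^ p.2.val) -
        if p = 0 then 1 else 0 := by
      intro p
      by_cases hp : p = 0
      · subst hp; simp
      · rw [if_pos, if_neg hp, sub_zero, smul_mul_smul_comm]
        · congr 1
          field_simp
          ring
        · by_contra h
          exact hp (Prod.ext (Fin.ext (by change p.1.val = 0; omega))
            (Fin.ext (by change p.2.val = 0; omega)))
    rw [Finset.sum_congr rfl fun p _ => h1 p, Finset.sum_sub_distrib, Finset.sum_ite_eq' ]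
    rw [if_pos (Finset.mem_univ _), expAd_smul, expAd_smul, Finset.sum_range, Finset.sum_range,
      Finset.sum_mul_sum, Fintype.sum_prod_type]
  rw [hE, dynkinSum, sum_fin_succ_cons, LinearMap.sum_apply]
  refine Finset.sum_congr rfl fun p _ => ?_
  by_cases hp : 0 < p.1.val + p.2.val
  · rw [if_pos hp, dynkinSum, map_sum]
    refine Finset.sum_congr rfl fun w _ => ?_
    simp only [Fin.forall_fin_succ (n := n + 1), Fin.cons_zero, Fin.cons_succ, hp, true_and]
    by_cases hw : ∀ i, 0 < (w i).1.val + (w i).2.val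
    · have hpos := blockDegree_pos hw
      have hne : blockWord X Y w ≠ [] := by
        rw [← List.length_pos_iff, blockWord_length]; exact hpos
      have hword : blockWord X Y (Fin.cons p w : Fin (n + 1 + 1) → _) =
          List.replicate p.1.val X ++ (List.replicate p.2.val Y ++ blockWord X Y w) := by
        rw [blockWord, List.ofFn_succ, List.flatten_cons]
        simp [blockWord]
      have hdeg : blockDegree (Fin.cons p w : Fin (n + 1 + 1) → _) - 1 =
          (p.1.val + p.2.val) + (blockDegree w - 1) := by
        rw [blockDegree, Fin.sum_univ_succ]
        simp only [Fin.cons_zero, Fin.cons_succ, ← blockDegree.eq_1]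
        omega
      have hfac : blockFactorial (Fin.cons p w : Fin (n + 1 + 1) → _) =
          ((p.1.val.factorial : ℝ) * (p.2.val.factorial : ℝ)) * blockFactorial w := by
        rw [blockFactorial, Fin.prod_univ_succ]
        simp [blockFactorial]
      rw [if_pos hw, if_pos hw, hword, hdeg, hfac,
        nestedBracket_replicate_append _ _ (by simp [hne]),
        nestedBracket_replicate_append _ _ hne, LinearMap.smul_apply, map_smul, smul_smul]
      congr 1
      rw [pow_add]; field_simp
    · rw [if_neg hw, if_neg hw, map_zero]
  · rw [if_neg hp, LinearMap.zero_apply]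
    refine Finset.sum_eq_zero fun w _ => ?_
    rw [if_neg]
    intro h
    exact hp (by simpa using h 0)

theorem dynkinSum_eq {N : ℕ} (hN : 1 ≤ N) (n : ℕ) (X Y : g) (t : ℝ) :
    dynkinSum N n X Y t =
      ((expAd N (t • X) * expAd N (t • Y) - 1) ^ n) (X + expAd N (t • X) Y) := by
  induction n with
  | zero => simpa using dynkinSum_zero hN X Y t
  | succ n ih => rw [dynkinSum_succ, ih, pow_succ']; rfl

theorem bch_eq (N : ℕ) (X Y : g) :
    bch N X Y = ∑ n ∈ Finset.range N, ((-1 : ℝ) ^ n / (n + 1)) •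
      ∑ w : Fin (n + 1) → Fin (N + 1) × Fin (N + 1),
        if ∀ i, 0 < (w i).1.val + (w i).2.val then
          (((blockDegree w : ℝ) * blockFactorial w)⁻¹) • nestedBracket (blockWord X Y w)
        else 0 := by
  have h : Finset.Icc 1 N = Finset.Ico (0 + 1) (N + 1) := by
    ext; simp only [Finset.mem_Icc, Finset.mem_Ico]; omega
  rw [bch, h, ← Finset.sum_Ico_add', ← Finset.range_eq_Ico]
  refine Finset.sum_congr rfl fun n _ => ?_
  rw [Finset.sum_filter, Finset.smul_sum]
  refine Finset.sum_congr rfl fun w _ => ?_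
  split_ifs with hw
  · rw [smul_smul]
    congr 1
    simp [blockDegree, blockFactorial, div_eq_mul_inv]
  · rw [smul_zero]

theorem bch_smul_smul (N : ℕ) (t : ℝ) (X Y : g) :
    bch N (t • X) (t • Y) = ∑ n ∈ Finset.range N, ((-1 : ℝ) ^ n / (n + 1)) •
      ∑ w : Fin (n + 1) → Fin (N + 1) × Fin (N + 1),
        if ∀ i, 0 < (w i).1.val + (w i).2.val then
          (t ^ blockDegree w * ((blockDegree w : ℝ) * blockFactorial w)⁻¹) •
            nestedBracket (blockWord X Y w)
        else 0 := by
  rw [bch_eq]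
  simp only [blockWord_map, nestedBracket_map_smul, blockWord_length, smul_smul]
  simp only [mul_comm]

theorem bch_zero_zero (N : ℕ) : bch N (0 : g) 0 = 0 := by
  have := bch_smul_smul N 0 (0 : g) 0
  rw [smul_zero] at this
  rw [this]
  refine Finset.sum_eq_zero fun n _ => ?_
  rw [Finset.sum_eq_zero, smul_zero]
  intro w _
  split_ifs with hw
  · rw [zero_pow (blockDegree_pos hw).ne', zero_mul, zero_smul]
  · rfl

end Dynkin

/-! ### The logarithm of a product of two exponentials is Dynkin's series. -/

namespace IsNilpotentRep

variable {g : Type*} [LieRing g] [LieAlgebra ℝ g]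
variable {A : Type*} [NormedRing A] [NormedAlgebra ℝ A] {N : ℕ} {ρ : g →ₗ[ℝ] A}

theorem map_ad_pow_mem (hρ : IsNilpotentRep N ρ) (x y : g) (k : ℕ) :
    ρ ((LieAlgebra.ad ℝ g x ^ k) y) ∈ repFiltration ρ (k + 1) := by
  induction k with
  | zero => exact map_mem_repFiltration ρ y
  | succ k ih =>
    rw [pow_succ', Module.End.mul_apply, LieAlgebra.ad_apply, hρ.map_lie]
    refine sub_mem ?_ (mul_mem_repFiltration ih (map_mem_repFiltration ρ x))
    exact repFiltration_anti ρ (by omega) (mul_mem_repFiltration (map_mem_repFiltration ρ x) ih)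

/-- Differentiating `t ^ blockDegree w` cancels the total degree in Dynkin's denominators; what
remains are the weights of `dynkinSum`. -/
theorem hasDerivAt_map_bch (X Y : g) (t : ℝ) :
    HasDerivAt (fun t : ℝ => ρ (bch N (t • X) (t • Y)))
      (ρ (∑ n ∈ Finset.range N, ((-1 : ℝ) ^ n / (n + 1)) • dynkinSum N n X Y t)) t := by
  simp only [bch_smul_smul, map_sum, map_smul, dynkinSum]
  refine HasDerivAt.fun_sum fun n _ => HasDerivAt.fun_const_smul _ (HasDerivAt.fun_sum fun w _ => ?_)
  split_ifs with hw
  · simp only [map_smul]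
    have hpos := blockDegree_pos hw
    have := (((hasDerivAt_pow (blockDegree w) t).mul_const
      (((blockDegree w : ℝ) * blockFactorial w)⁻¹)).smul_const (ρ (nestedBracket (blockWord X Y w))))
    refine this.congr_deriv ?_
    congr 1
    have : (blockDegree w : ℝ) ≠ 0 := by positivity
    field_simp
  · simpa using hasDerivAt_const t (0 : A)

variable [CompleteSpace A]

/-- This is `Ad (exp X) = exp (ad X)`. With `X` replaced by `t X`, the right side solves `G' = a G -
G a`, so `exp (-t a) G exp (t a)` is constant; truncation costs nothing because the missing term
lies above level `N`. -/
theorem exp_mul_map_mul_exp_neg (hρ : IsNilpotentRep N ρ) (X y : g) :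
    NormedSpace.exp (ρ X) * ρ y * NormedSpace.exp (-ρ X) = ρ (expAd N X y) := by
  let a := ρ X
  let G : ℝ → A := fun t => ρ (expAd N (t • X) y)
  have hGe : ∀ t, G t = ∑ k ∈ Finset.range (N + 1),
      (t ^ k * (k.factorial : ℝ)⁻¹) • ρ ((LieAlgebra.ad ℝ g X ^ k) y) := by
    intro t
    simp only [G, expAd_smul, LinearMap.sum_apply, map_sum, LinearMap.smul_apply, map_smul]
  have hG : ∀ t, HasDerivAt G (a * G t - G t * a) t := by
    intro t
    have h1 : a * G t - G t * a = ∑ k ∈ Finset.range (N + 1),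
        (t ^ k * (k.factorial : ℝ)⁻¹) • ρ ((LieAlgebra.ad ℝ g X ^ (k + 1)) y) := by
      rw [hGe, Finset.mul_sum, Finset.sum_mul, ← Finset.sum_sub_distrib]
      refine Finset.sum_congr rfl fun k _ => ?_
      rw [mul_smul_comm, smul_mul_assoc, ← smul_sub, pow_succ', Module.End.mul_apply,
        LieAlgebra.ad_apply, hρ.map_lie]
    rw [h1, Finset.sum_range_succ, hρ.eq_zero_of_mem (Nat.lt_succ_of_lt (Nat.lt_succ_self N))
      (hρ.map_ad_pow_mem X y (N + 1)), smul_zero, add_zero]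
    have h2 : G = fun t => ∑ k ∈ Finset.range (N + 1),
      (t ^ k * (k.factorial : ℝ)⁻¹) • ρ ((LieAlgebra.ad ℝ g X ^ k) y) := funext hGe
    rw [h2]
    have h3 := HasDerivAt.fun_sum (u := Finset.range (N + 1)) fun k _ =>
      ((hasDerivAt_pow k t).mul_const ((k.factorial : ℝ)⁻¹)).smul_const
        (ρ ((LieAlgebra.ad ℝ g X ^ k) y))
    refine h3.congr_deriv ?_
    rw [Finset.sum_range_succ']
    simp only [Nat.cast_zero, zero_mul, zero_smul, add_zero]
    refine Finset.sum_congr rfl fun k _ => ?_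
    congr 1
    rw [Nat.factorial_succ, Nat.add_sub_cancel]
    push_cast
    field_simp
  have hF : ∀ t : ℝ, HasDerivAt (fun t : ℝ => NormedSpace.exp (t • (-a)) * G t *
      NormedSpace.exp (t • a)) 0 t := by
    intro t
    refine (((hasDerivAt_exp_smul_const (-a) t).mul (hG t)).mul
      (hasDerivAt_exp_smul_const' a t)).congr_deriv ?_
    rw [Pi.mul_apply]
    noncomm_ring
  have := is_const_of_deriv_eq_zero (fun t => (hF t).differentiableAt) (fun t => (hF t).deriv) 1 0
  simp only [one_smul, zero_smul, NormedSpace.exp_zero, one_mul, mul_one, G] at this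
  have h0 : expAd N (0 : g) y = y := by
    have := expAd_smul N 0 (0 : g)
    rw [smul_zero] at this
    rw [this, Finset.sum_range_succ']
    simp
  rw [h0] at this
  rw [← this, ← mul_assoc, ← mul_assoc, NormedSpace.exp_mul_exp_neg_of_real, one_mul, mul_assoc,
    NormedSpace.exp_mul_exp_neg_of_real, mul_one]

/-- The product `P t = exp (t X) exp (t Y)` satisfies `P' = m P` with `m = X + exp (t ad X) Y`. By
`hasDerivAt_truncLog` the derivative of its logarithm is a series in `Ad P - 1` applied to `m`, and
by `dynkinSum_eq` this is the derivative of Dynkin's series. Both functions vanish at `t = 0`. -/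
theorem truncLog_exp_mul_exp (hρ : IsNilpotentRep N ρ) (hN : 1 ≤ N) (X Y : g) :
    truncLog (N + N + 2) (NormedSpace.exp (ρ X) * NormedSpace.exp (ρ Y) - 1) =
      ρ (bch N X Y) := by
  -- Powers of `P t - 1` vanish from the exponent `N + 1` on, and `hasDerivAt_truncLog` asks for
  -- twice this exponent to be at most `K + 1`.
  set K := N + N + 2 with hK
  let P : ℝ → A := fun t => NormedSpace.exp (ρ (t • X)) * NormedSpace.exp (ρ (t • Y))
  let Q : ℝ → A := fun t => NormedSpace.exp (-ρ (t • Y)) * NormedSpace.exp (-ρ (t • X))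
  have hPQ : ∀ t, P t * Q t = 1 := fun t => by
    simp only [P, Q]
    rw [mul_assoc, ← mul_assoc (NormedSpace.exp (ρ (t • Y))),
      NormedSpace.exp_mul_exp_neg_of_real, one_mul, NormedSpace.exp_mul_exp_neg_of_real]
  have hQP : ∀ t, Q t * P t = 1 := fun t => by
    simp only [P, Q]
    rw [mul_assoc, ← mul_assoc (NormedSpace.exp (-ρ (t • X))),
      NormedSpace.exp_neg_mul_exp_of_real, one_mul, NormedSpace.exp_neg_mul_exp_of_real]
  let m : ℝ → g := fun t => X + expAd N (t • X) Y
  have hP : ∀ t, HasDerivAt P (ρ (m t) * P t) t := by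
    intro t
    have h1 := (hasDerivAt_exp_smul_const' (ρ X) t).mul (hasDerivAt_exp_smul_const' (ρ Y) t)
    simp only [← map_smul] at h1
    refine h1.congr_deriv ?_
    simp only [m, map_add, ← hρ.exp_mul_map_mul_exp_neg, P]
    have := NormedSpace.exp_neg_mul_exp_of_real (ρ (t • X))
    rw [add_mul]
    congr 1
    · rw [mul_assoc]
    · rw [mul_assoc _ (NormedSpace.exp (-ρ (t • X))), ← mul_assoc (NormedSpace.exp (-ρ (t • X))),
        this, one_mul, mul_assoc]
  have hmem : ∀ t, P t - 1 ∈ repFiltration ρ 1 := by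
    intro t
    have : P t - 1 = (NormedSpace.exp (ρ (t • X)) - 1) * NormedSpace.exp (ρ (t • Y)) +
        (NormedSpace.exp (ρ (t • Y)) - 1) := by simp only [P]; noncomm_ring
    rw [this]
    exact add_mem (mul_mem_repFiltration_right (hρ.exp_sub_one_mem _) (hρ.exp_mem _))
      (hρ.exp_sub_one_mem _)
  have hconj : ∀ t y, P t * ρ y * Q t - ρ y =
      ρ ((expAd N (t • X) * expAd N (t • Y) - 1) y) := by
    intro t y
    rw [LinearMap.sub_apply, map_sub, Module.End.one_apply, Module.End.mul_apply,
      ← hρ.exp_mul_map_mul_exp_neg, ← hρ.exp_mul_map_mul_exp_neg]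
    simp only [P, Q, mul_assoc]
  have hiter : ∀ t k, (fun x => (1 + (P t - 1)) * x * Q t - x)^[k] (ρ (m t)) =
      ρ (((expAd N (t • X) * expAd N (t • Y) - 1) ^ k) (m t)) := by
    intro t k
    induction k with
    | zero => rfl
    | succ k ih =>
      rw [Function.iterate_succ_apply', ih, add_sub_cancel, hconj, pow_succ']
      rfl
  have hQmem : ∀ t, Q t - 1 ∈ repFiltration ρ 1 := by
    intro t
    have e := hρ.exp_sub_one_mem (-(t • Y))
    have e' := hρ.exp_mem (-(t • X))
    have e'' := hρ.exp_sub_one_mem (-(t • X))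
    rw [map_neg] at e e' e''
    have : Q t - 1 = (NormedSpace.exp (-ρ (t • Y)) - 1) * NormedSpace.exp (-ρ (t • X)) +
        (NormedSpace.exp (-ρ (t • X)) - 1) := by simp only [Q]; noncomm_ring
    rw [this]
    exact add_mem (mul_mem_repFiltration_right e e') e''
  have hnil : ∀ t k, ρ (((expAd N (t • X) * expAd N (t • Y) - 1) ^ k) (m t)) ∈
      repFiltration ρ (k + 1) := by
    intro t k
    induction k with
    | zero => exact map_mem_repFiltration ρ _
    | succ k ih =>
      rw [pow_succ', Module.End.mul_apply, ← hconj]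
      set v := ρ (((expAd N (t • X) * expAd N (t • Y) - 1) ^ k) (m t))
      have : P t * v * Q t - v = (P t - 1) * v * Q t + v * (Q t - 1) := by noncomm_ring
      rw [this]
      have hQ0 : Q t ∈ repFiltration ρ 0 := by
        simpa using add_mem (repFiltration_anti ρ zero_le_one (hQmem t)) (one_mem_repFiltration ρ)
      refine add_mem (mul_mem_repFiltration_right ?_ hQ0) (mul_mem_repFiltration ih (hQmem t))
      rw [add_comm]
      exact mul_mem_repFiltration (hmem t) ih
  have hW : ∀ t, HasDerivAt (fun t => truncLog K (P t - 1)) (ρ (∑ n ∈ Finset.range N,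
      ((-1 : ℝ) ^ n / (n + 1)) • dynkinSum N n X Y t)) t := by
    intro t
    have := hasDerivAt_truncLog (n := fun t => P t - 1) (m := ρ (m t)) (q := Q t) (t := t)
      (M := N + 1) (K := K) (hρ.eq_zero_of_mem (Nat.lt_succ_self N)
        (pow_mem_repFiltration (hmem t) (N + 1)))
      (by simpa using (hP t).sub_const 1) (by simpa using hPQ t) (by simpa using hQP t) (by omega)
    refine this.congr_deriv ?_
    simp only [hiter, map_sum, map_smul, dynkinSum_eq hN]
    symm
    -- The logarithm is summed up to `K` and Dynkin's series up to `N`; the terms in between lie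
    -- above filtration level `N`.
    refine Finset.sum_subset (Finset.range_mono (by omega)) fun k _ hk => ?_
    rw [hρ.eq_zero_of_mem (by simpa [Nat.lt_succ_iff] using hk) (hnil t k), smul_zero]
  have := is_const_of_deriv_eq_zero
    (f := (fun t => truncLog K (P t - 1)) - fun t => ρ (bch N (t • X) (t • Y)))
    (fun t => ((hW t).sub (hasDerivAt_map_bch X Y t)).differentiableAt)
    (fun t => by rw [((hW t).sub (hasDerivAt_map_bch X Y t)).deriv, sub_self]) 1 0
  simp only [Pi.sub_apply, P, one_smul, zero_smul, map_zero, NormedSpace.exp_zero, mul_one,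
    sub_self, bch_zero_zero] at this
  rw [sub_eq_zero.1 (this.trans (by simp [truncLog]))]

/-- For `Y = 0` the operator in `dynkinSum_eq` is `exp (t ad X) - 1`, which kills `X`, so only the
first term of the derivative remains. Inserted in `truncLog_exp_mul_exp`, this shows that the
truncated logarithm inverts the exponential. -/
theorem bch_zero_right (hρ : IsNilpotentRep N ρ) (hN : 1 ≤ N) (X : g) : bch N X 0 = X := by
  obtain ⟨M, rfl⟩ : ∃ M, N = M + 1 := ⟨N - 1, by omega⟩
  have had : ∀ Y : g, expAd (M + 1) Y (0 : g) = 0 := fun Y => map_zero _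
  have had0 : expAd (M + 1) (0 : g) = 1 := by
    have := expAd_smul (M + 1) 0 (0 : g)
    rw [smul_zero] at this
    rw [this, Finset.sum_range_succ']
    simp
  have hz : ∀ (t : ℝ) (n : ℕ), ((expAd (M + 1) (t • X) - 1 : Module.End ℝ g) ^ (n + 1)) X = 0 := by
    intro t n
    have hX : (expAd (M + 1) (t • X) - 1 : Module.End ℝ g) X = 0 := by
      rw [expAd_smul, Finset.sum_range_succ']
      simp [LinearMap.sum_apply, pow_succ]
    rw [pow_succ, Module.End.mul_apply, hX, map_zero]
  have h1 : ∀ t, HasDerivAt (fun t : ℝ => ρ (bch (M + 1) (t • X) (t • (0 : g)))) (ρ X) t := by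
    intro t
    refine (hasDerivAt_map_bch X 0 t).congr_deriv ?_
    congr 1
    rw [Finset.sum_range_succ']
    simp only [dynkinSum_eq hN, smul_zero, had0, mul_one, had, add_zero, hz]
    simp
  have h2 : ∀ t : ℝ, HasDerivAt (fun t : ℝ => t • ρ X) (ρ X) t := fun t => by
    simpa using (hasDerivAt_id t).smul_const (ρ X)
  have := is_const_of_deriv_eq_zero
    (f := (fun t : ℝ => ρ (bch (M + 1) (t • X) (t • (0 : g)))) - fun t : ℝ => t • ρ X)
    (fun t => ((h1 t).sub (h2 t)).differentiableAt)
    (fun t => by rw [((h1 t).sub (h2 t)).deriv, sub_self]) 1 0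
  simp only [Pi.sub_apply, one_smul, zero_smul, smul_zero, bch_zero_zero, map_zero, sub_self]
    at this
  exact hρ.injective (sub_eq_zero.1 this)

theorem truncLog_exp (hρ : IsNilpotentRep N ρ) (hN : 1 ≤ N) (X : g) :
    truncLog (N + N + 2) (NormedSpace.exp (ρ X) - 1) = ρ X := by
  have := hρ.truncLog_exp_mul_exp hN X 0
  rwa [map_zero, NormedSpace.exp_zero, mul_one, hρ.bch_zero_right hN] at this

/-- The Baker-Campbell-Hausdorff theorem. -/
theorem exp_bch (hρ : IsNilpotentRep N ρ) (hN : 1 ≤ N) (X Y : g) :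
    NormedSpace.exp (ρ (bch N X Y)) = NormedSpace.exp (ρ X) * NormedSpace.exp (ρ Y) := by
  have h := hρ.truncLog_injOn (K := N + N + 2) (by omega) (hρ.exp_sub_one_mem (bch N X Y))
    (y := NormedSpace.exp (ρ X) * NormedSpace.exp (ρ Y) - 1) (by
      have : NormedSpace.exp (ρ X) * NormedSpace.exp (ρ Y) - 1 =
        (NormedSpace.exp (ρ X) - 1) * NormedSpace.exp (ρ Y) + (NormedSpace.exp (ρ Y) - 1) := by
          noncomm_ring
      rw [this]
      exact add_mem (mul_mem_repFiltration_right (hρ.exp_sub_one_mem _) (hρ.exp_mem _))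
        (hρ.exp_sub_one_mem _))
    (by rw [hρ.truncLog_exp hN, hρ.truncLog_exp_mul_exp hN])
  exact sub_left_injective h

theorem exp_injective (hρ : IsNilpotentRep N ρ) (hN : 1 ≤ N) {X Y : g}
    (h : NormedSpace.exp (ρ X) = NormedSpace.exp (ρ Y)) : X = Y := by
  apply hρ.injective
  rw [← hρ.truncLog_exp hN X, h, hρ.truncLog_exp hN]

end IsNilpotentRep

/-! ### Algebra of stratified Lie algebras and their groups -/

section BCHExpansion

variable {g : Type*} [LieRing g] [LieAlgebra ℝ g]

theorem map_nestedBracket {h : Type*} [LieRing h] [LieAlgebra ℝ h] (T : g →ₗ⁅ℝ⁆ h) (l : List g) :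
    T (nestedBracket l) = nestedBracket (l.map T) := by
  induction l with
  | nil => simp [nestedBracket]
  | cons x l ih =>
    by_cases hl : l = []
    · subst hl; simp [nestedBracket]
    · rw [List.map_cons, nestedBracket_cons _ hl, nestedBracket_cons _ (by simpa using hl),
        LieHom.map_lie, ih]

theorem blockWord_map_fun {α : Type*} (f : α → g) {N n : ℕ} (a b : α)
    (w : Fin n → Fin (N + 1) × Fin (N + 1)) : blockWord (f a) (f b) w =
      ((List.ofFn fun i => List.replicate (w i).1.val a ++
        List.replicate (w i).2.val b).flatten).map f := by
  simp [blockWord, List.map_flatten, List.map_ofFn, Function.comp_def]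

theorem map_bch {h : Type*} [LieRing h] [LieAlgebra ℝ h] (T : g →ₗ⁅ℝ⁆ h) (N : ℕ) (X Y : g) :
    T (bch N X Y) = bch N (T X) (T Y) := by
  rw [bch_eq, bch_eq, map_sum]
  refine Finset.sum_congr rfl fun n _ => ?_
  rw [map_smul, map_sum]
  congr 1
  refine Finset.sum_congr rfl fun w _ => ?_
  split_ifs
  · rw [map_smul, map_nestedBracket, blockWord_map_fun T]
    rfl
  · exact map_zero T

theorem expAd_zero (N : ℕ) : expAd N (0 : g) = 1 := by
  have := expAd_smul N 0 (0 : g)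
  rw [smul_zero] at this
  rw [this, Finset.sum_range_succ']
  simp

/-- The Baker-Campbell-Hausdorff series is `X + Y` plus a combination of brackets. -/
theorem bch_eq_add {N : ℕ} (hN : 1 ≤ N) : ∃ κ : (n : ℕ) →
    (Fin (n + 1) → Fin (N + 1) × Fin (N + 1)) → ℝ, (∀ n w, blockDegree w < 2 → κ n w = 0) ∧
    ∀ X Y : g, bch N X Y = X + Y + ∑ n ∈ Finset.range N,
      ∑ w : Fin (n + 1) → Fin (N + 1) × Fin (N + 1), κ n w • nestedBracket (blockWord X Y w) := by
  -- The linear part is the derivative of the series at `t = 0`. In it the factor `0 ^ (blockDegree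
  -- w - 1)` selects the words with one letter, and subtracting it cancels exactly their
  -- coefficients.
  refine ⟨fun n w => if ∀ i, 0 < (w i).1.val + (w i).2.val then ((-1 : ℝ) ^ n / (n + 1)) *
    (((blockDegree w : ℝ) * blockFactorial w)⁻¹ - 0 ^ (blockDegree w - 1) / blockFactorial w)
    else 0, ?_, ?_⟩
  · intro n w hw
    beta_reduce
    split_ifs with h
    · have : blockDegree w = 1 := by have := blockDegree_pos h; omega
      rw [this]
      simp
    · rfl
  · intro X Y
    have h0 : X + Y = ∑ n ∈ Finset.range N, ((-1 : ℝ) ^ n / (n + 1)) • dynkinSum N n X Y 0 := by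
      obtain ⟨M, rfl⟩ : ∃ M, N = M + 1 := ⟨N - 1, by omega⟩
      simp only [dynkinSum_eq hN, zero_smul, expAd_zero, mul_one, sub_self]
      rw [Finset.sum_range_succ']
      simp
    rw [bch_eq, h0, ← Finset.sum_add_distrib]
    refine Finset.sum_congr rfl fun n _ => ?_
    rw [dynkinSum, Finset.smul_sum, Finset.smul_sum, ← Finset.sum_add_distrib]
    refine Finset.sum_congr rfl fun w _ => ?_
    by_cases hw : ∀ i, 0 < (w i).1.val + (w i).2.val
    · simp only [if_pos hw]
      module
    · simp only [if_neg hw]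
      simp

theorem nestedBracket_map_eq_zero {α : Type*} (φ : α → g) (h : ∀ a b, ⁅φ a, φ b⁆ = 0)
    (l : List α) (hl : 2 ≤ l.length) : nestedBracket (l.map φ) = 0 := by
  induction l with
  | nil => simp at hl
  | cons x l ih =>
    match l with
    | [] => simp at hl
    | [y] => exact h x y
    | y :: z :: l =>
      rw [List.map_cons, nestedBracket_cons _ (by simp), ih (by simp), lie_zero]

theorem bch_of_lie_eq_zero {N : ℕ} (hN : 1 ≤ N) {X Y : g} (h : ⁅X, Y⁆ = 0) :
    bch N X Y = X + Y := by
  obtain ⟨κ, hκ, hb⟩ := bch_eq_add (g := g) hN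
  rw [hb, add_eq_left]
  refine Finset.sum_eq_zero fun n _ => Finset.sum_eq_zero fun w _ => ?_
  rcases lt_or_ge (blockDegree w) 2 with hw | hw
  · rw [hκ n w hw, zero_smul]
  · have := blockWord_map_fun (fun b : Bool => if b then X else Y) true false w
    simp only [if_true, Bool.false_eq_true, if_false] at this
    rw [← blockWord_length X Y, this, List.length_map] at hw
    rw [this, nestedBracket_map_eq_zero _ _ _ hw, smul_zero]
    have h' : ⁅Y, X⁆ = 0 := by rw [← lie_skew, h, neg_zero]
    intro a b
    cases a <;> cases b <;> simp [h, h']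

end BCHExpansion

/-! ### Projections, dilations and the filtration by layers. -/

namespace Stratification

variable {g : Type*} [LieRing g] [LieAlgebra ℝ g] (S : Stratification g)

theorem one_le_step : 1 ≤ S.step := by
  rcases Nat.eq_zero_or_pos S.step with h | h
  · exact absurd (h ▸ S.layer_zero) S.layer_step
  · exact h

theorem bijective_coeLinearMap : Function.Bijective (DirectSum.coeLinearMap S.layer) :=
  S.isInternal

/-- The projection onto a layer. -/
noncomputable def proj (j : ℕ) : g →ₗ[ℝ] g :=
  (S.layer j).subtype ∘ₗ DirectSum.component ℝ ℕ (fun i => S.layer i) j ∘ₗ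
    (LinearEquiv.ofBijective (DirectSum.coeLinearMap S.layer) S.bijective_coeLinearMap).symm.toLinearMap

theorem proj_mem (j : ℕ) (X : g) : S.proj j X ∈ S.layer j := Submodule.coe_mem _

theorem proj_of_mem {j : ℕ} {X : g} (h : X ∈ S.layer j) (i : ℕ) :
    S.proj i X = if i = j then X else 0 := by
  have : (LinearEquiv.ofBijective (DirectSum.coeLinearMap S.layer) S.bijective_coeLinearMap).symm X =
      DirectSum.lof ℝ ℕ (fun i => S.layer i) j ⟨X, h⟩ := by
    rw [LinearEquiv.symm_apply_eq, LinearEquiv.ofBijective_apply, DirectSum.coeLinearMap_lof]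
  simp only [proj, LinearMap.comp_apply, LinearEquiv.coe_coe, this]
  split_ifs with hij
  · subst hij; simp [DirectSum.component.lof_self]
  · rw [DirectSum.component.of, dif_neg (Ne.symm hij)]; rfl

theorem proj_same {j : ℕ} {X : g} (h : X ∈ S.layer j) : S.proj j X = X := by
  rw [S.proj_of_mem h, if_pos rfl]

theorem proj_ne {i j : ℕ} {X : g} (h : X ∈ S.layer j) (hij : i ≠ j) : S.proj i X = 0 := by
  rw [S.proj_of_mem h, if_neg hij]

theorem proj_proj (i j : ℕ) (X : g) : S.proj i (S.proj j X) = if i = j then S.proj j X else 0 :=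
  S.proj_of_mem (S.proj_mem j X) i

@[elab_as_elim]
theorem layer_induction {p : g → Prop} (X : g) (mem : ∀ j, ∀ x ∈ S.layer j, p x)
    (add : ∀ x y, p x → p y → p (x + y)) : p X :=
  Submodule.iSup_induction S.layer (motive := p)
    (by rw [S.isInternal.submodule_iSup_eq_top]; trivial) mem (mem 0 0 (zero_mem _)) add

theorem proj_of_lt {j : ℕ} (h : S.step < j) (X : g) : S.proj j X = 0 := by
  simpa [S.layer_of_lt j h] using S.proj_mem j X

theorem proj_zero_layer (X : g) : S.proj 0 X = 0 := by
  simpa [S.layer_zero] using S.proj_mem 0 X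

theorem sum_proj (X : g) : ∑ j ∈ Finset.range (S.step + 1), S.proj j X = X := by
  induction X using S.layer_induction with
  | mem j x hx =>
    rcases lt_or_ge S.step j with h | h
    · rw [S.layer_of_lt j h, Submodule.mem_bot] at hx
      simp [hx]
    · rw [Finset.sum_eq_single j (fun i _ hij => S.proj_ne hx hij)
        (fun hj => absurd (Finset.mem_range.2 (by omega)) hj), S.proj_same hx]
  | add x y hx hy => simp only [map_add, Finset.sum_add_distrib, hx, hy]

theorem eq_of_proj {X Y : g} (h : ∀ j, S.proj j X = S.proj j Y) : X = Y := by
  rw [← S.sum_proj X, ← S.sum_proj Y]; simp only [h]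

/-- The axioms speak only of brackets with the first layer. Writing an element of a higher layer as
a sum of brackets, the Jacobi identity reduces to smaller `j`, at the price of a larger `i`; hence
the induction with `i`, `x`, `y` general. -/
theorem lie_mem_layer {i j : ℕ} {x y : g} (hx : x ∈ S.layer i) (hy : y ∈ S.layer j) :
    ⁅x, y⁆ ∈ S.layer (i + j) := by
  rcases Nat.eq_zero_or_pos i with rfl | hi
  · have : x = 0 := by simpa [S.layer_zero] using hx
    rw [this, zero_lie]; exact zero_mem _
  induction j generalizing i x y with
  | zero =>
    have : y = 0 := by simpa [S.layer_zero] using hy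
    rw [this, lie_zero]; exact zero_mem _
  | succ j ih =>
    rcases Nat.eq_zero_or_pos j with rfl | hj
    · rw [zero_add] at hy ⊢
      rw [S.layer_succ i hi]
      exact Submodule.subset_span ⟨x, hx, y, hy, rfl⟩
    · rw [S.layer_succ j hj] at hy
      induction hy using Submodule.span_induction with
      | mem z hz =>
        obtain ⟨a, ha, b, hb, rfl⟩ := hz
        have hxb : ⁅x, b⁆ ∈ S.layer (i + 1) := by
          rw [S.layer_succ i hi]
          exact Submodule.subset_span ⟨x, hx, b, hb, rfl⟩
        have h1 : ⁅⁅x, a⁆, b⁆ ∈ S.layer (i + (j + 1)) := by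
          rw [← add_assoc, S.layer_succ (i + j) (by omega)]
          exact Submodule.subset_span ⟨_, ih hx ha hi, b, hb, rfl⟩
        have h2 : ⁅⁅x, b⁆, a⁆ ∈ S.layer (i + (j + 1)) := by
          have := ih hxb ha (by omega)
          rwa [show i + 1 + j = i + (j + 1) by omega] at this
        have h3 : ⁅x, ⁅a, b⁆⁆ = ⁅⁅x, a⁆, b⁆ - ⁅⁅x, b⁆, a⁆ := by
          rw [leibniz_lie, ← lie_skew a]; abel
        rw [h3]; exact sub_mem h1 h2
      | zero => rw [lie_zero]; exact zero_mem _
      | add a b _ _ ha hb => rw [lie_add]; exact add_mem ha hb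
      | smul c a _ ha => rw [lie_smul]; exact Submodule.smul_mem _ _ ha

/-- The linear map which multiplies the `j`-th layer by `c j`. -/
noncomputable def scale (c : ℕ → ℝ) : g →ₗ[ℝ] g :=
  ∑ j ∈ Finset.range (S.step + 1), c j • S.proj j

theorem scale_of_mem (c : ℕ → ℝ) {j : ℕ} {X : g} (h : X ∈ S.layer j) :
    S.scale c X = c j • X := by
  rcases lt_or_ge S.step j with hj | hj
  · rw [S.layer_of_lt j hj, Submodule.mem_bot] at h
    simp [h]
  · simp only [scale, LinearMap.sum_apply, LinearMap.smul_apply]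
    rw [Finset.sum_eq_single j (fun i _ hij => by rw [S.proj_ne h hij, smul_zero])
      (fun hj' => absurd (Finset.mem_range.2 (by omega)) hj'), S.proj_same h]

theorem proj_scale (c : ℕ → ℝ) (j : ℕ) (X : g) : S.proj j (S.scale c X) = c j • S.proj j X := by
  induction X using S.layer_induction with
  | mem i x hx =>
    rw [S.scale_of_mem c hx, map_smul, S.proj_of_mem hx]
    split_ifs with h
    · rw [h]
    · simp
  | add x y hx hy => simp only [map_add, hx, hy, smul_add]

theorem scale_eq_sum (c : ℕ → ℝ) (X : g) :
    S.scale c X = ∑ j ∈ Finset.range (S.step + 1), c j • S.proj j X := by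
  simp [scale]

theorem euler_lie (x y : g) : S.scale (fun j => (j : ℝ)) ⁅x, y⁆ =
    ⁅S.scale (fun j => (j : ℝ)) x, y⁆ + ⁅x, S.scale (fun j => (j : ℝ)) y⁆ := by
  induction x using S.layer_induction with
  | add a b ha hb => simp only [add_lie, map_add, ha, hb]; abel
  | mem i x hx =>
    induction y using S.layer_induction with
    | add a b ha hb => simp only [lie_add, map_add, ha, hb]; abel
    | mem j y hy =>
      rw [S.scale_of_mem _ hx, S.scale_of_mem _ hy, S.scale_of_mem _ (S.lie_mem_layer hx hy)]
      rw [smul_lie, lie_smul]; push_cast; module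

theorem euler_injective : Function.Injective (S.scale fun j => (j : ℝ)) := by
  intro X Y h
  refine S.eq_of_proj fun j => ?_
  have := congrArg (S.proj j) h
  rw [proj_scale, proj_scale] at this
  rcases Nat.eq_zero_or_pos j with rfl | hj
  · rw [S.proj_zero_layer, S.proj_zero_layer]
  · exact smul_right_injective g (by positivity : (j : ℝ) ≠ 0) this

/-- The dilation `δₛ`. -/
noncomputable def dil (s : ℝ) : g →ₗ⁅ℝ⁆ g :=
  { S.scale (fun j => s ^ j) with
    map_lie' := by
      intro x y
      change S.scale _ _ = ⁅S.scale _ _, S.scale _ _⁆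
      induction x using S.layer_induction with
      | add a b ha hb => simp only [add_lie, map_add, ha, hb]
      | mem i x hx =>
        induction y using S.layer_induction with
        | add a b ha hb => simp only [lie_add, map_add, ha, hb]
        | mem j y hy =>
          rw [S.scale_of_mem _ hx, S.scale_of_mem _ hy, S.scale_of_mem _ (S.lie_mem_layer hx hy)]
          rw [smul_lie, lie_smul, smul_smul, pow_add] }

theorem dil_apply (s : ℝ) (X : g) : S.dil s X = S.scale (fun j => s ^ j) X := rfl

theorem dil_of_mem (s : ℝ) {j : ℕ} {X : g} (h : X ∈ S.layer j) : S.dil s X = s ^ j • X :=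
  S.scale_of_mem _ h

theorem proj_dil (s : ℝ) (j : ℕ) (X : g) : S.proj j (S.dil s X) = s ^ j • S.proj j X :=
  S.proj_scale _ j X

theorem dil_dil (s t : ℝ) (X : g) : S.dil s (S.dil t X) = S.dil (s * t) X :=
  S.eq_of_proj fun j => by rw [proj_dil, proj_dil, proj_dil, smul_smul, mul_pow]

theorem dil_one (X : g) : S.dil 1 X = X :=
  S.eq_of_proj fun j => by rw [proj_dil, one_pow, one_smul]

/-- The sum of the layers of index at least `k`. -/
noncomputable def ge (k : ℕ) : Submodule ℝ g := ⨅ j, ⨅ _ : j < k, LinearMap.ker (S.proj j)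

theorem mem_ge {k : ℕ} {X : g} : X ∈ S.ge k ↔ ∀ j < k, S.proj j X = 0 := by
  simp [ge, Submodule.mem_iInf]

theorem ge_anti {a b : ℕ} (h : a ≤ b) : S.ge b ≤ S.ge a := fun _ hX =>
  S.mem_ge.2 fun j hj => S.mem_ge.1 hX j (hj.trans_le h)

theorem mem_ge_one (X : g) : X ∈ S.ge 1 := S.mem_ge.2 fun j hj => by
  obtain rfl : j = 0 := by omega
  exact S.proj_zero_layer X

theorem eq_zero_of_mem_ge {k : ℕ} (hk : S.step < k) {X : g} (h : X ∈ S.ge k) : X = 0 := by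
  rw [← S.sum_proj X]
  exact Finset.sum_eq_zero fun j hj => S.mem_ge.1 h j (by rw [Finset.mem_range] at hj; omega)

theorem layer_le_ge {j k : ℕ} (h : k ≤ j) : S.layer j ≤ S.ge k := fun _ hX =>
  S.mem_ge.2 fun i hi => S.proj_ne hX (by omega)

theorem ge_induction {k : ℕ} {p : g → Prop} {X : g} (hX : X ∈ S.ge k)
    (mem : ∀ j, k ≤ j → ∀ x ∈ S.layer j, p x) (add : ∀ x y, p x → p y → p (x + y)) : p X := by
  have h0 : p 0 := mem k le_rfl 0 (zero_mem _)
  rw [← S.sum_proj X]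
  refine Finset.sum_induction _ p add h0 fun j _ => ?_
  rcases lt_or_ge j k with h | h
  · rw [S.mem_ge.1 hX j h]; exact h0
  · exact mem j h _ (S.proj_mem j X)

theorem lie_mem_ge {a b : ℕ} {x y : g} (hx : x ∈ S.ge a) (hy : y ∈ S.ge b) :
    ⁅x, y⁆ ∈ S.ge (a + b) := by
  refine S.ge_induction (p := fun x => ⁅x, y⁆ ∈ S.ge (a + b)) hx (fun i hi x hx => ?_)
    fun u v hu hv => by rw [add_lie]; exact add_mem hu hv
  exact S.ge_induction (p := fun y => ⁅x, y⁆ ∈ S.ge (a + b)) hy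
    (fun j hj y hy => S.layer_le_ge (by omega) (S.lie_mem_layer hx hy))
    fun u v hu hv => by rw [lie_add]; exact add_mem hu hv

theorem sub_proj_mem_ge {k : ℕ} {X : g} (hX : X ∈ S.ge k) : X - S.proj k X ∈ S.ge (k + 1) :=
  S.mem_ge.2 fun j hj => by
    rw [map_sub, proj_proj]
    split_ifs with h
    · rw [h, sub_self]
    · rw [S.mem_ge.1 hX j (by omega), sub_zero]

/-- Everything lies in `ge 1`, so each bracket raises the filtration index by at least one: an error
in `ge k` in the letters becomes an error in `ge (k + 1)` as soon as there is a bracket at all. -/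
theorem nestedBracket_sub_mem {α : Type*} {k : ℕ} {φ ψ : α → g}
    (h : ∀ a, φ a - ψ a ∈ S.ge k) (l : List α) :
    nestedBracket (l.map φ) - nestedBracket (l.map ψ) ∈ S.ge k ∧
      (2 ≤ l.length → nestedBracket (l.map φ) - nestedBracket (l.map ψ) ∈ S.ge (k + 1)) := by
  induction l with
  | nil => exact ⟨by simp [nestedBracket], by simp⟩
  | cons x l ih =>
    by_cases hl : l = []
    · subst hl
      exact ⟨by simpa [nestedBracket] using h x, by simp⟩
    · rw [List.map_cons, nestedBracket_cons _ (by simpa using hl), List.map_cons,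
        nestedBracket_cons _ (by simpa using hl)]
      have : ⁅φ x, nestedBracket (l.map φ)⁆ - ⁅ψ x, nestedBracket (l.map ψ)⁆ =
          ⁅φ x - ψ x, nestedBracket (l.map φ)⁆ +
          ⁅ψ x, nestedBracket (l.map φ) - nestedBracket (l.map ψ)⁆ := by
        rw [sub_lie, lie_sub]; abel
      have hmem : ⁅φ x, nestedBracket (l.map φ)⁆ - ⁅ψ x, nestedBracket (l.map ψ)⁆ ∈
          S.ge (k + 1) := by
        rw [this]
        refine add_mem (S.lie_mem_ge (h x) (S.mem_ge_one _)) ?_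
        rw [add_comm]
        exact S.lie_mem_ge (S.mem_ge_one _) ih.1
      exact ⟨S.ge_anti (by omega) hmem, fun _ => hmem⟩

/-- Only the linear part of the series sees `R` and `R'` to leading order, the brackets being
covered by `nestedBracket_sub_mem`. All the approximations in the group layer by layer rest on this.
-/
theorem bch_add_sub_mem {k : ℕ} {R R' : g} (hR : R ∈ S.ge k) (hR' : R' ∈ S.ge k) (X Y : g) :
    bch S.step (X + R) (Y + R') - bch S.step X Y - (R + R') ∈ S.ge (k + 1) := by
  obtain ⟨κ, hκ, hb⟩ := bch_eq_add (g := g) S.one_le_step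
  have e : bch S.step (X + R) (Y + R') - bch S.step X Y - (R + R') =
      ∑ n ∈ Finset.range S.step, ∑ w : Fin (n + 1) → Fin (S.step + 1) × Fin (S.step + 1),
        κ n w • (nestedBracket (blockWord (X + R) (Y + R') w) -
          nestedBracket (blockWord X Y w)) := by
    rw [hb, hb]
    simp only [smul_sub, Finset.sum_sub_distrib]
    abel
  rw [e]
  refine Submodule.sum_mem _ fun n _ => Submodule.sum_mem _ fun w _ => ?_
  rcases lt_or_ge (blockDegree w) 2 with hw | hw
  · rw [hκ n w hw, zero_smul]; exact zero_mem _
  · refine Submodule.smul_mem _ _ ?_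
    have h1 := blockWord_map_fun (fun b : Bool => if b then X + R else Y + R') true false w
    have h2 := blockWord_map_fun (fun b : Bool => if b then X else Y) true false w
    simp only [if_true, Bool.false_eq_true, if_false] at h1 h2
    rw [← blockWord_length X Y, h2, List.length_map] at hw
    rw [h1, h2]
    refine (S.nestedBracket_sub_mem ?_ _).2 hw
    intro a
    cases a <;> simp [hR, hR']

theorem proj_one_bch (X Y : g) : S.proj 1 (bch S.step X Y) = S.proj 1 X + S.proj 1 Y := by
  have := S.bch_add_sub_mem (S.mem_ge_one X) (S.mem_ge_one Y) 0 0
  rw [zero_add, zero_add, bch_zero_zero, sub_zero] at this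
  have := S.mem_ge.1 this 1 (by omega)
  rwa [map_sub, map_add, sub_eq_zero] at this

end Stratification

/-! ### An auxiliary norm on the Lie algebra. -/

section LieNorm

/-- The norm of a finite-dimensional Lie algebra given by the coordinates. -/
@[reducible]
noncomputable def lieNormedAddCommGroup (g : Type*) [LieRing g] [LieAlgebra ℝ g]
    [FiniteDimensional ℝ g] : NormedAddCommGroup g :=
  NormedAddCommGroup.induced g (Fin (Module.finrank ℝ g) → ℝ)
    (StratifiedGroup.coords g).toLinearMap (StratifiedGroup.coords g).injective

attribute [local instance 10] lieNormedAddCommGroup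

/-- The normed space structure of a finite-dimensional Lie algebra given by the coordinates. -/
@[reducible]
noncomputable def lieNormedSpace (g : Type*) [LieRing g] [LieAlgebra ℝ g]
    [FiniteDimensional ℝ g] : NormedSpace ℝ g :=
  NormedSpace.induced ℝ g (Fin (Module.finrank ℝ g) → ℝ) (StratifiedGroup.coords g).toLinearMap

end LieNorm

attribute [local instance 10] lieNormedAddCommGroup
attribute [local instance 10] lieNormedSpace

/-! ### A faithful nilpotent representation of a stratified Lie algebra. -/

namespace Stratification

variable {g : Type*} [LieRing g] [LieAlgebra ℝ g] [FiniteDimensional ℝ g] (S : Stratification g)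

/-- The operators on `g × ℝ`, which is `g` extended by the degree derivation. -/
abbrev RepAlgebra (g : Type*) [LieRing g] [LieAlgebra ℝ g] [FiniteDimensional ℝ g] : Type _ :=
  (g × ℝ) →L[ℝ] (g × ℝ)

theorem completeSpace_repAlgebra : CompleteSpace (RepAlgebra g) := by
  have : CompleteSpace g := FiniteDimensional.complete ℝ g
  infer_instance

/-- The restriction to `g` of the adjoint representation of the extension of `g` by the degree
derivation. -/
noncomputable def rep : g →ₗ[ℝ] RepAlgebra g :=
  (LinearMap.toContinuousLinearMap (E := g × ℝ) (F' := g × ℝ)).toLinearMap ∘ₗ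
    { toFun := fun X => (((LieAlgebra.ad ℝ g X : g →ₗ[ℝ] g) ∘ₗ LinearMap.fst ℝ g ℝ) +
        (LinearMap.snd ℝ g ℝ).smulRight (S.scale (fun j => (j : ℝ)) X)).prod 0
      map_add' := fun X Y => by
        ext v <;> simp
      map_smul' := fun c X => by
        ext v <;> simp }

theorem rep_apply (X : g) (v : g × ℝ) :
    S.rep X v = (⁅X, v.1⁆ + v.2 • S.scale (fun j => (j : ℝ)) X, 0) := rfl

/-- The adjoint representation alone would kill the centre. On the extra vector `(0, 1)` the
operator of `X` gives the degree derivation of `X`, which is injective since all the nonzero layers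
have positive index. After the first operator the vector lies in `g × 0`, and every further one
raises the filtration index. -/
theorem isNilpotentRep : IsNilpotentRep S.step S.rep where
  map_lie X Y := by
    refine ContinuousLinearMap.ext fun v => ?_
    rw [_root_.sub_apply, mul_apply_eq_comp, mul_apply_eq_comp]
    simp only [rep_apply, Prod.mk_sub_mk, sub_self, zero_smul, add_zero, S.euler_lie]
    rw [lie_add, lie_add, lie_smul, lie_smul, lie_lie, ← lie_skew (S.scale _ X) Y]
    congr 1
    module
  prod_eq_zero l hl := by
    have key : ∀ l : List g, 0 < l.length → ∀ v : g × ℝ,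
        ((l.map S.rep).prod v).1 ∈ S.ge l.length ∧ ((l.map S.rep).prod v).2 = 0 := by
      intro l
      induction l with
      | nil => simp
      | cons X l ih =>
        intro _ v
        rw [List.map_cons, List.prod_cons, mul_apply_eq_comp, rep_apply]
        refine ⟨?_, rfl⟩
        by_cases h : l = []
        · subst h; exact S.mem_ge_one _
        · obtain ⟨h1, h2⟩ := ih (List.length_pos_iff.2 h) v
          rw [h2, zero_smul, add_zero, List.length_cons, add_comm]
          exact S.lie_mem_ge (S.mem_ge_one X) h1
    refine ContinuousLinearMap.ext fun v => ?_
    obtain ⟨h1, h2⟩ := key l (by omega) v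
    exact Prod.ext (S.eq_zero_of_mem_ge hl h1) h2
  injective X Y h := by
    have := congrArg (fun T : RepAlgebra g => (T (0, 1)).1) h
    simp only [rep_apply, lie_zero, zero_add, one_smul] at this
    exact S.euler_injective this

/-- The faithful linear representation of the group. -/
noncomputable def expRep (X : g) : RepAlgebra g := NormedSpace.exp (S.rep X)

theorem expRep_bch (X Y : g) : S.expRep (bch S.step X Y) = S.expRep X * S.expRep Y :=
  have := completeSpace_repAlgebra (g := g)
  S.isNilpotentRep.exp_bch S.one_le_step X Y

theorem expRep_injective : Function.Injective S.expRep := fun _ _ h =>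
  have := completeSpace_repAlgebra (g := g)
  S.isNilpotentRep.exp_injective S.one_le_step h

theorem expRep_zero : S.expRep 0 = 1 := by rw [expRep, map_zero, NormedSpace.exp_zero]

theorem expRep_neg_mul (X : g) : S.expRep (-X) * S.expRep X = 1 := by
  have := completeSpace_repAlgebra (g := g)
  rw [expRep, map_neg]; exact NormedSpace.exp_neg_mul_exp_of_real _

theorem expRep_mul_neg (X : g) : S.expRep X * S.expRep (-X) = 1 := by
  simpa using S.expRep_neg_mul (-X)

theorem expRep_conj (X Y : g) :
    S.expRep X * S.expRep Y * S.expRep (-X) = S.expRep (expAd S.step X Y) := by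
  have := completeSpace_repAlgebra (g := g)
  have h1 := S.isNilpotentRep.exp_mul_map_mul_exp_neg X Y
  rw [← map_neg] at h1
  have h2 : ∀ k, (S.expRep X * S.rep Y * S.expRep (-X)) ^ k =
      S.expRep X * S.rep Y ^ k * S.expRep (-X) := by
    intro k
    induction k with
    | zero => rw [pow_zero, pow_zero, mul_one, expRep_mul_neg]
    | succ k ih =>
      rw [pow_succ, ih, pow_succ]
      calc _ = S.expRep X * S.rep Y ^ k * (S.expRep (-X) * S.expRep X) * S.rep Y *
            S.expRep (-X) := by noncomm_ring
        _ = _ := by rw [expRep_neg_mul]; noncomm_ring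
  simp only [expRep] at h1 h2 ⊢
  rw [S.isNilpotentRep.exp_eq_sum (expAd S.step X Y), ← h1, S.isNilpotentRep.exp_eq_sum Y,
    Finset.mul_sum, Finset.sum_mul]
  refine Finset.sum_congr rfl fun k _ => ?_
  rw [h2, mul_smul_comm, smul_mul_assoc]

end Stratification

/-! ### The group law, commutators, and generation by the first layer. -/

namespace StratifiedGroup

variable {g : Type*} [LieRing g] [LieAlgebra ℝ g] {S : Stratification g}

@[ext]
theorem ext_log {p q : StratifiedGroup S} (h : p.log = q.log) : p = q := by
  cases p; cases q; exact congrArg exp h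

@[simp] theorem exp_log (p : StratifiedGroup S) : exp p.log = p := rfl

theorem log_mul (p q : StratifiedGroup S) : (p * q).log = bch S.step p.log q.log := rfl

@[simp] theorem log_one : (1 : StratifiedGroup S).log = 0 := rfl

theorem exp_zero : (exp 0 : StratifiedGroup S) = 1 := rfl

variable [FiniteDimensional ℝ g]

/-- Each axiom is checked in the faithful representation `expRep`, where the product is
multiplication of operators. -/
noncomputable instance : Group (StratifiedGroup S) where
  inv p := exp (-p.log)
  mul_assoc p q r := by
    ext
    apply S.expRep_injective
    simp only [log_mul, S.expRep_bch, mul_assoc]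
  one_mul p := by
    ext
    apply S.expRep_injective
    rw [log_mul, S.expRep_bch, log_one, S.expRep_zero, one_mul]
  mul_one p := by
    ext
    apply S.expRep_injective
    rw [log_mul, S.expRep_bch, log_one, S.expRep_zero, mul_one]
  inv_mul_cancel p := by
    ext
    apply S.expRep_injective
    rw [log_mul, S.expRep_bch, log_one, S.expRep_zero]
    exact S.expRep_neg_mul p.log

@[simp] theorem log_inv (p : StratifiedGroup S) : (p⁻¹).log = -p.log := rfl

theorem exp_mul_of_lie_eq_zero {X Y : g} (h : ⁅X, Y⁆ = 0) :
    (exp X * exp Y : StratifiedGroup S) = exp (X + Y) :=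
  congrArg exp (bch_of_lie_eq_zero S.one_le_step h)

theorem exp_conj (X Y : g) : (exp X * exp Y * (exp X)⁻¹ : StratifiedGroup S) =
    exp (expAd S.step X Y) := by
  ext
  apply S.expRep_injective
  rw [log_mul, S.expRep_bch, log_mul, S.expRep_bch]
  exact S.expRep_conj X Y

theorem mul_log_sub_mem {k : ℕ} {p q : StratifiedGroup S} {R R' : g} (hR : R ∈ S.ge k)
    (hR' : R' ∈ S.ge k) : (exp (p.log + R) * exp (q.log + R') : StratifiedGroup S).log -
      (p * q).log - (R + R') ∈ S.ge (k + 1) :=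
  S.bch_add_sub_mem hR hR' p.log q.log

theorem log_inv_mul_sub_mem {k : ℕ} {X R : g} (hR : R ∈ S.ge k) :
    ((exp X : StratifiedGroup S)⁻¹ * exp (X + R)).log - R ∈ S.ge (k + 1) := by
  have := mul_log_sub_mem (p := (exp X : StratifiedGroup S)⁻¹) (q := exp X) (zero_mem (S.ge k)) hR
  rw [inv_mul_cancel, add_zero, zero_add, log_one, sub_zero] at this
  exact this

/-- The commutator is `exp (exp (ad X) Y) * exp (-Y)`. The first-order term of `exp (ad X) Y - Y` is
the bracket; every later term contains one more `ad X`, which raises the index because `1 ≤ i`. -/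
theorem log_commutator_sub_mem {i j : ℕ} (hi : 1 ≤ i) {X Y : g} (hX : X ∈ S.ge i)
    (hY : Y ∈ S.ge j) : (exp X * exp Y * (exp X)⁻¹ * (exp Y)⁻¹ : StratifiedGroup S).log - ⁅X, Y⁆ ∈
      S.ge (i + j + 1) := by
  have had : ∀ k, (LieAlgebra.ad ℝ g X ^ (k + 1)) Y ∈ S.ge (i + j) ∧
      (LieAlgebra.ad ℝ g X ^ (k + 1 + 1)) Y ∈ S.ge (i + j + 1) := by
    intro k
    induction k with
    | zero =>
      have h1 := S.lie_mem_ge hX hY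
      refine ⟨by simpa using h1, ?_⟩
      have h2 := S.lie_mem_ge hX h1
      exact S.ge_anti (by omega : i + j + 1 ≤ i + (i + j)) (by simpa [pow_succ] using h2)
    | succ k ih =>
      refine ⟨S.ge_anti (by omega) ih.2, ?_⟩
      rw [pow_succ' _ (k + 1 + 1)]
      exact S.ge_anti (by omega) (S.lie_mem_ge hX ih.2)
  obtain ⟨M, hM⟩ : ∃ M, S.step = M + 1 := ⟨S.step - 1, by have := S.one_le_step; omega⟩
  have hE : expAd S.step X Y = Y + (∑ k ∈ Finset.range S.step, (((k + 1).factorial : ℝ)⁻¹) •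
      (LieAlgebra.ad ℝ g X ^ (k + 1)) Y) := by
    rw [expAd, LinearMap.sum_apply, Finset.sum_range_succ']
    simp [add_comm]
  set R := ∑ k ∈ Finset.range S.step, (((k + 1).factorial : ℝ)⁻¹) •
      (LieAlgebra.ad ℝ g X ^ (k + 1)) Y with hR
  have hR1 : R ∈ S.ge (i + j) := Submodule.sum_mem _ fun k _ => Submodule.smul_mem _ _ (had k).1
  have hR2 : R - ⁅X, Y⁆ ∈ S.ge (i + j + 1) := by
    rw [hR, hM, Finset.sum_range_succ']
    simp only [zero_add, Nat.factorial_one, Nat.cast_one, inv_one, pow_one, one_smul,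
      LieAlgebra.ad_apply, add_sub_cancel_right]
    exact Submodule.sum_mem _ fun k _ => Submodule.smul_mem _ _ (had k).2
  rw [exp_conj, hE]
  have := mul_log_sub_mem (p := (exp Y : StratifiedGroup S)) (q := (exp Y)⁻¹) hR1
    (zero_mem (S.ge (i + j)))
  simp only [add_zero, mul_inv_cancel, log_one, sub_zero] at this
  have h3 := add_mem this hR2
  rwa [sub_add_sub_cancel] at h3

/-- The homomorphism of groups given by a homomorphism of Lie algebras. -/
noncomputable def mapHom (S : Stratification g) (T : g →ₗ⁅ℝ⁆ g) :
    StratifiedGroup S →* StratifiedGroup S where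
  toFun p := exp (T p.log)
  map_one' := by ext; simp
  map_mul' p q := by ext; rw [log_mul, map_bch]; rfl

@[simp] theorem log_mapHom (T : g →ₗ⁅ℝ⁆ g) (p : StratifiedGroup S) :
    (mapHom S T p).log = T p.log := rfl

@[simp] theorem mapHom_exp (T : g →ₗ⁅ℝ⁆ g) (X : g) :
    mapHom S T (exp X) = exp (T X) := rfl

/-- The group is generated by the exponentials of the first layer. -/
theorem eq_top_of_exp_mem (Γ : Subgroup (StratifiedGroup S))
    (h : ∀ X ∈ S.layer 1, exp X ∈ Γ) : Γ = ⊤ := by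
  have hmul : ∀ k X R, R ∈ S.ge (k + 1) → ∃ R' ∈ S.ge (k + 1),
      (exp X : StratifiedGroup S)⁻¹ * exp (X + R) = exp R' := by
    intro k X R hR
    refine ⟨((exp X : StratifiedGroup S)⁻¹ * exp (X + R)).log, ?_, rfl⟩
    have := S.ge_anti (Nat.le_succ _) (log_inv_mul_sub_mem (S := S) (X := X) hR)
    simpa using add_mem this hR
  -- Every vector of a layer is the leading part of the logarithm of some element of `Γ`: brackets
  -- come from commutators, sums from products.
  have hlayer : ∀ k, 1 ≤ k → ∀ X ∈ S.layer k, ∃ R ∈ S.ge (k + 1), exp (X + R) ∈ Γ := by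
    intro k hk
    induction k, hk using Nat.le_induction with
    | base => exact fun X hX => ⟨0, zero_mem _, by simpa using h X hX⟩
    | succ k hk ih =>
      intro X hX
      -- As an additive monoid the span is generated by the scalar multiples of brackets, and the
      -- scalar is absorbed in `x`. No scalar case, which would have no counterpart in `Γ`, is left.
      rw [S.layer_succ k hk, ← Submodule.mem_toAddSubmonoid, Submodule.span_eq_closure] at hX
      induction hX using AddSubmonoid.closure_induction with
      | mem z hz =>
        obtain ⟨c, -, z, ⟨x, hx, y, hy, rfl⟩, rfl⟩ := hz
        beta_reduce
        rw [← smul_lie]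
        obtain ⟨R, hR, hRΓ⟩ := ih (c • x) (Submodule.smul_mem _ _ hx)
        have hx' := Submodule.smul_mem (S.layer k) c hx
        have hc := log_commutator_sub_mem (S := S) (i := k) (j := 1) hk
          (add_mem (S.layer_le_ge le_rfl hx') (S.ge_anti (by omega) hR)) (S.layer_le_ge le_rfl hy)
        refine ⟨(exp (c • x + R) * exp y * (exp (c • x + R))⁻¹ * (exp y)⁻¹ :
          StratifiedGroup S).log - ⁅c • x, y⁆, ?_, ?_⟩
        · have h2 := S.lie_mem_ge hR (S.layer_le_ge le_rfl hy)
          have h3 := add_mem hc (S.ge_anti (by omega : k + 1 + 1 ≤ k + 1 + 1) h2)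
          rw [add_lie] at h3
          rwa [sub_add_eq_sub_sub, sub_add_cancel] at h3
        · rw [add_sub_cancel]
          exact Γ.mul_mem (Γ.mul_mem (Γ.mul_mem hRΓ (h y hy)) (Γ.inv_mem hRΓ)) (Γ.inv_mem (h y hy))
      | zero => exact ⟨0, zero_mem _, by rw [add_zero]; exact Γ.one_mem⟩
      | add a b ha hb iha ihb =>
        obtain ⟨R, hR, hRΓ⟩ := iha
        obtain ⟨R', hR', hRΓ'⟩ := ihb
        have ha' : a ∈ S.ge (k + 1) := by
          refine S.layer_le_ge le_rfl ?_
          rw [S.layer_succ k hk, ← Submodule.mem_toAddSubmonoid, Submodule.span_eq_closure]; exact ha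
        have hb' : b ∈ S.ge (k + 1) := by
          refine S.layer_le_ge le_rfl ?_
          rw [S.layer_succ k hk, ← Submodule.mem_toAddSubmonoid, Submodule.span_eq_closure]; exact hb
        refine ⟨(exp (a + R) * exp (b + R') : StratifiedGroup S).log - (a + b), ?_, ?_⟩
        · have := mul_log_sub_mem (S := S) (p := 1) (q := 1)
            (add_mem ha' (S.ge_anti (by omega) hR)) (add_mem hb' (S.ge_anti (by omega) hR'))
          simp only [log_one, zero_add, mul_one, sub_zero] at this
          have h3 := add_mem (add_mem this hR) hR'
          convert h3 using 1
          abel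
        · rw [add_sub_cancel]
          exact Γ.mul_mem hRΓ hRΓ'
  -- Descending induction on `k`: dividing by an element of `Γ` with the same leading part leaves an
  -- element of the next filtration level.
  have hge : ∀ n k, S.step + 1 ≤ k + n → 1 ≤ k → ∀ X ∈ S.ge k, exp X ∈ Γ := by
    intro n
    induction n with
    | zero =>
      intro k hk _ X hX
      rw [S.eq_zero_of_mem_ge (by omega) hX]
      exact Γ.one_mem
    | succ n ih =>
      intro k hk hk1 X hX
      obtain ⟨R, hR, hΓ⟩ := hlayer k hk1 _ (S.proj_mem k X)
      obtain ⟨R', hR', he⟩ := hmul k (S.proj k X + R) (X - S.proj k X - R)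
        (sub_mem (S.sub_proj_mem_ge hX) hR)
      have : S.proj k X + R + (X - S.proj k X - R) = X := by abel
      rw [this, inv_mul_eq_iff_eq_mul] at he
      rw [he]
      exact Γ.mul_mem hΓ (ih (k + 1) (by omega) (by omega) R' hR')
  exact eq_top_iff.2 fun p _ => hge S.step 1 (by omega) le_rfl p.log (S.mem_ge_one _)

/-- Every element of the group is a product of exponentials of elements of the first layer. -/
theorem exists_prod_exp (p : StratifiedGroup S) :
    ∃ l : List (S.layer 1), (l.map fun X : S.layer 1 => exp (X : g)).prod = p := by
  let Γ : Subgroup (StratifiedGroup S) :=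
    { carrier := {p | ∃ l : List (S.layer 1), (l.map fun X : S.layer 1 => exp (X : g)).prod = p}
      mul_mem' := by
        rintro _ _ ⟨l, rfl⟩ ⟨l', rfl⟩
        exact ⟨l ++ l', by simp⟩
      one_mem' := ⟨[], rfl⟩
      inv_mem' := by
        rintro _ ⟨l, rfl⟩
        refine ⟨(l.map (- ·)).reverse, ?_⟩
        rw [List.prod_inv_reverse, List.map_reverse, List.map_map, List.map_map]
        rfl }
  have : Γ = ⊤ := eq_top_of_exp_mem Γ fun X hX => ⟨[⟨X, hX⟩], by simp⟩
  have hp : p ∈ Γ := by rw [this]; trivial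
  exact hp

@[elab_as_elim]
theorem exp_induction {P : StratifiedGroup S → Prop} (p : StratifiedGroup S) (one : P 1)
    (mul_exp : ∀ q, P q → ∀ X ∈ S.layer 1, P (q * exp X)) : P p := by
  obtain ⟨l, rfl⟩ := exists_prod_exp p
  induction l using List.reverseRecOn with
  | nil => exact one
  | append_singleton l X ih =>
    rw [List.map_append, List.prod_append, List.map_singleton, List.prod_singleton]
    exact mul_exp _ ih X X.2

end StratifiedGroup

/-! ### Velocities of curves -/

section Smoothness

variable {g : Type*} [LieRing g] [LieAlgebra ℝ g] [FiniteDimensional ℝ g]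
variable {E : Type*} [NormedAddCommGroup E] [NormedSpace ℝ E] {n : WithTop ℕ∞}

theorem ContDiff.lie_finiteDimensional {X Y : E → g} (hX : ContDiff ℝ n X)
    (hY : ContDiff ℝ n Y) : ContDiff ℝ n fun e => ⁅X e, Y e⁆ := by
  let b : g →ₗ[ℝ] g →ₗ[ℝ] g :=
    LinearMap.mk₂ ℝ (fun x y => ⁅x, y⁆) add_lie smul_lie lie_add (fun c x y => lie_smul c x y)
  exact (b.toContinuousBilinearMap.isBoundedBilinearMap.contDiff (n := n)).comp (hX.prodMk hY)

theorem contDiff_nestedBracket {α : Type*} {φ : α → E → g} (h : ∀ a, ContDiff ℝ n (φ a))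
    (l : List α) : ContDiff ℝ n fun e => nestedBracket (l.map fun a => φ a e) := by
  induction l with
  | nil => simpa [nestedBracket] using contDiff_const
  | cons a l ih =>
    by_cases hl : l = []
    · subst hl; simpa [nestedBracket] using h a
    · simp only [List.map_cons]
      have : ∀ e, nestedBracket (φ a e :: l.map fun a => φ a e) =
          ⁅φ a e, nestedBracket (l.map fun a => φ a e)⁆ :=
        fun e => nestedBracket_cons _ (by simpa using hl)
      simp only [this]
      exact (h a).lie_finiteDimensional ih

theorem ContDiff.bch (N : ℕ) {X Y : E → g} (hX : ContDiff ℝ n X) (hY : ContDiff ℝ n Y) :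
    ContDiff ℝ n fun e => bch N (X e) (Y e) := by
  simp only [bch_eq]
  refine ContDiff.sum fun k _ => ContDiff.const_smul _ (ContDiff.sum fun w _ => ?_)
  split_ifs
  · refine ContDiff.const_smul _ ?_
    have h1 := fun e => blockWord_map_fun (fun b : Bool => if b then X e else Y e) true false w
    simp only [if_true, Bool.false_eq_true, if_false] at h1
    simp only [h1]
    refine contDiff_nestedBracket (φ := fun (b : Bool) e => if b then X e else Y e) ?_ _
    rintro (_ | _) <;> simpa
  · exact contDiff_const

end Smoothness

namespace Stratification

variable {g : Type*} [LieRing g] [LieAlgebra ℝ g] [FiniteDimensional ℝ g] (S : Stratification g)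

theorem contDiff_mul {n : WithTop ℕ∞} : ContDiff ℝ n fun p : g × g => bch S.step p.1 p.2 :=
  contDiff_fst.bch S.step contDiff_snd

theorem contDiff_mul_left {n : WithTop ℕ∞} (X : g) : ContDiff ℝ n fun y => bch S.step X y :=
  contDiff_const.bch S.step contDiff_id

theorem bch_zero (X : g) : bch S.step X 0 = X :=
  congrArg StratifiedGroup.log (mul_one (StratifiedGroup.exp X : StratifiedGroup S))

theorem zero_bch (X : g) : bch S.step 0 X = X :=
  congrArg StratifiedGroup.log (one_mul (StratifiedGroup.exp X : StratifiedGroup S))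

theorem bch_assoc (X Y Z : g) :
    bch S.step (bch S.step X Y) Z = bch S.step X (bch S.step Y Z) :=
  congrArg StratifiedGroup.log (mul_assoc (StratifiedGroup.exp X : StratifiedGroup S)
    (StratifiedGroup.exp Y) (StratifiedGroup.exp Z))

theorem neg_bch_cancel (X Y : g) : bch S.step (-X) (bch S.step X Y) = Y :=
  congrArg StratifiedGroup.log (inv_mul_cancel_left (StratifiedGroup.exp X : StratifiedGroup S)
    (StratifiedGroup.exp Y))

/-- The differential at the identity of the left translation by `exp X`, in exponential
coordinates. -/
noncomputable def leftDeriv (X : g) : g →L[ℝ] g := fderiv ℝ (fun y => bch S.step X y) 0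

theorem hasFDerivAt_leftDeriv (X : g) :
    HasFDerivAt (fun y => bch S.step X y) (S.leftDeriv X) 0 :=
  ((S.contDiff_mul_left (n := 1) X).differentiable one_ne_zero 0).hasFDerivAt

theorem leftDeriv_zero : S.leftDeriv 0 = ContinuousLinearMap.id ℝ g := by
  have h : (fun y => bch S.step 0 y) = (id : g → g) := funext S.zero_bch
  rw [leftDeriv, h, fderiv_id]

/-- Associativity, differentiated: left translations carry the left-invariant frame to itself. Hence
velocities read through `leftDeriv` do not change under left translation. -/
theorem fderiv_mul_leftDeriv (X Y u : g) :
    fderiv ℝ (fun y => bch S.step X y) Y (S.leftDeriv Y u) = S.leftDeriv (bch S.step X Y) u := by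
  have h1 : HasFDerivAt (fun y => bch S.step X y) (fderiv ℝ (fun y => bch S.step X y) Y)
      (bch S.step Y 0) := by
    rw [S.bch_zero]
    exact ((S.contDiff_mul_left (n := 1) X).differentiable one_ne_zero Y).hasFDerivAt
  have h2 := h1.comp (0 : g) (S.hasFDerivAt_leftDeriv Y)
  have h3 : ((fun y => bch S.step X y) ∘ fun y => bch S.step Y y) =
      fun y => bch S.step (bch S.step X Y) y := funext fun y => (S.bch_assoc X Y y).symm
  rw [h3] at h2
  rw [h2.unique (S.hasFDerivAt_leftDeriv (bch S.step X Y)) |>.symm]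
  rfl

theorem fderiv_neg_leftDeriv (X u : g) :
    fderiv ℝ (fun y => bch S.step (-X) y) X (S.leftDeriv X u) = u := by
  have h : bch S.step (-X) X = 0 := by simpa [S.bch_zero] using S.neg_bch_cancel X 0
  rw [fderiv_mul_leftDeriv, h, leftDeriv_zero]; rfl

theorem leftDeriv_injective (X : g) : Function.Injective (S.leftDeriv X) := fun u v h => by
  rw [← S.fderiv_neg_leftDeriv X u, h, S.fderiv_neg_leftDeriv]

/-- The first layer of a product is additive (`proj_one_bch`). So the first-layer part of a velocity
is the ordinary derivative of the first-layer coordinates of the curve. -/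
theorem proj_one_leftDeriv (X u : g) : S.proj 1 (S.leftDeriv X u) = S.proj 1 u := by
  let P : g →L[ℝ] g := LinearMap.toContinuousLinearMap (S.proj 1)
  have h1 := (P.hasFDerivAt (x := bch S.step X 0)).comp (0 : g) (S.hasFDerivAt_leftDeriv X)
  have h2 : HasFDerivAt (P ∘ fun y => bch S.step X y) P 0 := by
    have : (P ∘ fun y => bch S.step X y) = fun y => P X + P y :=
      funext fun y => S.proj_one_bch X y
    rw [this]
    exact P.hasFDerivAt.const_add _
  exact congrArg (fun L : g →L[ℝ] g => L u) (h1.unique h2)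

theorem contDiff_expRep {n : WithTop ℕ∞} : ContDiff ℝ n S.expRep := by
  have : S.expRep = fun X => ∑ k ∈ Finset.range (S.step + 1),
      ((k.factorial : ℝ)⁻¹) • S.rep X ^ k := funext S.isNilpotentRep.exp_eq_sum
  rw [this]
  refine ContDiff.sum fun k _ => ContDiff.const_smul _ (ContDiff.pow ?_ k)
  exact (LinearMap.toContinuousLinearMap S.rep).contDiff

/-- In the representation a curve with velocity `u` solves the linear equation `M' = M ρ(u)`, to
which Gronwall's inequality applies. -/
theorem fderiv_expRep_leftDeriv (X u : g) :
    fderiv ℝ S.expRep X (S.leftDeriv X u) = S.expRep X * S.rep u := by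
  have := completeSpace_repAlgebra (g := g)
  have hl : HasDerivAt (fun ε : ℝ => ε • u) u 0 := by
    simpa using (hasDerivAt_id (0 : ℝ)).smul_const u
  have h1 : HasDerivAt (fun ε : ℝ => bch S.step X (ε • u)) (S.leftDeriv X u) 0 := by
    have h0 : HasFDerivAt (fun y => bch S.step X y) (S.leftDeriv X) ((0 : ℝ) • u) := by
      rw [zero_smul]; exact S.hasFDerivAt_leftDeriv X
    exact h0.comp_hasDerivAt (0 : ℝ) hl
  have h2 : HasFDerivAt S.expRep (fderiv ℝ S.expRep X) (bch S.step X ((0 : ℝ) • u)) := by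
    rw [zero_smul, S.bch_zero]
    exact ((S.contDiff_expRep (n := 1)).differentiable one_ne_zero X).hasFDerivAt
  have h3 := h2.comp_hasDerivAt (0 : ℝ) h1
  have h4 : HasDerivAt (fun ε : ℝ => S.expRep X * NormedSpace.exp (ε • S.rep u))
      (S.expRep X * S.rep u) 0 := by
    have := (hasDerivAt_exp_smul_const (S.rep u) (0 : ℝ)).const_mul (S.expRep X)
    simpa [NormedSpace.exp_zero] using this
  have h5 : (S.expRep ∘ fun ε : ℝ => bch S.step X (ε • u)) =
      fun ε : ℝ => S.expRep X * NormedSpace.exp (ε • S.rep u) := by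
    funext ε
    rw [Function.comp_apply, S.expRep_bch, ← map_smul]; rfl
  rw [h5] at h3
  exact h3.unique h4

end Stratification

namespace StratifiedGroup

variable {g : Type*} [LieRing g] [LieAlgebra ℝ g] [FiniteDimensional ℝ g] {S : Stratification g}

/-- The curve `c` has at time `t` (within `s`) the velocity `u`, translated back to the
identity. -/
def HasVelocity (c : ℝ → StratifiedGroup S) (u : g) (s : Set ℝ) (t : ℝ) : Prop :=
  HasDerivWithinAt (fun t => (c t).log) (S.leftDeriv (c t).log u) s t

theorem leftInvariantField_eq (X : g) (p : StratifiedGroup S) :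
    leftInvariantField X p = coords g (S.leftDeriv p.log X) := by
  have hl : HasDerivAt (fun ε : ℝ => ε • X) X 0 := by
    simpa using (hasDerivAt_id (0 : ℝ)).smul_const X
  have h1 : HasDerivAt (fun ε : ℝ => bch S.step p.log (ε • X)) (S.leftDeriv p.log X) 0 := by
    have h0 : HasFDerivAt (fun y => bch S.step p.log y) (S.leftDeriv p.log) ((0 : ℝ) • X) := by
      rw [zero_smul]; exact S.hasFDerivAt_leftDeriv p.log
    exact h0.comp_hasDerivAt (0 : ℝ) hl
  let P : g →L[ℝ] (Fin (Module.finrank ℝ g) → ℝ) :=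
    LinearMap.toContinuousLinearMap (coords g).toLinearMap
  exact (P.hasFDerivAt.comp_hasDerivAt (0 : ℝ) h1).deriv

theorem HasVelocity.mono {c : ℝ → StratifiedGroup S} {u : g} {s s' : Set ℝ} {t : ℝ}
    (h : HasVelocity c u s t) (hs : s' ⊆ s) : HasVelocity c u s' t :=
  HasDerivWithinAt.mono h hs

theorem HasVelocity.const_mul {c : ℝ → StratifiedGroup S} {u : g} {s : Set ℝ} {t : ℝ}
    (h : HasVelocity c u s t) (p : StratifiedGroup S) : HasVelocity (fun t => p * c t) u s t := by
  have h1 := ((S.contDiff_mul_left (n := 1) p.log).differentiable one_ne_zero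
    (c t).log).hasFDerivAt.comp_hasDerivWithinAt t h
  rw [S.fderiv_mul_leftDeriv] at h1
  exact h1

theorem leftDeriv_map (T : g →ₗ⁅ℝ⁆ g) (X u : g) :
    T (S.leftDeriv X u) = S.leftDeriv (T X) (T u) := by
  let P : g →L[ℝ] g := LinearMap.toContinuousLinearMap (T : g →ₗ[ℝ] g)
  have h1 := (P.hasFDerivAt (x := bch S.step X 0)).comp (0 : g) (S.hasFDerivAt_leftDeriv X)
  have h2 : HasFDerivAt (fun y => bch S.step (T X) y) (S.leftDeriv (T X)) (P 0) := by
    rw [map_zero]; exact S.hasFDerivAt_leftDeriv (T X)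
  have h3 := h2.comp (0 : g) P.hasFDerivAt
  have h4 : (P ∘ fun y => bch S.step X y) = (fun y => bch S.step (T X) y) ∘ P :=
    funext fun y => map_bch T S.step X y
  rw [h4] at h1
  exact congrArg (fun L : g →L[ℝ] g => L u) (h1.unique h3)

theorem HasVelocity.mapHom {c : ℝ → StratifiedGroup S} {u : g} {s : Set ℝ} {t : ℝ}
    (h : HasVelocity c u s t) (T : g →ₗ⁅ℝ⁆ g) :
    HasVelocity (fun t => mapHom S T (c t)) (T u) s t := by
  let P : g →L[ℝ] g := LinearMap.toContinuousLinearMap (T : g →ₗ[ℝ] g)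
  have h1 := P.hasFDerivAt.comp_hasDerivWithinAt t h
  have h2 : P (S.leftDeriv (c t).log u) = S.leftDeriv (T (c t).log) (T u) := leftDeriv_map T _ _
  rw [h2] at h1
  exact h1

theorem HasVelocity.scomp {c : ℝ → StratifiedGroup S} {u : g} {s : Set ℝ} {s' : Set ℝ} {t : ℝ}
    {φ : ℝ → ℝ} {φ' : ℝ} (h : HasVelocity c u s' (φ t)) (hφ : HasDerivWithinAt φ φ' s t)
    (hs : Set.MapsTo φ s s') : HasVelocity (fun t => c (φ t)) (φ' • u) s t := by
  rw [HasVelocity, map_smul]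
  exact HasDerivWithinAt.scomp t h hφ hs

theorem hasVelocity_exp_smul (X : g) (s : Set ℝ) (t : ℝ) :
    HasVelocity (fun t => (exp (t • X) : StratifiedGroup S)) X s t := by
  have hl : ∀ t, HasDerivAt (fun ε : ℝ => ε • X) X t := fun t => by
    simpa using (hasDerivAt_id t).smul_const X
  have h0 : HasFDerivAt (fun y => bch S.step (t • X) y) (S.leftDeriv (t • X)) ((0 : ℝ) • X) := by
    rw [zero_smul]; exact S.hasFDerivAt_leftDeriv _
  have h1 := h0.comp_hasDerivAt (0 : ℝ) (hl 0)
  have h2 : ((fun y => bch S.step (t • X) y) ∘ fun ε : ℝ => ε • X) =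
      fun ε : ℝ => t • X + ε • X :=
    funext fun ε => bch_of_lie_eq_zero S.one_le_step (by rw [smul_lie, lie_smul, lie_self]; simp)
  rw [h2] at h1
  have h3 := h1.unique ((hl 0).const_add (t • X))
  rw [HasVelocity, h3]
  exact (hl t).hasDerivWithinAt

/-- In general the first velocity would appear conjugated by `c' t`. The side condition makes the
conjugation trivial; it holds at all times when two curves are run one after the other. -/
theorem HasVelocity.mul {c c' : ℝ → StratifiedGroup S} {u u' : g} {s : Set ℝ} {t : ℝ}
    (h : HasVelocity c u s t) (h' : HasVelocity c' u' s t) (h1 : c' t = 1 ∨ u = 0) :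
    HasVelocity (fun t => c t * c' t) (u + u') s t := by
  let F := fderiv ℝ (fun p : g × g => bch S.step p.1 p.2) ((c t).log, (c' t).log)
  have hF : HasFDerivAt (fun p : g × g => bch S.step p.1 p.2) F ((c t).log, (c' t).log) :=
    ((S.contDiff_mul (n := 1)).differentiable one_ne_zero _).hasFDerivAt
  have hc := hF.comp_hasDerivWithinAt t (HasDerivWithinAt.prodMk h h')
  have hsplit : F (S.leftDeriv (c t).log u, S.leftDeriv (c' t).log u') =
      F (S.leftDeriv (c t).log u, 0) + F (0, S.leftDeriv (c' t).log u') := by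
    rw [← map_add, Prod.mk_add_mk, add_zero, zero_add]
  have hr : F (0, S.leftDeriv (c' t).log u') = S.leftDeriv (c t * c' t).log u' := by
    have h2 : HasFDerivAt (fun y => bch S.step (c t).log y)
        (F ∘L (ContinuousLinearMap.inr ℝ g g)) (c' t).log :=
      hF.comp (c' t).log (hasFDerivAt_prodMk_right (c t).log (c' t).log)
    rw [log_mul, ← S.fderiv_mul_leftDeriv, h2.fderiv]
    rfl
  have hleft : F (S.leftDeriv (c t).log u, 0) = S.leftDeriv (c t * c' t).log u := by
    rcases h1 with h1 | h1
    · have h2 : HasFDerivAt (fun y => bch S.step y (c' t).log)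
          (F ∘L (ContinuousLinearMap.inl ℝ g g)) (c t).log :=
        HasFDerivAt.comp (f := fun e => (e, (c' t).log)) (c t).log hF
          (hasFDerivAt_prodMk_left (c t).log (c' t).log)
      rw [h1] at h2 ⊢
      simp only [log_one, S.bch_zero] at h2
      rw [mul_one]
      exact congrArg (fun L : g →L[ℝ] g => L (S.leftDeriv (c t).log u))
        (h2.unique (hasFDerivAt_id (c t).log))
    · rw [h1, map_zero, map_zero]
      exact map_zero F
  rw [hsplit, hr, hleft, ← map_add] at hc
  exact hc

theorem HasVelocity.proj_one {c : ℝ → StratifiedGroup S} {u : g} {s : Set ℝ} {t : ℝ}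
    (h : HasVelocity c u s t) :
    HasDerivWithinAt (fun t => S.proj 1 (c t).log) (S.proj 1 u) s t := by
  let P : g →L[ℝ] g := LinearMap.toContinuousLinearMap (S.proj 1)
  have := P.hasFDerivAt.comp_hasDerivWithinAt t h
  have h2 : P (S.leftDeriv (c t).log u) = S.proj 1 u := S.proj_one_leftDeriv _ _
  rw [h2] at this
  exact this

theorem HasVelocity.unique {c : ℝ → StratifiedGroup S} {u u' : g} {s : Set ℝ} {t : ℝ}
    (h : HasVelocity c u s t) (h' : HasVelocity c u' s t) (hs : UniqueDiffWithinAt ℝ s t) :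
    u = u' :=
  S.leftDeriv_injective _ (hs.eq_deriv _ h h')

theorem HasVelocity.congr {c c' : ℝ → StratifiedGroup S} {u : g} {s : Set ℝ} {t : ℝ}
    (h : HasVelocity c u s t) (hc : c' =ᶠ[𝓝[s] t] c) (ht : c' t = c t) :
    HasVelocity c' u s t := by
  rw [HasVelocity, ht]
  refine HasDerivWithinAt.congr_of_eventuallyEq h ?_ (by rw [ht])
  filter_upwards [hc] with x hx
  rw [hx]

theorem hasVelocity_const (p : StratifiedGroup S) (s : Set ℝ) (t : ℝ) :
    HasVelocity (fun _ => p) 0 s t := by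
  rw [HasVelocity, map_zero]
  exact hasDerivWithinAt_const _ _ _

theorem HasVelocity.expRep {c : ℝ → StratifiedGroup S} {u : g} {s : Set ℝ} {t : ℝ}
    (h : HasVelocity c u s t) : HasDerivWithinAt (fun t => S.expRep (c t).log)
      (S.expRep (c t).log * S.rep u) s t := by
  have h1 := ((S.contDiff_expRep (n := 1)).differentiable one_ne_zero
    (c t).log).hasFDerivAt.comp_hasDerivWithinAt t h
  rw [S.fderiv_expRep_leftDeriv] at h1
  exact h1

end StratifiedGroup

/-! ### Growth of curves -/

namespace Stratification

variable {g : Type*} [LieRing g] [LieAlgebra ℝ g] [FiniteDimensional ℝ g] (S : Stratification g)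

theorem exists_norm_le_norm_rep : ∃ C : ℝ, 0 < C ∧ ∀ X, ‖X‖ ≤ C * ‖S.rep X‖ := by
  obtain ⟨K, hK, h⟩ := LinearMap.exists_antilipschitzWith S.rep
    (LinearMap.ker_eq_bot.2 S.isNilpotentRep.injective)
  refine ⟨K, hK, fun X => ?_⟩
  simpa using h.le_mul_dist X 0

/-- The logarithm is a polynomial in the operator, so bounded operators come from bounded vectors;
continuity of the same polynomial gives `tendsto_of_tendsto_expRep`. -/
theorem exists_norm_le_of_norm_expRep_le (R : ℝ) :
    ∃ C : ℝ, ∀ X, ‖S.expRep X‖ ≤ R → ‖X‖ ≤ C := by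
  have := completeSpace_repAlgebra (g := g)
  obtain ⟨C, hC, h⟩ := S.exists_norm_le_norm_rep
  refine ⟨C * ∑ n ∈ Finset.range (S.step + S.step + 2), (R + ‖(1 : RepAlgebra g)‖) ^ (n + 1),
    fun X hX => (h X).trans ?_⟩
  have h1 : ‖S.expRep X - 1‖ ≤ R + ‖(1 : RepAlgebra g)‖ :=
    (norm_sub_le _ _).trans (by gcongr)
  rw [← S.isNilpotentRep.truncLog_exp S.one_le_step X, truncLog]
  gcongr
  refine (norm_sum_le _ _).trans (Finset.sum_le_sum fun n _ => ?_)
  rw [norm_smul]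
  have h2 : ‖((-1 : ℝ) ^ n / (n + 1))‖ ≤ 1 := by
    rw [norm_div, norm_pow, norm_neg, norm_one, one_pow, Real.norm_eq_abs,
      abs_of_nonneg (by positivity : (0 : ℝ) ≤ n + 1)]
    exact div_le_one_of_le₀ (by linarith [(Nat.cast_nonneg n : (0 : ℝ) ≤ n)]) (by positivity)
  calc _ ≤ 1 * ‖(S.expRep X - 1) ^ (n + 1)‖ := mul_le_mul_of_nonneg_right h2 (norm_nonneg _)
    _ ≤ ‖S.expRep X - 1‖ ^ (n + 1) := by rw [one_mul]; exact norm_pow_le' _ (by omega)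
    _ ≤ _ := by gcongr

theorem tendsto_of_tendsto_expRep {ι : Type*} {l : Filter ι} {X : ι → g} {Y : g}
    (h : Filter.Tendsto (fun i => S.expRep (X i)) l (𝓝 (S.expRep Y))) :
    Filter.Tendsto X l (𝓝 Y) := by
  have := completeSpace_repAlgebra (g := g)
  obtain ⟨K, hK, ha⟩ := LinearMap.exists_antilipschitzWith S.rep
    (LinearMap.ker_eq_bot.2 S.isNilpotentRep.injective)
  have hind := ha.isInducing (LinearMap.continuous_of_finiteDimensional S.rep)
  rw [hind.tendsto_nhds_iff]
  have hc : Continuous fun x : RepAlgebra g => truncLog (S.step + S.step + 2) (x - 1) := by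
    unfold truncLog
    fun_prop
  have h2 := (hc.tendsto (S.expRep Y)).comp h
  have h3 : ∀ Z, truncLog (S.step + S.step + 2) (S.expRep Z - 1) = S.rep Z :=
    S.isNilpotentRep.truncLog_exp S.one_le_step
  rw [h3] at h2
  exact h2.congr fun i => h3 _

theorem exists_norm_proj_le (j : ℕ) : ∃ C : ℝ, 0 < C ∧ ∀ X, ‖S.proj j X‖ ≤ C * ‖X‖ :=
  (LinearMap.toContinuousLinearMap (S.proj j)).bound

theorem exists_norm_proj_le_all : ∃ C : ℝ, 0 < C ∧ ∀ j X, ‖S.proj j X‖ ≤ C * ‖X‖ := by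
  choose C hC h using S.exists_norm_proj_le
  refine ⟨1 + ∑ j ∈ Finset.range (S.step + 1), C j, ?_, fun j X => ?_⟩
  · have : 0 ≤ ∑ j ∈ Finset.range (S.step + 1), C j := Finset.sum_nonneg fun j _ => (hC j).le
    linarith
  · rcases lt_or_ge S.step j with hj | hj
    · rw [S.proj_of_lt hj, norm_zero]
      have : 0 ≤ ∑ j ∈ Finset.range (S.step + 1), C j := Finset.sum_nonneg fun j _ => (hC j).le
      positivity
    · refine (h j X).trans ?_
      gcongr
      have : C j ≤ ∑ j ∈ Finset.range (S.step + 1), C j :=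
        Finset.single_le_sum (fun j _ => (hC j).le) (Finset.mem_range.2 (by omega))
      linarith

theorem norm_le_sum_proj (X : g) : ‖X‖ ≤ ∑ j ∈ Finset.range (S.step + 1), ‖S.proj j X‖ := by
  conv_lhs => rw [← S.sum_proj X]
  exact norm_sum_le _ _

end Stratification

namespace StratifiedGroup

variable {g : Type*} [LieRing g] [LieAlgebra ℝ g] [FiniteDimensional ℝ g] {S : Stratification g}

open Set MeasureTheory

/-- Gronwall's inequality for `M' = M ρ(u)` bounds the operator by an exponential of the length;
then the logarithm is bounded. -/
theorem exists_norm_log_le (S : Stratification g) : ∃ C : ℝ, ∀ (c : ℝ → StratifiedGroup S)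
    (u : ℝ → g), (∀ t ∈ Icc (0 : ℝ) 1, HasVelocity c (u t) (Icc 0 1) t) →
    ContinuousOn u (Icc 0 1) → c 0 = 1 → ∫ t in (0 : ℝ)..1, ‖u t‖ ≤ 1 → ‖(c 1).log‖ ≤ C := by
  obtain ⟨K, hK, hrep⟩ := (LinearMap.toContinuousLinearMap S.rep).bound
  replace hrep : ∀ x, ‖S.rep x‖ ≤ K * ‖x‖ := hrep
  obtain ⟨C, hC⟩ := S.exists_norm_le_of_norm_expRep_le
    ((1 + ‖(1 : Stratification.RepAlgebra g)‖) * Real.exp (K + 1))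
  refine ⟨C, fun c u hc hu h0 hint => hC _ ?_⟩
  let v : ℝ → ℝ := fun t => ‖u (projIcc 0 1 zero_le_one t)‖
  have hv : Continuous v := by
    have h1 : Continuous fun t : Icc (0 : ℝ) 1 => u t := continuousOn_iff_continuous_domRestrict.1 hu
    exact (h1.comp continuous_projIcc).norm
  have hvu : ∀ t ∈ Icc (0 : ℝ) 1, v t = ‖u t‖ := fun t ht => by
    simp only [v, projIcc_of_mem _ ht]
  let U : ℝ → ℝ := fun t => ∫ s in (0 : ℝ)..t, v s
  have hU : ∀ t, HasDerivAt U (v t) t := fun t =>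
    intervalIntegral.integral_hasDerivAt_right (hv.intervalIntegrable _ _)
      (hv.stronglyMeasurableAtFilter _ _) hv.continuousAt
  have hU1 : U 1 ≤ 1 := by
    refine le_trans (le_of_eq ?_) hint
    refine intervalIntegral.integral_congr fun t ht => ?_
    rw [uIcc_of_le zero_le_one] at ht
    exact hvu t ht
  -- The summand `t` in the exponent makes the differential inequality strict, as the comparison
  -- theorem requires, and `1 +` makes the positivity of `B` evident.
  let B : ℝ → ℝ := fun t => (1 + ‖(1 : Stratification.RepAlgebra g)‖) * Real.exp (K * U t + t)
  have hB : ∀ t, HasDerivAt B ((K * v t + 1) * B t) t := fun t => by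
    have := ((((hU t).const_mul K).add (hasDerivAt_id t)).exp).const_mul
      (1 + ‖(1 : Stratification.RepAlgebra g)‖)
    refine this.congr_deriv ?_
    simp only [B, Pi.add_apply, id]
    ring
  have hBpos : ∀ t, 0 < B t := fun t => by positivity
  have hM : ∀ t ∈ Icc (0 : ℝ) 1, HasDerivWithinAt (fun t => S.expRep (c t).log)
      (S.expRep (c t).log * S.rep (u t)) (Icc 0 1) t := fun t ht => (hc t ht).expRep
  have key := image_norm_le_of_norm_deriv_right_lt_deriv_boundary
    (f := fun t => S.expRep (c t).log) (f' := fun t => S.expRep (c t).log * S.rep (u t))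
    (a := 0) (b := 1) (B := B) (B' := fun t => (K * v t + 1) * B t)
    (fun t ht => (hM t ht).continuousWithinAt)
    (fun t ht => (hM t (Ico_subset_Icc_self ht)).mono_of_mem_nhdsWithin (Icc_mem_nhdsGE_of_mem ht))
    (by
      simp only [h0, log_one, S.expRep_zero, B, U, intervalIntegral.integral_same]
      simp) hB
    (fun t ht he => by
      have h1 : ‖S.expRep (c t).log * S.rep (u t)‖ ≤ B t * (K * v t) := by
        refine (norm_mul_le _ _).trans ?_
        rw [he, hvu t (Ico_subset_Icc_self ht)]
        exact mul_le_mul_of_nonneg_left (hrep _) (hBpos t).le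
      have := hBpos t
      linarith)
    (right_mem_Icc.2 zero_le_one)
  refine key.trans ?_
  simp only [B]
  gcongr
  nlinarith

/-- A horizontal curve of length at most `r` starting at the identity ends at a point whose
component in the `j`-th layer is `O(r ^ j)`. -/
theorem exists_norm_proj_log_le (S : Stratification g) : ∃ C : ℝ, 0 < C ∧
    ∀ (c : ℝ → StratifiedGroup S) (u : ℝ → g) (r : ℝ), 0 < r →
    (∀ t ∈ Icc (0 : ℝ) 1, HasVelocity c (u t) (Icc 0 1) t) → (∀ t ∈ Icc (0 : ℝ) 1, u t ∈ S.layer 1) →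
    ContinuousOn u (Icc 0 1) → c 0 = 1 → ∫ t in (0 : ℝ)..1, ‖u t‖ ≤ r →
    ∀ j, ‖S.proj j (c 1).log‖ ≤ C * r ^ j := by
  obtain ⟨C, hC⟩ := exists_norm_log_le S
  obtain ⟨K, hK, hproj⟩ := S.exists_norm_proj_le_all
  refine ⟨K * (|C| + 1), by positivity, fun c u r hr hc hu huc h0 hint j => ?_⟩
  -- The dilation by `r⁻¹` reduces to length at most one, and dilating back multiplies the `j`-th
  -- layer by `r ^ j`.
  have h1 := hC (fun t => mapHom S (S.dil r⁻¹) (c t)) (fun t => r⁻¹ • u t)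
    (fun t ht => by
      have := (hc t ht).mapHom (S.dil r⁻¹)
      rwa [S.dil_of_mem _ (hu t ht), pow_one] at this)
    (huc.const_smul _) (by rw [h0, map_one]) (by
      simp only [norm_smul, norm_inv, Real.norm_eq_abs, abs_of_pos hr]
      rw [intervalIntegral.integral_const_mul]
      calc r⁻¹ * _ ≤ r⁻¹ * r := by gcongr
        _ = 1 := inv_mul_cancel₀ hr.ne')
  rw [log_mapHom] at h1
  have h2 : S.proj j (c 1).log = r ^ j • S.proj j (S.dil r⁻¹ (c 1).log) := by
    rw [S.proj_dil, smul_smul, ← mul_pow, mul_inv_cancel₀ hr.ne', one_pow, one_smul]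
  rw [h2, norm_smul, norm_pow, Real.norm_eq_abs, abs_of_pos hr, mul_comm]
  gcongr
  refine (hproj j _).trans ?_
  gcongr
  linarith [le_abs_self C]

/-- Stability of the endpoint of a curve with almost constant velocity. -/
theorem tendsto_log_of_velocity {ι : Type*} {l : Filter ι} {c : ι → ℝ → StratifiedGroup S}
    {u : ι → ℝ → g} {v : g}
    (hc : ∀ᶠ i in l, ∀ t ∈ Icc (0 : ℝ) 1, HasVelocity (c i) (u i t) (Icc 0 1) t)
    (h0 : ∀ᶠ i in l, c i 0 = 1)
    (hu : ∀ ε > 0, ∀ᶠ i in l, ∀ t ∈ Icc (0 : ℝ) 1, ‖u i t - v‖ ≤ ε) :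
    Filter.Tendsto (fun i => (c i 1).log) l (𝓝 v) := by
  have := Stratification.completeSpace_repAlgebra (g := g)
  obtain ⟨K, hK, hrep⟩ := (LinearMap.toContinuousLinearMap S.rep).bound
  replace hrep : ∀ x, ‖S.rep x‖ ≤ K * ‖x‖ := hrep
  apply S.tendsto_of_tendsto_expRep
  let V := S.rep v
  obtain ⟨D, hD⟩ : ∃ D : ℝ, ∀ t ∈ Icc (0 : ℝ) 1,
      ‖NormedSpace.exp (t • V)‖ ≤ D ∧ ‖NormedSpace.exp (t • (-V))‖ ≤ D := by
    have hcont : ∀ W : Stratification.RepAlgebra g,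
        Continuous fun t : ℝ => NormedSpace.exp (t • W) := fun W =>
      (differentiable_exp_smul_const ℝ W).continuous
    obtain ⟨D1, h1⟩ := isCompact_Icc.exists_bound_of_continuousOn (hcont V).continuousOn
      (s := Icc (0 : ℝ) 1)
    obtain ⟨D2, h2⟩ := isCompact_Icc.exists_bound_of_continuousOn (hcont (-V)).continuousOn
      (s := Icc (0 : ℝ) 1)
    exact ⟨max D1 D2, fun t ht => ⟨(h1 t ht).trans (le_max_left _ _),
      (h2 t ht).trans (le_max_right _ _)⟩⟩
  have hDpos : 0 ≤ D := (norm_nonneg _).trans (hD 0 (left_mem_Icc.2 zero_le_one)).1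
  have key : ∀ i ε, 0 < ε → (∀ t ∈ Icc (0 : ℝ) 1, HasVelocity (c i) (u i t) (Icc 0 1) t) →
      c i 0 = 1 → (∀ t ∈ Icc (0 : ℝ) 1, ‖u i t - v‖ ≤ ε) →
      ‖S.expRep (c i 1).log - S.expRep v‖ ≤
        gronwallBound 0 (D * (K * ε) * D) (D * (K * ε) * D * ‖(1 : Stratification.RepAlgebra g)‖)
          (1 - 0) * D := by
    intro i ε hε hc h0 hu
    -- The deviation from the model curve `exp (t V)`, in multiplicative form: its derivative
    -- contains only the difference of the velocities.
    let f : ℝ → Stratification.RepAlgebra g := fun t =>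
      S.expRep (c i t).log * NormedSpace.exp (t • (-V)) - 1
    have hexp : ∀ t : ℝ, NormedSpace.exp (t • (-V)) * NormedSpace.exp (t • V) = 1 := fun t => by
      rw [smul_neg]; exact NormedSpace.exp_neg_mul_exp_of_real _
    let f' : ℝ → Stratification.RepAlgebra g := fun t =>
      (f t + 1) * (NormedSpace.exp (t • V) * S.rep (u i t - v) * NormedSpace.exp (t • (-V)))
    have hf : ∀ t ∈ Icc (0 : ℝ) 1, HasDerivWithinAt f (f' t) (Icc 0 1) t := by
      intro t ht
      have h1 := ((hc t ht).expRep.mul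
        (hasDerivAt_exp_smul_const' (-V) t).hasDerivWithinAt).sub_const 1
      refine h1.congr_deriv ?_
      simp only [f', f, sub_add_cancel]
      calc _ = S.expRep (c i t).log * (S.rep (u i t) - V) * NormedSpace.exp (t • (-V)) := by
            noncomm_ring
        _ = S.expRep (c i t).log * (NormedSpace.exp (t • (-V)) * NormedSpace.exp (t • V)) *
              (S.rep (u i t) - V) * NormedSpace.exp (t • (-V)) := by rw [hexp, mul_one]
        _ = _ := by simp only [V, map_sub, mul_assoc]
    have hb := norm_le_gronwallBound_of_norm_deriv_right_le (f := f) (f' := f') (δ := 0)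
      (K := D * (K * ε) * D) (ε := D * (K * ε) * D * ‖(1 : Stratification.RepAlgebra g)‖)
      (a := 0) (b := 1)
      (fun t ht => (hf t ht).continuousWithinAt)
      (fun t ht => (hf t (Ico_subset_Icc_self ht)).mono_of_mem_nhdsWithin
        (Icc_mem_nhdsGE_of_mem ht))
      (by simp [f, h0, S.expRep_zero, NormedSpace.exp_zero])
      (fun t ht => by
        have ht' := Ico_subset_Icc_self ht
        have h2 : ‖NormedSpace.exp (t • V) * S.rep (u i t - v) * NormedSpace.exp (t • (-V))‖ ≤
            D * (K * ε) * D := by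
          refine (norm_mul_le _ _).trans ?_
          gcongr
          · refine (norm_mul_le _ _).trans ?_
            gcongr
            · exact (hD t ht').1
            · exact (hrep _).trans (by gcongr; exact hu t ht')
          · exact (hD t ht').2
        refine (norm_mul_le _ _).trans ?_
        have h3 := norm_add_le (f t) 1
        calc _ ≤ (‖f t‖ + ‖(1 : Stratification.RepAlgebra g)‖) * (D * (K * ε) * D) := by gcongr
          _ = _ := by ring)
      1 (right_mem_Icc.2 zero_le_one)
    have h4 : S.expRep (c i 1).log - S.expRep v = f 1 * NormedSpace.exp ((1 : ℝ) • V) := by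
      simp only [f]
      rw [sub_mul, mul_assoc, hexp, one_smul, mul_one, one_mul]; rfl
    rw [h4]
    refine (norm_mul_le _ _).trans ?_
    gcongr
    · exact (norm_nonneg _).trans hb
    · exact (hD 1 (right_mem_Icc.2 zero_le_one)).1
  have hlim : Filter.Tendsto (fun ε : ℝ => gronwallBound 0 (D * (K * ε) * D)
      (D * (K * ε) * D * ‖(1 : Stratification.RepAlgebra g)‖) (1 - 0) * D) (𝓝 0) (𝓝 0) := by
    -- `gronwallBound` is defined by cases at rate `0`; this formula covers both cases and shows the
    -- continuity at `0`.
    have h1 : ∀ k m : ℝ, gronwallBound 0 k (k * m) (1 - 0) = m * (Real.exp k - 1) := by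
      intro k m
      by_cases hk : k = 0
      · simp [hk, gronwallBound_K0]
      · rw [gronwallBound_of_K_ne_0 hk]
        field_simp
        simp
    simp only [h1]
    have : Continuous fun ε : ℝ =>
      ‖(1 : Stratification.RepAlgebra g)‖ * (Real.exp (D * (K * ε) * D) - 1) * D := by fun_prop
    simpa using this.tendsto 0
  rw [tendsto_iff_norm_sub_tendsto_zero, Metric.tendsto_nhds]
  intro η hη
  obtain ⟨δ, hδ, hδ'⟩ := Metric.eventually_nhds_iff.1 ((tendsto_order.1 hlim).2 η hη)
  filter_upwards [hc, h0, hu (δ / 2) (by positivity)] with i h1 h2 h3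
  rw [dist_zero_right, norm_norm]
  refine (key i (δ / 2) (by positivity) h1 h2 h3).trans_lt (hδ' ?_)
  rw [dist_zero_right, Real.norm_eq_abs, abs_of_pos (by positivity)]
  linarith

end StratifiedGroup

/-! ### Reachable points and the ball-box estimates -/

namespace StratifiedGroup

variable {g : Type*} [LieRing g] [LieAlgebra ℝ g] [FiniteDimensional ℝ g] {S : Stratification g}

open Set

/-- The point `p` is joined to the identity by a smooth horizontal curve of speed at most `R`,
constant outside `[0, 1]`. -/
def IsReachable (R : ℝ) (p : StratifiedGroup S) : Prop :=
  ∃ (γ : ℝ → StratifiedGroup S) (u : ℝ → g), ContDiff ℝ (⊤ : ℕ∞) (fun t => (γ t).log) ∧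
    (∀ t, HasVelocity γ (u t) univ t) ∧ (∀ t, u t ∈ S.layer 1 ∧ ‖u t‖ ≤ R) ∧
    (∀ t ≤ 0, γ t = 1) ∧ ∀ t, 1 ≤ t → γ t = p

theorem IsReachable.mono {R R' : ℝ} {p : StratifiedGroup S} (h : IsReachable R p) (hR : R ≤ R') :
    IsReachable R' p := by
  obtain ⟨γ, u, h1, h2, h3, h4⟩ := h
  exact ⟨γ, u, h1, h2, fun t => ⟨(h3 t).1, (h3 t).2.trans hR⟩, h4⟩

theorem exists_abs_deriv_smoothTransition_le :
    ∃ D : ℝ, 0 < D ∧ ∀ t, |deriv Real.smoothTransition t| ≤ D := by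
  have hc : Continuous (deriv Real.smoothTransition) :=
    (Real.smoothTransition.contDiff (n := 1)).continuous_deriv le_rfl
  obtain ⟨D, hD⟩ := isCompact_Icc.exists_bound_of_continuousOn (s := Icc (0 : ℝ) 1) hc.continuousOn
  refine ⟨max D 1, by positivity, fun t => ?_⟩
  by_cases ht : t ∈ Icc (0 : ℝ) 1
  · exact (hD t ht).trans (le_max_left _ _)
  · have : deriv Real.smoothTransition t = 0 := by
      rw [mem_Icc, not_and_or, not_le, not_le] at ht
      rcases ht with ht | ht
      · have : Real.smoothTransition =ᶠ[𝓝 t] fun _ => 0 := by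
          filter_upwards [gt_mem_nhds ht] with x hx
          exact Real.smoothTransition.zero_of_nonpos hx.le
        rw [this.deriv_eq, deriv_const]
      · have : Real.smoothTransition =ᶠ[𝓝 t] fun _ => 1 := by
          filter_upwards [lt_mem_nhds ht] with x hx
          exact Real.smoothTransition.one_of_one_le hx.le
        rw [this.deriv_eq, deriv_const]
    rw [this, abs_zero]
    positivity

/-- The segment `t ↦ exp (t X)` is reparametrized by the smooth transition function, so that it is
smooth and constant outside `[0, 1]` and can be concatenated smoothly. -/
theorem exists_isReachable_exp : ∃ D : ℝ, 0 < D ∧ ∀ X ∈ S.layer 1,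
    IsReachable (D * ‖X‖) (exp X : StratifiedGroup S) := by
  obtain ⟨D, hD, h⟩ := exists_abs_deriv_smoothTransition_le
  refine ⟨D, hD, fun X hX => ⟨fun t => exp (Real.smoothTransition t • X),
    fun t => deriv Real.smoothTransition t • X, ?_, ?_, ?_, ?_, ?_⟩⟩
  · exact (Real.smoothTransition.contDiff).smul contDiff_const
  · intro t
    have h1 : HasDerivWithinAt Real.smoothTransition (deriv Real.smoothTransition t) univ t :=
      (((Real.smoothTransition.contDiff (n := 1)).differentiable
        (by norm_num)) t).hasDerivAt.hasDerivWithinAt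
    exact (hasVelocity_exp_smul X univ _).scomp h1 (mapsTo_univ _ _)
  · intro t
    refine ⟨Submodule.smul_mem _ _ hX, ?_⟩
    rw [norm_smul]
    gcongr
    exact h t
  · intro t ht
    simp only [Real.smoothTransition.zero_of_nonpos ht, zero_smul]
    rfl
  · intro t ht
    simp only [Real.smoothTransition.one_of_one_le ht, one_smul]

/-- The curves are run one after the other at double speed. Their pointwise product does this,
because the second is still at the identity up to time `1 / 2` and the first stays at `p`
afterwards. -/
theorem IsReachable.mul {R R' : ℝ} {p q : StratifiedGroup S} (hp : IsReachable R p)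
    (hq : IsReachable R' q) : IsReachable (2 * R + 2 * R') (p * q) := by
  obtain ⟨γ, u, h1, h2, h3, h4, h5⟩ := hp
  obtain ⟨γ', u', h1', h2', h3', h4', h5'⟩ := hq
  have hR : 0 ≤ R := (norm_nonneg _).trans (h3 0).2
  have hR' : 0 ≤ R' := (norm_nonneg _).trans (h3' 0).2
  have ha : ∀ t : ℝ, HasVelocity (fun t => γ (2 * t)) ((2 : ℝ) • u (2 * t)) univ t := fun t => by
    have : HasDerivAt (fun t : ℝ => 2 * t) 2 t := by
      simpa using (hasDerivAt_id t).const_mul (2 : ℝ)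
    exact (h2 (2 * t)).scomp (φ := fun t => 2 * t) this.hasDerivWithinAt (mapsTo_univ _ _)
  have hb : ∀ t : ℝ, HasVelocity (fun t => γ' (2 * t - 1)) ((2 : ℝ) • u' (2 * t - 1)) univ t :=
    fun t => by
    have : HasDerivAt (fun t : ℝ => 2 * t - 1) 2 t := by
      simpa using ((hasDerivAt_id t).const_mul (2 : ℝ)).sub_const 1
    exact (h2' (2 * t - 1)).scomp (φ := fun t => 2 * t - 1) this.hasDerivWithinAt
      (mapsTo_univ _ _)
  refine ⟨fun t => γ (2 * t) * γ' (2 * t - 1), fun t => (2 : ℝ) • u (2 * t) +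
    (2 : ℝ) • u' (2 * t - 1), ?_, ?_, ?_, ?_, ?_⟩
  · exact (h1.comp (contDiff_const.mul contDiff_id)).bch S.step
      (h1'.comp ((contDiff_const.mul contDiff_id).sub contDiff_const))
  · intro t
    refine (ha t).mul (hb t) ?_
    rcases le_or_gt t (1 / 2) with ht | ht
    · exact Or.inl (h4' _ (by linarith))
    · right
      have hconst : HasVelocity (fun t => γ (2 * t)) 0 univ t := by
        refine (hasVelocity_const p univ t).congr ?_ (h5 _ (by linarith))
        rw [nhdsWithin_univ]
        filter_upwards [lt_mem_nhds ht] with x hx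
        exact h5 _ (by linarith)
      exact (ha t).unique hconst uniqueDiffWithinAt_univ
  · intro t
    refine ⟨add_mem (Submodule.smul_mem _ _ (h3 _).1) (Submodule.smul_mem _ _ (h3' _).1), ?_⟩
    refine (norm_add_le _ _).trans ?_
    rw [norm_smul, norm_smul, Real.norm_two]
    gcongr
    · exact (h3 _).2
    · exact (h3' _).2
  · intro t ht
    beta_reduce
    rw [h4 _ (by linarith), h4' _ (by linarith), one_mul]
  · intro t ht
    beta_reduce
    rw [h5 _ (by linarith), h5' _ (by linarith)]

theorem isReachable_one : IsReachable 0 (1 : StratifiedGroup S) :=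
  ⟨fun _ => 1, fun _ => 0, contDiff_const, fun t => hasVelocity_const 1 univ t,
    fun _ => ⟨zero_mem _, by simp⟩, fun _ _ => rfl, fun _ _ => rfl⟩

theorem exists_isReachable (p : StratifiedGroup S) : ∃ R, IsReachable R p := by
  obtain ⟨D, hD, h⟩ := exists_isReachable_exp (S := S)
  induction p using exp_induction with
  | one => exact ⟨0, isReachable_one⟩
  | mul_exp q hq X hX =>
    obtain ⟨R, hR⟩ := hq
    exact ⟨_, hR.mul (h X hX)⟩

theorem IsReachable.dil {R : ℝ} {p : StratifiedGroup S} (h : IsReachable R p) {s : ℝ}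
    (hs : 0 ≤ s) : IsReachable (s * R) (mapHom S (S.dil s) p) := by
  obtain ⟨γ, u, h1, h2, h3, h4, h5⟩ := h
  refine ⟨fun t => mapHom S (S.dil s) (γ t), fun t => s • u t, ?_, ?_, ?_, ?_, ?_⟩
  · exact (LinearMap.toContinuousLinearMap (S.dil s : g →ₗ[ℝ] g)).contDiff.comp h1
  · intro t
    have := (h2 t).mapHom (S.dil s)
    rwa [S.dil_of_mem s (h3 t).1, pow_one] at this
  · intro t
    refine ⟨Submodule.smul_mem _ _ (h3 t).1, ?_⟩
    rw [norm_smul, Real.norm_eq_abs, abs_of_nonneg hs]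
    gcongr
    exact (h3 t).2
  · intro t ht
    beta_reduce
    rw [h4 t ht, map_one]
  · intro t ht
    beta_reduce
    rw [h5 t ht]

/-- The logarithms of the products of `k` exponentials of elements of the first layer of norm at
most `n`. -/
def productSet (S : Stratification g) (n : ℕ) : ℕ → Set g
  | 0 => {0}
  | k + 1 => (fun p : g × g => bch S.step p.1 p.2) ''
      (productSet S n k ×ˢ (Metric.closedBall 0 n ∩ S.layer 1))

/-- Compactness is for Baire's theorem; the speed bound, uniform over the set, is what becomes a
bound near the identity. -/
theorem productSet_spec (S : Stratification g) (n k : ℕ) : IsCompact (productSet S n k) ∧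
    ∃ R, ∀ X ∈ productSet S n k, IsReachable R (exp X : StratifiedGroup S) := by
  have : ProperSpace g := FiniteDimensional.proper ℝ g
  obtain ⟨D, hD, h⟩ := exists_isReachable_exp (S := S)
  induction k with
  | zero =>
    refine ⟨isCompact_singleton, 0, ?_⟩
    rintro _ rfl
    exact isReachable_one
  | succ k ih =>
    obtain ⟨hc, R, hR⟩ := ih
    refine ⟨(hc.prod ((isCompact_closedBall 0 _).inter_right
      (S.layer 1).closed_of_finiteDimensional)).image (S.contDiff_mul (n := 0)).continuous, ?_⟩
    refine ⟨2 * R + 2 * (D * n), ?_⟩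
    rintro _ ⟨⟨X, Y⟩, ⟨hX, hY, hY1⟩, rfl⟩
    refine (hR X hX).mul ((h Y hY1).mono ?_)
    gcongr
    simpa using hY

theorem iUnion_productSet (S : Stratification g) :
    ⋃ i : ℕ × ℕ, productSet S i.1 i.2 = univ := by
  have hmono : ∀ {n n' : ℕ}, n ≤ n' → ∀ k, productSet S n k ⊆ productSet S n' k := by
    intro n n' hn k
    induction k with
    | zero => exact subset_rfl
    | succ k ih =>
      refine image_mono (prod_mono ih (inter_subset_inter_left _ ?_))
      exact Metric.closedBall_subset_closedBall (by exact_mod_cast hn)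
  have key : ∀ p : StratifiedGroup S, ∃ n k, p.log ∈ productSet S n k := by
    intro p
    induction p using exp_induction with
    | one => exact ⟨0, 0, rfl⟩
    | mul_exp q hq X hX =>
      obtain ⟨n, k, h⟩ := hq
      obtain ⟨n', hn'⟩ := exists_nat_ge ‖X‖
      refine ⟨max n n', k + 1, (q.log, X), ⟨hmono (le_max_left _ _) k h, ?_, hX⟩, rfl⟩
      rw [mem_closedBall_zero_iff]
      refine hn'.trans ?_
      exact_mod_cast le_max_right n n'
  refine eq_univ_of_forall fun X => ?_
  obtain ⟨n, k, h⟩ := key (exp X)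
  exact mem_iUnion.2 ⟨(n, k), h⟩

/-- Quantitative reachability. -/
theorem exists_isReachable_of_norm_proj_le (S : Stratification g) : ∃ C : ℝ, 0 < C ∧
    ∀ (X : g) (r : ℝ), 0 < r → (∀ j, ‖S.proj j X‖ ≤ r ^ j) →
      IsReachable (C * r) (exp X : StratifiedGroup S) := by
  have : CompleteSpace g := FiniteDimensional.complete ℝ g
  -- By Baire's theorem one of the countably many compact sets covering `g` has an interior point
  -- `x₀`. Translation by its inverse gives a neighbourhood of the identity reachable with uniformly
  -- bounded speed, and dilations give every scale.
  obtain ⟨⟨n, k⟩, x₀, hx₀⟩ := nonempty_interior_of_iUnion_of_closed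
    (fun i : ℕ × ℕ => (productSet_spec S i.1 i.2).1.isClosed) (iUnion_productSet S)
  obtain ⟨-, R, hR⟩ := productSet_spec S n k
  obtain ⟨R', hR'⟩ := exists_isReachable (exp x₀ : StratifiedGroup S)⁻¹
  have hcont : ContinuousAt (fun y => bch S.step x₀ y) 0 :=
    ((S.contDiff_mul_left (n := 0) x₀).continuous).continuousAt
  have hnhds : (fun y => bch S.step x₀ y) ⁻¹' productSet S n k ∈ 𝓝 (0 : g) := by
    refine hcont.preimage_mem_nhds ?_
    rw [S.bch_zero]
    exact mem_interior_iff_mem_nhds.1 hx₀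
  obtain ⟨ε, hε, hball⟩ := Metric.mem_nhds_iff.1 hnhds
  -- After rescaling, each of the `step + 1` components has norm at most `ℓ`, and their sum must
  -- stay below `ε`; `ℓ ≤ 1` gives `ℓ ^ j ≤ ℓ`.
  let ℓ : ℝ := min 1 (ε / (2 * (S.step + 1)))
  have hℓ : 0 < ℓ := by positivity
  have hreach : ∀ y, ‖y‖ < ε → IsReachable (2 * R' + 2 * R) (exp y : StratifiedGroup S) := by
    intro y hy
    have h1 := hR _ (hball (mem_ball_zero_iff.2 hy))
    have h2 := hR'.mul h1
    have h3 : (exp x₀ : StratifiedGroup S)⁻¹ * exp (bch S.step x₀ y) = exp y :=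
      inv_mul_cancel_left (exp x₀ : StratifiedGroup S) (exp y)
    rwa [h3] at h2
  refine ⟨(|2 * R' + 2 * R| + 1) / ℓ, by positivity, fun X r hr hX => ?_⟩
  have h1 : ‖S.dil (ℓ / r) X‖ < ε := by
    refine (S.norm_le_sum_proj _).trans_lt ?_
    have : ∀ j ∈ Finset.range (S.step + 1), ‖S.proj j (S.dil (ℓ / r) X)‖ ≤ ℓ := by
      intro j _
      rcases Nat.eq_zero_or_pos j with rfl | hj
      · rw [S.proj_zero_layer, norm_zero]; exact hℓ.le
      · rw [S.proj_dil, norm_smul, norm_pow, Real.norm_eq_abs, abs_of_pos (by positivity)]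
        calc (ℓ / r) ^ j * ‖S.proj j X‖ ≤ (ℓ / r) ^ j * r ^ j := by gcongr; exact hX j
          _ = ℓ ^ j := by rw [← mul_pow, div_mul_cancel₀ _ hr.ne']
          _ ≤ ℓ := pow_le_of_le_one hℓ.le (min_le_left _ _) hj.ne'
    refine (Finset.sum_le_sum this).trans_lt ?_
    rw [Finset.sum_const, Finset.card_range, nsmul_eq_mul]
    push_cast
    have h2 : ℓ ≤ ε / (2 * (S.step + 1)) := min_le_right _ _
    calc ((S.step : ℝ) + 1) * ℓ ≤ (S.step + 1) * (ε / (2 * (S.step + 1))) := by gcongr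
      _ = ε / 2 := by field_simp
      _ < ε := by linarith
  have h2 := (hreach _ h1).dil (s := r / ℓ) (by positivity)
  rw [mapHom_exp, S.dil_dil, show r / ℓ * (ℓ / r) = 1 by field_simp, S.dil_one] at h2
  refine h2.mono ?_
  rw [div_mul_eq_mul_div, div_mul_eq_mul_div, mul_comm r]
  refine div_le_div_of_nonneg_right (mul_le_mul_of_nonneg_right ?_ hr.le) hℓ.le
  linarith [le_abs_self (2 * R' + 2 * R)]

end StratifiedGroup

/-! ### The Carnot-Carathéodory distance and the ball-box estimates. -/

namespace CarnotStructure

variable {g : Type*} [LieRing g] [LieAlgebra ℝ g] [FiniteDimensional ℝ g] (C : CarnotStructure g)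

open Set StratifiedGroup MeasureTheory

theorem isHorizontalCurve_iff {p q : C.Group} {γ : ℝ → C.Group} {u : ℝ → C.layer 1} :
    C.IsHorizontalCurve p q γ u ↔
      ContDiffOn ℝ (⊤ : ℕ∞) (fun t => (γ t).log) (Icc 0 1) ∧
      (∀ t ∈ Icc (0 : ℝ) 1, HasVelocity γ (u t : g) (Icc 0 1) t) ∧ γ 0 = p ∧ γ 1 = q := by
  let P : g →L[ℝ] (Fin (Module.finrank ℝ g) → ℝ) :=
    LinearMap.toContinuousLinearMap (coords g).toLinearMap
  let Q : (Fin (Module.finrank ℝ g) → ℝ) →L[ℝ] g :=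
    LinearMap.toContinuousLinearMap (coords g).symm.toLinearMap
  have hQP : ∀ x, Q (P x) = x := fun x => (coords g).symm_apply_apply x
  constructor
  · rintro ⟨h1, h2, h3, h4⟩
    refine ⟨?_, fun t ht => ?_, h3, h4⟩
    · exact (Q.contDiff.comp_contDiffOn h1).congr fun t _ => (hQP _).symm
    · have h5 := h2 t ht
      rw [leftInvariantField_eq] at h5
      have h6 := Q.hasFDerivAt.comp_hasDerivWithinAt t h5
      have h7 : (Q ∘ fun t => (γ t).chart) = fun t => (γ t).log := funext fun t => hQP _
      rw [h7] at h6
      exact h6.congr_deriv (hQP _)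
  · rintro ⟨h1, h2, h3, h4⟩
    refine ⟨P.contDiff.comp_contDiffOn h1, fun t ht => ?_, h3, h4⟩
    rw [leftInvariantField_eq]
    exact P.hasFDerivAt.comp_hasDerivWithinAt t (h2 t ht)

theorem isHorizontalCurve_const_mul {p q : C.Group} {γ : ℝ → C.Group} {u : ℝ → C.layer 1}
    (h : C.IsHorizontalCurve p q γ u) (a : C.Group) :
    C.IsHorizontalCurve (a * p) (a * q) (fun t => a * γ t) u := by
  rw [isHorizontalCurve_iff] at h ⊢
  obtain ⟨h1, h2, h3, h4⟩ := h
  refine ⟨(C.contDiff_mul_left a.log).comp_contDiffOn h1, fun t ht => (h2 t ht).const_mul a, ?_, ?_⟩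
  · simp only [h3]
  · simp only [h4]

theorem dist_mul_left (a p q : C.Group) : C.dist (a * p) (a * q) = C.dist p q := by
  unfold dist
  congr 1
  ext r
  constructor
  · rintro ⟨γ, u, h, hr⟩
    refine ⟨fun t => a⁻¹ * γ t, u, ?_, hr⟩
    simpa using C.isHorizontalCurve_const_mul h a⁻¹
  · rintro ⟨γ, u, h, hr⟩
    exact ⟨fun t => a * γ t, u, C.isHorizontalCurve_const_mul h a, hr⟩

theorem dist_eq_dist_one (p q : C.Group) : C.dist p q = C.dist 1 (p⁻¹ * q) := by
  rw [← C.dist_mul_left p⁻¹ p q, inv_mul_cancel]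

theorem dist_nonneg (p q : C.Group) : 0 ≤ C.dist p q := by
  refine Real.sInf_nonneg ?_
  rintro _ ⟨γ, u, -, rfl⟩
  exact intervalIntegral.integral_nonneg zero_le_one fun t _ => Real.sqrt_nonneg _

theorem exists_sqrt_inner_bounds : ∃ a b : ℝ, 0 < a ∧ 0 < b ∧
    ∀ u : C.layer 1, a * ‖(u : g)‖ ≤ √(C.inner u u) ∧ √(C.inner u u) ≤ b * ‖(u : g)‖ := by
  have : ProperSpace (C.layer 1) := FiniteDimensional.proper ℝ _
  let B := C.inner.toContinuousBilinearMap
  have hB : ∀ u, B u u = C.inner u u := fun u => rfl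
  have hcont : Continuous fun u : C.layer 1 => √(C.inner u u) := by
    simp only [← hB]
    fun_prop
  have hs : ∀ (t : ℝ) (u : C.layer 1), √(C.inner (t • u) (t • u)) = |t| * √(C.inner u u) := by
    intro t u
    rw [map_smul, map_smul, LinearMap.smul_apply, smul_eq_mul, smul_eq_mul, ← mul_assoc,
      Real.sqrt_mul (mul_self_nonneg t), Real.sqrt_mul_self_eq_abs]
  have hsphere : IsCompact (Metric.sphere (0 : C.layer 1) 1) := isCompact_sphere _ _
  obtain ⟨b, hb⟩ := hsphere.exists_bound_of_continuousOn hcont.continuousOn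
  obtain ⟨a, ha, ha'⟩ : ∃ a : ℝ, 0 < a ∧ ∀ u ∈ Metric.sphere (0 : C.layer 1) 1,
      a ≤ √(C.inner u u) := by
    rcases (Metric.sphere (0 : C.layer 1) 1).eq_empty_or_nonempty with he | hne
    · exact ⟨1, one_pos, by simp [he]⟩
    · obtain ⟨v, hv, hmin⟩ := hsphere.exists_isMinOn hne hcont.continuousOn
      refine ⟨√(C.inner v v), Real.sqrt_pos.2 (C.inner_pos v ?_), fun u hu => hmin hu⟩
      rintro rfl
      simp at hv
  refine ⟨a, |b| + 1, ha, by positivity, fun u => ?_⟩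
  by_cases hu : u = 0
  · simp [hu]
  · have hn : 0 < ‖u‖ := norm_pos_iff.2 hu
    have hmem : ‖u‖⁻¹ • u ∈ Metric.sphere (0 : C.layer 1) 1 := by
      rw [mem_sphere_zero_iff_norm, norm_smul, norm_inv, norm_norm, inv_mul_cancel₀ hn.ne']
    have h1 := ha' _ hmem
    have h2 := (le_abs_self _).trans (hb _ hmem)
    rw [hs, abs_of_pos (by positivity), inv_mul_eq_div] at h1 h2
    rw [le_div_iff₀ hn] at h1
    rw [div_le_iff₀ hn] at h2
    refine ⟨h1, h2.trans ?_⟩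
    change b * ‖u‖ ≤ (|b| + 1) * ‖u‖
    gcongr
    linarith [le_abs_self b]

theorem isHorizontalCurve_of_isReachable {R : ℝ} {p : C.Group} (h : IsReachable R p) :
    ∃ γ u, C.IsHorizontalCurve 1 p γ u ∧ ∀ t, ‖(u t : g)‖ ≤ R := by
  obtain ⟨γ, u, h1, h2, h3, h4, h5⟩ := h
  refine ⟨γ, fun t => ⟨u t, (h3 t).1⟩, C.isHorizontalCurve_iff.2 ⟨h1.contDiffOn, fun t _ =>
    (h2 t).mono (subset_univ _), h4 0 le_rfl, h5 1 le_rfl⟩, fun t => (h3 t).2⟩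

/-- An infimum over the empty set would be `0`, and then no lower estimate of the distance could
hold. -/
theorem nonempty_lengths (p : C.Group) : {r | ∃ γ u, C.IsHorizontalCurve 1 p γ u ∧
    r = ∫ t in (0 : ℝ)..1, √(C.inner (u t) (u t))}.Nonempty := by
  obtain ⟨R, hR⟩ := exists_isReachable p
  obtain ⟨γ, u, h, -⟩ := C.isHorizontalCurve_of_isReachable hR
  exact ⟨_, γ, u, h, rfl⟩

/-- The upper ball-box estimate. -/
theorem exists_dist_le : ∃ K : ℝ, 0 < K ∧ ∀ (p q : C.Group) (r : ℝ), 0 < r →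
    (∀ j, ‖C.proj j (p⁻¹ * q).log‖ ≤ r ^ j) → C.dist p q ≤ K * r := by
  obtain ⟨K, hK, h⟩ := exists_isReachable_of_norm_proj_le C.toStratification
  obtain ⟨a, b, ha, hb, hab⟩ := C.exists_sqrt_inner_bounds
  refine ⟨b * K, by positivity, fun p q r hr hj => ?_⟩
  rw [dist_eq_dist_one]
  obtain ⟨γ, u, hγ, hu⟩ := C.isHorizontalCurve_of_isReachable (h _ r hr hj)
  have h0 : C.dist 1 (p⁻¹ * q) ≤ ∫ t in (0 : ℝ)..1, √(C.inner (u t) (u t)) := by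
    refine csInf_le ⟨0, ?_⟩ ⟨γ, u, hγ, rfl⟩
    rintro _ ⟨γ, u, -, rfl⟩
    exact intervalIntegral.integral_nonneg zero_le_one fun t _ => Real.sqrt_nonneg _
  refine h0.trans ?_
  · have h1 := intervalIntegral.norm_integral_le_of_norm_le_const (a := (0 : ℝ)) (b := 1)
      (C := b * (K * r)) (f := fun t => √(C.inner (u t) (u t))) (fun t _ => by
        rw [Real.norm_eq_abs, abs_of_nonneg (Real.sqrt_nonneg _)]
        refine (hab _).2.trans ?_
        gcongr
        exact hu t)
    rw [sub_zero, abs_one, mul_one, Real.norm_eq_abs] at h1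
    refine (le_abs_self _).trans (h1.trans (by rw [mul_assoc]))

/-- Only the curve is assumed smooth. But `u` is the derivative of its first-layer coordinates, so
it inherits continuity. -/
theorem continuousOn_of_isHorizontalCurve {p q : C.Group} {γ : ℝ → C.Group} {u : ℝ → C.layer 1}
    (h : C.IsHorizontalCurve p q γ u) : ContinuousOn (fun t => (u t : g)) (Icc 0 1) := by
  obtain ⟨h1, h2, -, -⟩ := C.isHorizontalCurve_iff.1 h
  have h3 : ContDiffOn ℝ 1 (fun t => C.proj 1 (γ t).log) (Icc 0 1) :=
    (LinearMap.toContinuousLinearMap (C.proj 1)).contDiff.comp_contDiffOn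
      (h1.of_le (by exact_mod_cast le_top))
  have h4 := h3.continuousOn_derivWithin (uniqueDiffOn_Icc zero_lt_one) le_rfl
  refine h4.congr fun t ht => ?_
  have h5 := (h2 t ht).proj_one
  rw [C.proj_same (u t).2] at h5
  exact (h5.derivWithin (uniqueDiffOn_Icc zero_lt_one t ht)).symm

/-- The lower ball-box estimate. -/
theorem exists_norm_proj_le_dist : ∃ K : ℝ, 0 < K ∧ ∀ (p q : C.Group) (j : ℕ),
    ‖C.proj j (p⁻¹ * q).log‖ ≤ K * C.dist p q ^ j := by
  obtain ⟨K, hK, h⟩ := StratifiedGroup.exists_norm_proj_log_le C.toStratification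
  obtain ⟨a, b, ha, hb, hab⟩ := C.exists_sqrt_inner_bounds
  -- One constant for all `j ≤ step`: it dominates every `a⁻¹ ^ j`.
  refine ⟨K * (1 + a⁻¹) ^ C.step, by positivity, fun p q j => ?_⟩
  rcases lt_or_ge C.step j with hj | hj
  · rw [C.proj_of_lt hj, norm_zero]
    have := C.dist_nonneg p q
    positivity
  rw [C.dist_eq_dist_one p q]
  set x := p⁻¹ * q
  -- The infimum need not be attained, so an almost shortest curve is used; `ε` also keeps the
  -- radius positive.
  have key : ∀ ε : ℝ, 0 < ε → ‖C.proj j x.log‖ ≤ K * (a⁻¹ * (C.dist 1 x + ε)) ^ j := by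
    intro ε hε
    obtain ⟨r, ⟨γ, u, hγ, rfl⟩, hr⟩ := exists_lt_of_csInf_lt (C.nonempty_lengths x)
      (lt_add_of_pos_right (C.dist 1 x) hε)
    obtain ⟨-, h2, h3, h4⟩ := C.isHorizontalCurve_iff.1 hγ
    have hu := C.continuousOn_of_isHorizontalCurve hγ
    have hd := C.dist_nonneg 1 x
    have h5 := h γ (fun t => (u t : g)) (a⁻¹ * (C.dist 1 x + ε)) (by positivity) h2
      (fun t _ => (u t).2) hu h3 ?_ j
    · rwa [h4] at h5
    have hu' : ContinuousOn u (Icc 0 1) := continuousOn_iff_continuous_domRestrict.2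
      (Continuous.subtype_mk (continuousOn_iff_continuous_domRestrict.1 hu) _)
    have hB : ContinuousOn (fun t => √(C.inner (u t) (u t))) (Icc 0 1) := by
      have : Continuous fun v : C.layer 1 => √(C.inner.toContinuousBilinearMap v v) := by fun_prop
      exact this.comp_continuousOn hu'
    rw [← uIcc_of_le zero_le_one] at hu hB
    calc ∫ t in (0 : ℝ)..1, ‖(u t : g)‖ ≤ ∫ t in (0 : ℝ)..1, a⁻¹ * √(C.inner (u t) (u t)) := by
          refine intervalIntegral.integral_mono_on zero_le_one hu.norm.intervalIntegrable
            (hB.const_smul a⁻¹).intervalIntegrable fun t _ => ?_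
          rw [le_inv_mul_iff₀ ha]
          exact (hab _).1
      _ = a⁻¹ * ∫ t in (0 : ℝ)..1, √(C.inner (u t) (u t)) :=
          intervalIntegral.integral_const_mul _ _
      _ ≤ _ := by gcongr
  have hlim : Filter.Tendsto (fun ε : ℝ => K * (a⁻¹ * (C.dist 1 x + ε)) ^ j) (𝓝[>] 0)
      (𝓝 (K * (a⁻¹ * (C.dist 1 x + 0)) ^ j)) := by
    have : Continuous fun ε : ℝ => K * (a⁻¹ * (C.dist 1 x + ε)) ^ j := by fun_prop
    exact (this.tendsto 0).mono_left nhdsWithin_le_nhds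
  have h1 := ge_of_tendsto hlim (Filter.eventually_of_mem self_mem_nhdsWithin key)
  refine h1.trans ?_
  have hd := C.dist_nonneg 1 x
  rw [add_zero, mul_pow, mul_assoc]
  gcongr
  calc a⁻¹ ^ j ≤ (1 + a⁻¹) ^ j := by gcongr; linarith
    _ ≤ (1 + a⁻¹) ^ C.step := by
      have : 0 < a⁻¹ := by positivity
      exact pow_le_pow_right₀ (by linarith) hj

theorem norm_proj_symm (p q : C.Group) (j : ℕ) :
    ‖C.proj j (q⁻¹ * p).log‖ = ‖C.proj j (p⁻¹ * q).log‖ := by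
  have : q⁻¹ * p = (p⁻¹ * q)⁻¹ := by group
  rw [this, log_inv, map_neg, norm_neg]

theorem eq_of_dist_eq_zero {p q : C.Group} (h : C.dist p q = 0) : p = q := by
  obtain ⟨K, hK, hle⟩ := C.exists_norm_proj_le_dist
  have : (p⁻¹ * q).log = 0 := C.eq_of_proj fun j => by
    rcases Nat.eq_zero_or_pos j with rfl | hj
    · rw [C.proj_zero_layer, C.proj_zero_layer]
    · have := hle p q j
      rw [h, zero_pow hj.ne', mul_zero, norm_le_zero_iff] at this
      rw [this, map_zero]
  have h1 : p⁻¹ * q = 1 := ext_log this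
  exact (inv_mul_eq_one.1 h1)

end CarnotStructure

/-! ### Differentials of continuously differentiable maps -/

namespace Stratification

variable {g : Type*} [LieRing g] [LieAlgebra ℝ g] [FiniteDimensional ℝ g] (S : Stratification g)

theorem continuous_dil (X : g) : Continuous fun s : ℝ => S.dil s X := by
  simp only [dil_apply, scale_eq_sum]
  fun_prop

theorem dil_zero (X : g) : S.dil 0 X = 0 := S.eq_of_proj fun j => by
  rw [S.proj_dil, map_zero]
  rcases Nat.eq_zero_or_pos j with rfl | hj
  · rw [S.proj_zero_layer, smul_zero]
  · rw [zero_pow hj.ne', zero_smul]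

theorem continuous_proj (j : ℕ) : Continuous (S.proj j) :=
  LinearMap.continuous_of_finiteDimensional _

end Stratification

theorem Continuous.bch {g : Type*} [LieRing g] [LieAlgebra ℝ g] [FiniteDimensional ℝ g]
    {E : Type*} [TopologicalSpace E] (N : ℕ) {X Y : E → g} (hX : Continuous X)
    (hY : Continuous Y) : Continuous fun e => bch N (X e) (Y e) := by
  have h : Continuous fun p : g × g => _root_.bch N p.1 p.2 :=
    ((contDiff_fst (n := 0)).bch N contDiff_snd).continuous
  have h1 := h.comp (hX.prodMk hY)
  exact h1

namespace StratifiedGroup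

variable {g : Type*} [LieRing g] [LieAlgebra ℝ g] [FiniteDimensional ℝ g] {S : Stratification g}
variable {f : StratifiedGroup S → StratifiedGroup S}

open Set Filter

/-- The differential of `f` at `p`, read in the left trivialization of the tangent bundle. -/
noncomputable def differential (f : StratifiedGroup S → StratifiedGroup S) (p : StratifiedGroup S) :
    g →L[ℝ] g :=
  fderiv ℝ (fun y => ((f p)⁻¹ * f (p * exp y)).log) 0

/-- The map `f` preserves the horizontal directions. -/
def IsContact (f : StratifiedGroup S → StratifiedGroup S) : Prop :=
  ∀ p, ∀ X ∈ S.layer 1, differential f p X ∈ S.layer 1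

theorem IsC1.contDiff (hf : IsC1 f) : ContDiff ℝ 1 fun X => (f (exp X)).log := by
  let P : g →L[ℝ] (Fin (Module.finrank ℝ g) → ℝ) :=
    LinearMap.toContinuousLinearMap (coords g).toLinearMap
  let Q : (Fin (Module.finrank ℝ g) → ℝ) →L[ℝ] g :=
    LinearMap.toContinuousLinearMap (coords g).symm.toLinearMap
  have hQP : ∀ x, (coords g).symm (coords g x) = x := (coords g).symm_apply_apply
  have hf' : ContDiff ℝ 1 fun v => chart (f (exp ((coords g).symm v))) := hf
  have h : ContDiff ℝ 1 fun X => Q (chart (f (exp ((coords g).symm (P X))))) :=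
    Q.contDiff.comp (hf'.comp P.contDiff)
  have e : (fun X => Q (chart (f (exp ((coords g).symm (P X)))))) = fun X => (f (exp X)).log := by
    funext X
    change (coords g).symm (coords g (f (exp ((coords g).symm (coords g X)))).log) = _
    rw [hQP, hQP]
  rwa [e] at h

theorem IsC1.contDiff_local (hf : IsC1 f) :
    ContDiff ℝ 1 fun x : g × g => ((f (exp x.1))⁻¹ * f (exp x.1 * exp x.2)).log := by
  have h1 := (hf.contDiff.comp (contDiff_fst (F := g))).neg
  have h2 := hf.contDiff.comp S.contDiff_mul
  have h3 := h1.bch S.step h2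
  exact h3

theorem IsC1.hasFDerivAt (hf : IsC1 f) (p : StratifiedGroup S) :
    HasFDerivAt (fun y => ((f p)⁻¹ * f (p * exp y)).log) (differential f p) 0 := by
  have h := hf.contDiff_local.comp ((contDiff_const (c := p.log)).prodMk
    (contDiff_id (E := g)))
  exact (h.differentiable one_ne_zero 0).hasFDerivAt

theorem IsC1.continuous_differential (hf : IsC1 f) :
    Continuous fun X => differential f (exp X) := by
  let G := fun x : g × g => ((f (exp x.1))⁻¹ * f (exp x.1 * exp x.2)).log
  have h : ∀ X, differential f (exp X) =
      (fderiv ℝ G (X, 0)).comp (ContinuousLinearMap.inr ℝ g g) := fun X => by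
    have h1 : HasFDerivAt G (fderiv ℝ G (X, 0)) (X, 0) :=
      (hf.contDiff_local.differentiable one_ne_zero _).hasFDerivAt
    exact (hf.hasFDerivAt (exp X)).unique (h1.comp (0 : g) (hasFDerivAt_prodMk_right X 0))
  simp only [h]
  have h2 : Continuous (fderiv ℝ G) := hf.contDiff_local.continuous_fderiv one_ne_zero
  exact (h2.comp (by fun_prop : Continuous fun X : g => (X, (0 : g)))).clm_comp continuous_const

theorem HasVelocity.comp {c : ℝ → StratifiedGroup S} {u : g} {s : Set ℝ} {t : ℝ} (hf : IsC1 f)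
    (h : HasVelocity c u s t) :
    HasVelocity (fun t => f (c t)) (differential f (c t) u) s t := by
  have h1 := h.const_mul (c t)⁻¹
  rw [HasVelocity, inv_mul_cancel, log_one, S.leftDeriv_zero, ContinuousLinearMap.id_apply] at h1
  have h2 : HasFDerivAt (fun y => ((f (c t))⁻¹ * f (c t * exp y)).log) (differential f (c t))
      ((c t)⁻¹ * c t).log := by
    rw [inv_mul_cancel]; exact hf.hasFDerivAt (c t)
  have h3 := h2.comp_hasDerivWithinAt t h1
  have h4 : HasVelocity (fun τ => (f (c t))⁻¹ * f (c τ)) (differential f (c t) u) s t := by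
    rw [HasVelocity, inv_mul_cancel, log_one, S.leftDeriv_zero, ContinuousLinearMap.id_apply]
    refine h3.congr (fun τ _ => ?_) ?_ <;>
    simp only [Function.comp_apply, exp_log, mul_inv_cancel_left]
  simpa using h4.const_mul (f (c t))

/-! ### The Pansu differential of a contact map -/

/-- The blow-up of `f` at `p` at the scale `s`. -/
noncomputable def blowUp (f : StratifiedGroup S → StratifiedGroup S) (p : StratifiedGroup S)
    (s : ℝ) (z : StratifiedGroup S) : StratifiedGroup S :=
  mapHom S (S.dil s⁻¹) ((f p)⁻¹ * f (p * mapHom S (S.dil s) z))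

/-- The blow-up at `z * exp X` is the blow-up at `z` times the endpoint of a curve `c s`. By
contactness the velocity of this curve is horizontal, so the dilation by `s⁻¹` cancels the factor
`s` of the chain rule, and the velocities converge uniformly to `differential f p X`. Stability of
endpoints gives the limit. -/
theorem tendsto_blowUp_mul_exp (hf : IsC1 f) (hc : IsContact f) (p : StratifiedGroup S)
    {z w : StratifiedGroup S}
    (h : Tendsto (fun s => (blowUp f p s z).log) (𝓝[>] 0) (𝓝 w.log)) {X : g} (hX : X ∈ S.layer 1) :
    Tendsto (fun s => (blowUp f p s (z * exp X)).log) (𝓝[>] 0)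
      (𝓝 (w * exp (differential f p X)).log) := by
  let q : ℝ → StratifiedGroup S := fun s => p * mapHom S (S.dil s) z
  let c : ℝ → ℝ → StratifiedGroup S := fun s t =>
    mapHom S (S.dil s⁻¹) ((f (q s))⁻¹ * f (q s * exp ((t * s) • X)))
  have hsplit : ∀ s, (blowUp f p s (z * exp X)) = blowUp f p s z * c s 1 := fun s => by
    simp only [blowUp, c, q]
    rw [← map_mul, one_mul, map_mul (mapHom S (S.dil s)) z, mapHom_exp (S.dil s) X,
      S.dil_of_mem s hX, pow_one, mul_assoc (f p)⁻¹, mul_inv_cancel_left, mul_assoc p]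
  have hvel : ∀ s : ℝ, 0 < s → ∀ t, HasVelocity (c s)
      (differential f (q s * exp ((t * s) • X)) X) (Icc 0 1) t := fun s hs t => by
    have h1 : HasDerivAt (fun t : ℝ => t * s) s t := by simpa using (hasDerivAt_id t).mul_const s
    have h2 := (((hasVelocity_exp_smul (S := S) X univ (t * s)).scomp (φ := fun t => t * s)
      h1.hasDerivWithinAt (mapsTo_univ (s := Icc (0 : ℝ) 1) _)).const_mul (q s)).comp hf
    have h3 := (h2.const_mul (f (q s))⁻¹).mapHom (S.dil s⁻¹)
    rw [S.dil_of_mem s⁻¹ (hc _ _ (Submodule.smul_mem _ _ hX)), pow_one, map_smul, smul_smul,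
      inv_mul_cancel₀ hs.ne', one_smul] at h3
    exact h3
  have hunif : ∀ ε > 0, ∀ᶠ s in 𝓝[>] (0 : ℝ), ∀ t ∈ Icc (0 : ℝ) 1,
      ‖differential f (q s * exp ((t * s) • X)) X - differential f p X‖ ≤ ε := by
    intro ε hε
    refine Eventually.filter_mono nhdsWithin_le_nhds ?_
    refine isCompact_Icc.eventually_forall_of_forall_eventually fun t _ => ?_
    have hcont : Continuous fun x : ℝ × ℝ =>
        ‖differential f (q x.1 * exp ((x.2 * x.1) • X)) X - differential f p X‖ := by
      have h1 : Continuous fun x : ℝ × ℝ => S.dil x.1 z.log :=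
        (S.continuous_dil z.log).comp continuous_fst
      have h2 : Continuous fun x : ℝ × ℝ => bch S.step p.log (S.dil x.1 z.log) :=
        continuous_const.bch S.step h1
      have h3 : Continuous fun x : ℝ × ℝ =>
          bch S.step (bch S.step p.log (S.dil x.1 z.log)) ((x.2 * x.1) • X) :=
        h2.bch S.step (by fun_prop)
      have h4 := hf.continuous_differential.comp h3
      have h5 := ((h4.clm_apply (continuous_const (y := X))).sub
        (continuous_const (y := differential f p X))).norm
      exact h5
    have h0 : ‖differential f (q (0 : ℝ) * exp ((t * 0) • X)) X - differential f p X‖ < ε := by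
      have h1 : q (0 : ℝ) * exp ((t * 0) • X) = p := by
        change p * exp (S.dil 0 z.log) * exp ((t * 0) • X) = p
        rw [S.dil_zero, mul_zero, zero_smul, exp_zero, mul_one, mul_one]
      rw [h1, sub_self, norm_zero]
      exact hε
    filter_upwards [hcont.continuousAt.eventually_lt
      (continuousAt_const (x := ((0 : ℝ), t)) (y := ε)) h0] with x hx
    exact hx.le
  have hlim : Tendsto (fun s => (c s 1).log) (𝓝[>] 0) (𝓝 (differential f p X)) := by
    refine tendsto_log_of_velocity (S := S) (c := c)
      (u := fun s t => differential f (q s * exp ((t * s) • X)) X) ?_ ?_ hunif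
    · filter_upwards [self_mem_nhdsWithin] with s hs t _
      exact hvel s hs t
    · refine Eventually.of_forall fun s => ?_
      simp only [c]
      rw [zero_mul, zero_smul, exp_zero, mul_one, inv_mul_cancel, map_one]
  simp only [hsplit]
  have hm : Continuous fun x : g × g => bch S.step x.1 x.2 :=
    continuous_fst.bch S.step continuous_snd
  have hfin := (hm.tendsto (w.log, differential f p X)).comp (h.prodMk_nhds hlim)
  exact hfin

/-- The first layer generates the group, so the limit propagates from the identity to every point.
The rule `A (z * exp X) = A z * exp (differential f p X)` for horizontal `X` makes `A`
multiplicative. This is Pansu's differential. -/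
theorem exists_tendsto_blowUp (hf : IsC1 f) (hc : IsContact f) (p : StratifiedGroup S) :
    ∃ A : StratifiedGroup S →* StratifiedGroup S,
      ∀ z, Tendsto (fun s => (blowUp f p s z).log) (𝓝[>] 0) (𝓝 (A z).log) := by
  have h1 : Tendsto (fun s => (blowUp f p s 1).log) (𝓝[>] 0)
      (𝓝 (1 : StratifiedGroup S).log) := by
    have : ∀ s, blowUp f p s 1 = 1 := fun s => by simp [blowUp]
    simp only [this]
    exact tendsto_const_nhds
  have hex : ∀ z, ∃ w : StratifiedGroup S,
      Tendsto (fun s => (blowUp f p s z).log) (𝓝[>] 0) (𝓝 w.log) := fun z => by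
    induction z using exp_induction with
    | one => exact ⟨1, h1⟩
    | mul_exp z ih X hX =>
      obtain ⟨w, hw⟩ := ih
      exact ⟨_, tendsto_blowUp_mul_exp hf hc p hw hX⟩
  choose A hA using hex
  have hone : A 1 = 1 := ext_log (tendsto_nhds_unique (hA 1) h1)
  have hexp : ∀ z, ∀ X ∈ S.layer 1, A (z * exp X) = A z * exp (differential f p X) :=
    fun z X hX => ext_log (tendsto_nhds_unique (hA _) (tendsto_blowUp_mul_exp hf hc p (hA z) hX))
  refine ⟨{ toFun := A, map_one' := hone, map_mul' := fun z z' => ?_ }, hA⟩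
  induction z' using exp_induction with
  | one => rw [mul_one, hone, mul_one]
  | mul_exp q ih X hX => rw [← mul_assoc, hexp _ _ hX, hexp _ _ hX, ih, mul_assoc]

/-- On `ge k` the vector `s⁻ᵏ δₛ Z` tends to the `k`-th component of `Z`, so ordinary
differentiability, tested at the scale `s ^ k`, sees just that component. -/
theorem tendsto_smul_log (hf : IsC1 f) (p : StratifiedGroup S) {k : ℕ} (hk : 1 ≤ k) {Z : g}
    (hZ : Z ∈ S.ge k) :
    Tendsto (fun s : ℝ => (s⁻¹ ^ k) • ((f p)⁻¹ * f (p * exp (S.dil s Z))).log) (𝓝[>] 0)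
      (𝓝 (differential f p (S.proj k Z))) := by
  have hd : Tendsto (fun s : ℝ => s⁻¹ ^ k • S.dil s Z) (𝓝[>] 0) (𝓝 (S.proj k Z)) := by
    refine S.ge_induction (p := fun Z => Tendsto (fun s : ℝ => s⁻¹ ^ k • S.dil s Z) (𝓝[>] 0)
      (𝓝 (S.proj k Z))) hZ (fun j hj x hx => ?_) fun x y hx hy => ?_
    · have h1 : Tendsto (fun s : ℝ => s ^ (j - k) • x) (𝓝[>] 0) (𝓝 (S.proj k x)) := by
        have h2 : Continuous fun s : ℝ => s ^ (j - k) • x := by fun_prop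
        have h3 := (h2.tendsto 0).mono_left (nhdsWithin_le_nhds (s := Ioi 0))
        rw [S.proj_of_mem hx]
        rcases hj.eq_or_lt with rfl | hj
        · simpa using h3
        · rw [if_neg hj.ne]
          rwa [zero_pow (by omega), zero_smul] at h3
      refine h1.congr' ?_
      filter_upwards [self_mem_nhdsWithin] with s hs
      have hs : (0 : ℝ) < s := hs
      rw [S.dil_of_mem s hx, smul_smul, inv_pow, ← div_eq_inv_mul, pow_sub₀ _ hs.ne' hj,
        div_eq_mul_inv]
    · simpa only [map_add, smul_add] using hx.add hy
  have hc : Tendsto (fun s : ℝ => S.dil s Z) (𝓝[>] 0) (𝓝 0) := by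
    have := ((S.continuous_dil Z).tendsto 0).mono_left (nhdsWithin_le_nhds (s := Ioi 0))
    rwa [S.dil_zero] at this
  have h := (hf.hasFDerivAt p).hasFDerivWithinAt (s := univ) |>.lim
    (l := 𝓝[>] (0 : ℝ)) (c := fun s : ℝ => s⁻¹ ^ k) (d := fun s => S.dil s Z)
    (v := S.proj k Z) hc (Eventually.of_forall fun _ => mem_univ _) hd
  simpa [exp_zero] using h

/-- The components of the differential and of the blow-ups on the layers. -/
theorem proj_differential (hf : IsC1 f) (p : StratifiedGroup S)
    {A : StratifiedGroup S →* StratifiedGroup S}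
    (hA : ∀ z, Tendsto (fun s => (blowUp f p s z).log) (𝓝[>] 0) (𝓝 (A z).log))
    {k : ℕ} (hk : 1 ≤ k) {Z : g} (hZ : Z ∈ S.ge k) :
    (∀ m < k, S.proj m (A (exp Z)).log = 0) ∧
    S.proj k (A (exp Z)).log = S.proj k (differential f p (S.proj k Z)) ∧
    ∀ m, k < m → S.proj m (differential f p (S.proj k Z)) = 0 := by
  let F : ℝ → g := fun s => ((f p)⁻¹ * f (p * exp (S.dil s Z))).log
  have h1 : ∀ m, Tendsto (fun s : ℝ => s⁻¹ ^ k • S.proj m (F s)) (𝓝[>] 0)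
      (𝓝 (S.proj m (differential f p (S.proj k Z)))) := fun m => by
    have := ((S.continuous_proj m).tendsto _).comp (tendsto_smul_log hf p hk hZ)
    simpa only [Function.comp_def, map_smul] using this
  have h2 : ∀ m, Tendsto (fun s : ℝ => s⁻¹ ^ m • S.proj m (F s)) (𝓝[>] 0)
      (𝓝 (S.proj m (A (exp Z)).log)) := fun m => by
    have := ((S.continuous_proj m).tendsto _).comp (hA (exp Z))
    refine this.congr fun s => ?_
    simp only [Function.comp_def, blowUp, log_mapHom, S.proj_dil]
    rfl
  have hpow : ∀ a : ℕ, 0 < a → Tendsto (fun s : ℝ => s ^ a) (𝓝[>] 0) (𝓝 0) := fun a ha => by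
    have := ((continuous_pow a).tendsto (0 : ℝ)).mono_left (nhdsWithin_le_nhds (s := Ioi 0))
    rwa [zero_pow ha.ne'] at this
  have hmul : ∀ a b : ℕ, a < b → ∀ s : ℝ, 0 < s → s ^ (b - a) * s⁻¹ ^ b = s⁻¹ ^ a := by
    intro a b hab s hs
    rw [inv_pow, inv_pow, pow_sub₀ _ hs.ne' hab.le]
    field_simp
  -- The same component converges after multiplication by `s⁻ᵏ` and by `s⁻ᵐ`. If the exponents
  -- differ, the limit with the smaller one is zero; if they agree, the limits coincide.
  refine ⟨fun m hm => ?_, tendsto_nhds_unique (h2 k) (h1 k), fun m hm => ?_⟩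
  · have h3 := (hpow (k - m) (by omega)).smul (h1 m)
    rw [zero_smul] at h3
    refine tendsto_nhds_unique (h2 m) (h3.congr' ?_)
    filter_upwards [self_mem_nhdsWithin] with s hs
    rw [smul_smul, hmul m k hm s hs]
  · have h3 := (hpow (m - k) (by omega)).smul (h2 m)
    rw [zero_smul] at h3
    refine tendsto_nhds_unique (h1 m) (h3.congr' ?_)
    filter_upwards [self_mem_nhdsWithin] with s hs
    rw [smul_smul, hmul k m hm s hs]

/-- A linear map which preserves the layers and is the leading part of a homomorphism of groups is
a homomorphism of Lie algebras. -/
theorem map_lie_of_leading (A : StratifiedGroup S →* StratifiedGroup S) (T : g →ₗ[ℝ] g)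
    (hT : ∀ j, ∀ X ∈ S.layer j, T X ∈ S.layer j)
    (hAT : ∀ k, 1 ≤ k → ∀ Z ∈ S.ge k, (A (exp Z)).log - T Z ∈ S.ge (k + 1)) (X Y : g) :
    T ⁅X, Y⁆ = ⁅T X, T Y⁆ := by
  have hge : ∀ k, ∀ Z ∈ S.ge k, T Z ∈ S.ge k := fun k Z hZ =>
    S.ge_induction (p := fun Z => T Z ∈ S.ge k) hZ
      (fun j hj x hx => S.layer_le_ge hj (hT j x hx))
      fun x y hx hy => by rw [map_add]; exact add_mem hx hy
  induction X using S.layer_induction with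
  | add a b ha hb => simp only [add_lie, map_add, ha, hb]
  | mem i X hX =>
  induction Y using S.layer_induction with
  | add a b ha hb => simp only [lie_add, map_add, ha, hb]
  | mem j Y hY =>
  rcases Nat.eq_zero_or_pos i with rfl | hi
  · have : X = 0 := by simpa [S.layer_zero] using hX
    simp [this]
  rcases Nat.eq_zero_or_pos j with rfl | hj
  · have : Y = 0 := by simpa [S.layer_zero] using hY
    simp [this]
  have hXi := S.layer_le_ge le_rfl hX
  have hYj := S.layer_le_ge le_rfl hY
  -- `A c` is computed in two ways modulo `ge (i + j + 1)`: from the leading part of `c`, which is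
  -- the bracket, and as the commutator of the images.
  set c : StratifiedGroup S := exp X * exp Y * (exp X)⁻¹ * (exp Y)⁻¹ with hcdef
  have h1 : c.log - ⁅X, Y⁆ ∈ S.ge (i + j + 1) := log_commutator_sub_mem hi hXi hYj
  have hc : c.log ∈ S.ge (i + j) := by
    have := add_mem (S.ge_anti (Nat.le_succ _) h1) (S.lie_mem_ge hXi hYj)
    rwa [sub_add_cancel] at this
  have h2 : (A c).log - T ⁅X, Y⁆ ∈ S.ge (i + j + 1) := by
    have h3 := hAT (i + j) (by omega) c.log hc
    have h4 := hge _ _ h1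
    rw [map_sub] at h4
    have := add_mem h3 h4
    rwa [exp_log, sub_add_sub_cancel] at this
  have hAX := hAT i hi X hXi
  have hAY := hAT j hj Y hYj
  have hAX' : (A (exp X)).log ∈ S.ge i := by
    have := add_mem (S.ge_anti (Nat.le_succ _) hAX) (hge _ _ hXi)
    rwa [sub_add_cancel] at this
  have hAY' : (A (exp Y)).log ∈ S.ge j := by
    have := add_mem (S.ge_anti (Nat.le_succ _) hAY) (hge _ _ hYj)
    rwa [sub_add_cancel] at this
  have h5 : (A c).log - ⁅(A (exp X)).log, (A (exp Y)).log⁆ ∈ S.ge (i + j + 1) := by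
    have : A c = exp (A (exp X)).log * exp (A (exp Y)).log * (exp (A (exp X)).log)⁻¹ *
        (exp (A (exp Y)).log)⁻¹ := by
      simp only [hcdef, map_mul, map_inv, exp_log]
    rw [this]
    exact log_commutator_sub_mem hi hAX' hAY'
  have h6 : ⁅(A (exp X)).log, (A (exp Y)).log⁆ - ⁅T X, T Y⁆ ∈ S.ge (i + j + 1) := by
    have h7 := S.ge_anti (by omega : i + j + 1 ≤ i + 1 + j) (S.lie_mem_ge hAX hAY')
    have h8 := S.ge_anti (by omega : i + j + 1 ≤ i + (j + 1)) (S.lie_mem_ge (hge _ _ hXi) hAY)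
    have := add_mem h7 h8
    rwa [sub_lie, lie_sub, sub_add_sub_cancel] at this
  have h9 : T ⁅X, Y⁆ - ⁅T X, T Y⁆ ∈ S.ge (i + j + 1) := by
    have := sub_mem (add_mem h5 h6) h2
    rwa [sub_add_sub_cancel, sub_sub_sub_cancel_left] at this
  have h10 : T ⁅X, Y⁆ - ⁅T X, T Y⁆ ∈ S.layer (i + j) :=
    sub_mem (hT _ _ (S.lie_mem_layer hX hY)) (S.lie_mem_layer (hT _ _ hX) (hT _ _ hY))
  have := S.mem_ge.1 h9 (i + j) (by omega)
  rw [S.proj_same h10] at this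
  exact sub_eq_zero.1 this

/-- The diagonal part of the differential of a contact map is a homomorphism of Lie algebras. -/
theorem exists_lieHom_differential (hf : IsC1 f) (hc : IsContact f) (p : StratifiedGroup S) :
    ∃ T : g →ₗ⁅ℝ⁆ g, (∀ j, ∀ X ∈ S.layer j, T X ∈ S.layer j) ∧
      (∀ X ∈ S.layer 1, T X = differential f p X) ∧
      ∀ k, ∀ X ∈ S.layer k, ∀ m, k ≤ m →
        S.proj m (differential f p X) = if m = k then T X else 0 := by
  obtain ⟨A, hA⟩ := exists_tendsto_blowUp hf hc p
  let T : g →ₗ[ℝ] g := ∑ j ∈ Finset.range (S.step + 1),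
    S.proj j ∘ₗ (differential f p : g →ₗ[ℝ] g) ∘ₗ S.proj j
  have hTX : ∀ k, ∀ X ∈ S.layer k, T X = S.proj k (differential f p X) := fun k X hX => by
    simp only [T, LinearMap.sum_apply, LinearMap.comp_apply, S.proj_of_mem hX,
      ContinuousLinearMap.coe_coe]
    rcases lt_or_ge S.step k with hk | hk
    · rw [S.layer_of_lt k hk, Submodule.mem_bot] at hX
      simp [hX]
    · rw [Finset.sum_eq_single k]
      · rw [if_pos rfl]
      · intro j _ hj
        rw [if_neg hj, map_zero, map_zero]
      · intro h
        simp at h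
        omega
  have hT : ∀ j, ∀ X ∈ S.layer j, T X ∈ S.layer j := fun j X hX => by
    rw [hTX j X hX]; exact S.proj_mem _ _
  have hTproj : ∀ k Z, S.proj k (T Z) = S.proj k (differential f p (S.proj k Z)) := fun k Z => by
    induction Z using S.layer_induction with
    | add a b ha hb => simp only [map_add, ha, hb]
    | mem j Z hZ =>
      rw [S.proj_of_mem (hT j Z hZ), S.proj_of_mem hZ]
      split_ifs with h
      · rw [h]; exact hTX j Z hZ
      · simp
  have hAT : ∀ k, 1 ≤ k → ∀ Z ∈ S.ge k, (A (exp Z)).log - T Z ∈ S.ge (k + 1) := by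
    intro k hk Z hZ
    obtain ⟨h1, h2, -⟩ := proj_differential hf p hA hk hZ
    refine S.mem_ge.2 fun m hm => ?_
    rw [map_sub, hTproj]
    rcases (Nat.lt_succ_iff.1 hm).eq_or_lt with rfl | hm
    · rw [h2, sub_self]
    · rw [h1 m hm, S.mem_ge.1 hZ m hm, map_zero, map_zero, sub_zero]
  refine ⟨{ T with map_lie' := map_lie_of_leading A T hT hAT _ _ }, hT, fun X hX => ?_,
    fun k X hX m hm => ?_⟩
  · exact (hTX 1 X hX).trans (S.proj_same (hc p X hX))
  · rcases Nat.eq_zero_or_pos k with rfl | hk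
    · have : X = 0 := by simpa [S.layer_zero] using hX
      simp [this]
    obtain ⟨-, -, h3⟩ := proj_differential hf p hA hk (S.layer_le_ge le_rfl hX)
    rw [S.proj_same hX] at h3
    split_ifs with h
    · rw [h]; exact (hTX k X hX).symm
    · exact h3 m (by omega)

end StratifiedGroup

/-! ### Quasiconformal maps -/

/-- The ball-box estimates want a pure power: the constant is absorbed in the radius, since `K ≤ (K
+ 1) ^ j` for `j ≥ 1` and the layer `0` is trivial. -/
theorem Stratification.norm_proj_le_pow {g : Type*} [LieRing g] [LieAlgebra ℝ g]
    [FiniteDimensional ℝ g] (S : Stratification g) {K r : ℝ} (hK : 0 < K) (hr : 0 < r) {X : g}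
    (h : ∀ j, ‖S.proj j X‖ ≤ K * r ^ j) (j : ℕ) : ‖S.proj j X‖ ≤ ((K + 1) * r) ^ j := by
  rcases Nat.eq_zero_or_pos j with rfl | hj
  · rw [S.proj_zero_layer, norm_zero]; positivity
  · refine (h j).trans ?_
    rw [mul_pow]
    gcongr
    calc K ≤ K + 1 := by linarith
      _ ≤ (K + 1) ^ j := le_self_pow₀ (by linarith) hj.ne'

namespace CarnotStructure

variable {g : Type*} [LieRing g] [LieAlgebra ℝ g] [FiniteDimensional ℝ g] (C : CarnotStructure g)

open Set StratifiedGroup MeasureTheory Filter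

/-- The size of the layers is symmetric under inversion, so the ball-box estimates hold in both
orders of the points; this replaces the symmetry of the distance. -/
theorem exists_dist_le_symm : ∃ K : ℝ, 0 < K ∧ ∀ (p q : C.Group) (r : ℝ), 0 < r →
    (∀ j, ‖C.proj j (p⁻¹ * q).log‖ ≤ r ^ j) → C.dist q p ≤ K * r := by
  obtain ⟨K, hK, h⟩ := C.exists_dist_le
  refine ⟨K, hK, fun p q r hr hj => h q p r hr fun j => ?_⟩
  rw [norm_proj_symm]; exact hj j

theorem exists_norm_proj_le_dist_symm : ∃ K : ℝ, 0 < K ∧ ∀ (p q : C.Group) (j : ℕ),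
    ‖C.proj j (p⁻¹ * q).log‖ ≤ K * C.dist q p ^ j := by
  obtain ⟨K, hK, h⟩ := C.exists_norm_proj_le_dist
  refine ⟨K, hK, fun p q j => ?_⟩
  rw [← norm_proj_symm]; exact h q p j

theorem dist_self (p : C.Group) : C.dist p p = 0 := by
  obtain ⟨K, hK, h⟩ := C.exists_dist_le
  refine le_antisymm (le_of_forall_pos_le_add fun ε hε => ?_) (C.dist_nonneg p p)
  have := h p p (ε / K) (by positivity) fun j => by
    rw [inv_mul_cancel, log_one, map_zero, norm_zero]; positivity
  rwa [mul_div_cancel₀ _ hK.ne', ← zero_add ε] at this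

theorem exists_dist_le_of_velocity : ∃ M : ℝ, 0 < M ∧ ∀ (c : ℝ → C.Group) (u : ℝ → g) (r : ℝ),
    0 < r → (∀ t ∈ Icc (0 : ℝ) 1, HasVelocity c (u t) (Icc 0 1) t) →
    (∀ t ∈ Icc (0 : ℝ) 1, u t ∈ C.layer 1) → ContinuousOn u (Icc 0 1) →
    (∀ t ∈ Icc (0 : ℝ) 1, ‖u t‖ ≤ r) → C.dist (c 0) (c 1) ≤ M * r ∧ C.dist (c 1) (c 0) ≤ M * r := by
  obtain ⟨K, hK, h⟩ := StratifiedGroup.exists_norm_proj_log_le C.toStratification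
  obtain ⟨K₁, hK₁, h₁⟩ := C.exists_dist_le
  obtain ⟨K₂, hK₂, h₂⟩ := C.exists_dist_le_symm
  refine ⟨K₁ * (K + 1) + K₂ * (K + 1), by positivity, fun c u r hr hc hu hcont hb => ?_⟩
  have hint : ∫ t in (0 : ℝ)..1, ‖u t‖ ≤ r := by
    have := intervalIntegral.norm_integral_le_of_norm_le_const (a := (0 : ℝ)) (b := 1)
      (C := r) (f := fun t => ‖u t‖) (fun t ht => by
        rw [norm_norm]
        rw [uIoc_of_le zero_le_one] at ht
        exact hb t (Ioc_subset_Icc_self ht))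
    rw [sub_zero, abs_one, mul_one] at this
    exact (le_abs_self _).trans this
  have h3 := h (fun t => (c 0)⁻¹ * c t) u r hr (fun t ht => (hc t ht).const_mul _) hu hcont
    (inv_mul_cancel _) hint
  have h4 := C.norm_proj_le_pow hK hr h3
  refine ⟨(h₁ _ _ _ (by positivity) h4).trans ?_, (h₂ _ _ _ (by positivity) h4).trans ?_⟩ <;>
  · rw [← mul_assoc]
    gcongr
    have : 0 < K₁ * (K + 1) := by positivity
    have : 0 < K₂ * (K + 1) := by positivity
    linarith

variable {C} {f : C.Group → C.Group}

/-- Quasiconformality as an inequality between distances. -/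
theorem IsQuasiconformal.exists_bound (h : C.IsQuasiconformal f) : ∃ H : ℝ, 0 < H ∧
    ∀ p, ∀ᶠ s in 𝓝[>] (0 : ℝ), ∀ x y, C.dist x p ≤ s → s ≤ C.dist y p →
      C.dist (f x) (f p) ≤ H * C.dist (f y) (f p) ∧ 0 < C.dist (f y) (f p) := by
  obtain ⟨K, hK, h⟩ := h
  refine ⟨K + 1, by positivity, fun p => ?_⟩
  have h1 : limsup (fun s => C.distortion f p s) (𝓝[>] (0 : ℝ)) < ENNReal.ofReal (K + 1) :=
    (h p).trans_lt ((ENNReal.ofReal_lt_ofReal_iff (by linarith)).2 (by linarith))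
  filter_upwards [eventually_lt_of_limsup_lt h1] with s hs x y hx hy
  rw [distortion] at hs
  split_ifs at hs with h0
  · exact absurd hs not_top_lt
  have h2 : (⨅ x, ⨅ _ : s ≤ C.dist x p, ENNReal.ofReal (C.dist (f x) (f p))) ≤
      ENNReal.ofReal (C.dist (f y) (f p)) := iInf₂_le y hy
  have h3 : ENNReal.ofReal (C.dist (f x) (f p)) ≤
      ⨆ x, ⨆ _ : C.dist x p ≤ s, ENNReal.ofReal (C.dist (f x) (f p)) :=
    le_iSup₂ (f := fun x (_ : C.dist x p ≤ s) => ENNReal.ofReal (C.dist (f x) (f p))) x hx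
  have h4 := (ENNReal.div_le_iff_le_mul (Or.inl h0) (Or.inr (by positivity))).1 hs.le
  have hpos : 0 < C.dist (f y) (f p) :=
    ENNReal.ofReal_pos.1 ((pos_iff_ne_zero.2 h0).trans_le h2)
  refine ⟨?_, hpos⟩
  have h5 : ENNReal.ofReal (C.dist (f x) (f p)) ≤
      ENNReal.ofReal (K + 1) * ENNReal.ofReal (C.dist (f y) (f p)) :=
    h3.trans (h4.trans (by gcongr))
  rw [← ENNReal.ofReal_mul (by positivity)] at h5
  exact (ENNReal.ofReal_le_ofReal_iff (by positivity)).1 h5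

/-- If `f x = f p`, the denominator of the distortion at `p` vanishes for all `s` up to the distance
of `x` from `p`. -/
theorem IsQuasiconformal.injective (h : C.IsQuasiconformal f) : Function.Injective f := by
  obtain ⟨H, hH, hq⟩ := h.exists_bound
  intro x p hxp
  by_contra hne
  have hd : 0 < C.dist x p := (C.dist_nonneg x p).lt_of_ne fun h => hne (C.eq_of_dist_eq_zero h.symm)
  obtain ⟨s, hs, hsd⟩ := ((hq p).and (Ioo_mem_nhdsGT hd)).exists
  have := (hs p x (by rw [C.dist_self]; exact hsd.1.le) hsd.2.le).2
  rw [hxp, C.dist_self] at this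
  exact lt_irrefl _ this

/-- The test point `p exp (κ s^ℓ Z)`, with `Z` in the last layer and `ℓ` the step, is at distance at
least `a s` from `p`. But it is only `O(s^ℓ)` away in coordinates, and so is its image from `f p`;
by the ball-box estimate the image is at distance `O(s)`. Quasiconformality transfers this bound to
`f (p exp (s X))`, whose component in the layer `k` relative to `f p` is then `O(s^k)`. For `k ≥ 2`
this is `o(s)`. -/
theorem IsQuasiconformal.isContact (hf : IsC1 f) (h : C.IsQuasiconformal f) : IsContact f := by
  obtain ⟨H, hH, hq⟩ := h.exists_bound
  obtain ⟨Ku, hKu, hup⟩ := C.exists_dist_le_symm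
  obtain ⟨Kl, hKl, hlow⟩ := C.exists_norm_proj_le_dist_symm
  obtain ⟨Kp, hKp, hproj⟩ := C.exists_norm_proj_le_all
  obtain ⟨Z, hZ, hZ0⟩ := (Submodule.ne_bot_iff _).1 C.layer_step
  have hZn : 0 < ‖Z‖ := norm_pos_iff.2 hZ0
  intro p X hX
  set a : ℝ := Ku * (‖X‖ + 1) with ha
  have ha0 : 0 < a := by positivity
  -- Chosen so that the lower ball-box estimate puts the test point at distance at least `a s`.
  set κ : ℝ := Kl * a ^ C.step / ‖Z‖ with hκ
  have hκ0 : 0 < κ := by positivity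
  obtain ⟨B, hB0, hB⟩ := (hf.hasFDerivAt p).isBigO_sub.exists_pos
  rw [Asymptotics.IsBigOWith] at hB
  simp only [exp_zero, mul_one, inv_mul_cancel, log_one, sub_zero] at hB
  have hcurve : Tendsto (fun s : ℝ => (κ * s ^ C.step) • Z) (𝓝[>] 0) (𝓝 0) := by
    have h1 : Continuous fun s : ℝ => (κ * s ^ C.step) • Z := by fun_prop
    have h2 := (h1.tendsto 0).mono_left (nhdsWithin_le_nhds (s := Ioi 0))
    rwa [zero_pow (by have := C.one_le_step; omega), mul_zero, zero_smul] at h2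
  have hscale : Tendsto (fun s : ℝ => a * s) (𝓝[>] 0) (𝓝[>] 0) := by
    refine tendsto_nhdsWithin_iff.2 ⟨?_, ?_⟩
    · have h1 : Continuous fun s : ℝ => a * s := by fun_prop
      have h2 := (h1.tendsto 0).mono_left (nhdsWithin_le_nhds (s := Ioi 0))
      rwa [mul_zero] at h2
    · filter_upwards [self_mem_nhdsWithin] with s hs
      exact mul_pos ha0 hs
  set E : ℝ := Kp * (B * (κ * ‖Z‖)) with hE
  have hE0 : 0 < E := by positivity
  have key : ∀ᶠ s in 𝓝[>] (0 : ℝ), ∀ k,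
      ‖C.proj k ((f p)⁻¹ * f (p * exp (s • X))).log‖ ≤
        Kl * (H * (Ku * ((E + 1) * s))) ^ k := by
    filter_upwards [hcurve.eventually hB, hscale.eventually (hq p),
      Ioo_mem_nhdsGT (zero_lt_one (α := ℝ))] with s hs1 hs2 hs3 k
    obtain ⟨hs0, hs3⟩ := hs3
    have hx : C.dist (p * exp (s • X)) p ≤ a * s := by
      rw [ha, mul_assoc]
      refine hup _ _ _ (by positivity) fun j => ?_
      rw [inv_mul_cancel_left]
      change ‖C.proj j (s • X)‖ ≤ _
      rw [C.proj_of_mem (Submodule.smul_mem _ _ hX)]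
      split_ifs with hj
      · rw [hj, pow_one, norm_smul, Real.norm_eq_abs, abs_of_pos hs0, mul_comm]
        gcongr
        linarith
      · rw [norm_zero]; positivity
    have hy : a * s ≤ C.dist (p * exp ((κ * s ^ C.step) • Z)) p := by
      have h1 := hlow p (p * exp ((κ * s ^ C.step) • Z)) C.step
      rw [inv_mul_cancel_left] at h1
      change ‖C.proj C.step ((κ * s ^ C.step) • Z)‖ ≤ _ at h1
      rw [C.proj_same (Submodule.smul_mem _ _ hZ), norm_smul, Real.norm_eq_abs,
        abs_of_pos (by positivity), hκ] at h1
      have h2 : Kl * a ^ C.step / ‖Z‖ * s ^ C.step * ‖Z‖ = Kl * (a * s) ^ C.step := by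
        rw [mul_pow a s, div_mul_eq_mul_div, div_mul_cancel₀ _ hZn.ne']
        ring
      rw [h2] at h1
      have h3 := le_of_mul_le_mul_left h1 hKl
      exact (pow_le_pow_iff_left₀ (by positivity) (C.dist_nonneg _ _)
        (by have := C.one_le_step; omega)).1 h3
    have hfy : C.dist (f (p * exp ((κ * s ^ C.step) • Z))) (f p) ≤ Ku * ((E + 1) * s) := by
      refine hup _ _ _ (by positivity) (C.norm_proj_le_pow hE0 hs0 fun j => ?_)
      rcases lt_or_ge C.step j with hj | hj
      · rw [C.proj_of_lt hj, norm_zero]; positivity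
      · refine (hproj j _).trans ?_
        rw [norm_smul, Real.norm_eq_abs, abs_of_pos (by positivity)] at hs1
        calc _ ≤ Kp * (B * (κ * s ^ C.step * ‖Z‖)) := by gcongr
          _ = E * s ^ C.step := by rw [hE]; ring
          _ ≤ E * s ^ j := by
            gcongr ?_ * ?_
            exact pow_le_pow_of_le_one hs0.le hs3.le hj
    have hfx := (hs2 _ _ hx hy).1
    refine (hlow _ _ k).trans ?_
    have := C.dist_nonneg (f (p * exp (s • X))) (f p)
    gcongr
    exact hfx.trans (by gcongr)
  have hlim := tendsto_smul_log hf p le_rfl (C.layer_le_ge le_rfl hX)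
  simp only [pow_one, C.dil_of_mem _ hX, C.proj_same hX] at hlim
  have hzero : ∀ k, 2 ≤ k → C.proj k (differential f p X) = 0 := by
    intro k hk
    have h1 := ((C.continuous_proj k).tendsto _).comp hlim
    have h2 : Tendsto (fun s : ℝ => Kl * (H * (Ku * (E + 1))) ^ k * s ^ (k - 1)) (𝓝[>] 0)
        (𝓝 0) := by
      have h3 : Continuous fun s : ℝ => Kl * (H * (Ku * (E + 1))) ^ k * s ^ (k - 1) := by fun_prop
      have h4 := (h3.tendsto 0).mono_left (nhdsWithin_le_nhds (s := Ioi 0))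
      rwa [zero_pow (by omega), mul_zero] at h4
    refine tendsto_nhds_unique h1 (squeeze_zero_norm' ?_ h2)
    filter_upwards [key, self_mem_nhdsWithin] with s hs hs0
    have hs0 : (0 : ℝ) < s := hs0
    rw [Function.comp_apply, map_smul, norm_smul, norm_inv, Real.norm_eq_abs, abs_of_pos hs0,
      inv_mul_le_iff₀ hs0]
    refine (hs k).trans (le_of_eq ?_)
    obtain ⟨n, rfl⟩ : ∃ n, k = n + 1 := ⟨k - 1, by omega⟩
    rw [Nat.add_sub_cancel, show H * (Ku * ((E + 1) * s)) = H * (Ku * (E + 1)) * s by ring, mul_pow,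
      pow_succ s]
    ring
  have : differential f p X = C.proj 1 (differential f p X) := C.eq_of_proj fun k => by
    rw [C.proj_proj]
    split_ifs with hk
    · rw [hk]
    · rcases Nat.eq_zero_or_pos k with rfl | hk0
      · exact C.proj_zero_layer _
      · exact hzero k (by omega)
  rw [this]
  exact C.proj_mem _ _

/-- The differential of a quasiconformal map is conformal on the first layer, up to a constant. -/
theorem IsQuasiconformal.exists_conformal (hf : IsC1 f) (h : C.IsQuasiconformal f) :
    ∃ K : ℝ, 0 < K ∧ ∀ p, ∀ X ∈ C.layer 1, ∀ Y ∈ C.layer 1,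
      ‖differential f p X‖ * ‖Y‖ ≤ K * (‖differential f p Y‖ * ‖X‖) := by
  have hc := h.isContact hf
  obtain ⟨H, hH, hq⟩ := h.exists_bound
  obtain ⟨Ku, hKu, hup⟩ := C.exists_dist_le_symm
  obtain ⟨Kl, hKl, hlow⟩ := C.exists_norm_proj_le_dist_symm
  obtain ⟨M, hM, hvel⟩ := C.exists_dist_le_of_velocity
  refine ⟨Kl * H * M * Kl * Ku, by positivity, fun p X hX Y hY => ?_⟩
  rcases eq_or_ne X 0 with rfl | hX0
  · simp
  rcases eq_or_ne Y 0 with rfl | hY0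
  · simp
  have hXn : 0 < ‖X‖ := norm_pos_iff.2 hX0
  have hYn : 0 < ‖Y‖ := norm_pos_iff.2 hY0
  -- The margin `ε` makes `R` a bound for the differential on `Y` at all points near `p`, and keeps
  -- it positive even where the differential kills `Y`.
  suffices hε : ∀ ε : ℝ, 0 < ε → ‖differential f p X‖ * ‖Y‖ ≤
      Kl * H * M * Kl * Ku * ((‖differential f p Y‖ + ε) * ‖X‖) by
    have hlim : Tendsto (fun ε : ℝ => Kl * H * M * Kl * Ku * ((‖differential f p Y‖ + ε) * ‖X‖))
        (𝓝[>] 0) (𝓝 (Kl * H * M * Kl * Ku * ((‖differential f p Y‖ + 0) * ‖X‖))) := by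
      have h1 : Continuous fun ε : ℝ =>
        Kl * H * M * Kl * Ku * ((‖differential f p Y‖ + ε) * ‖X‖) := by fun_prop
      exact (h1.tendsto 0).mono_left nhdsWithin_le_nhds
    rw [add_zero] at hlim
    exact ge_of_tendsto hlim (eventually_of_mem self_mem_nhdsWithin hε)
  intro ε hε
  set R : ℝ := ‖differential f p Y‖ + ε with hR
  have hR0 : 0 < R := by positivity
  -- With this factor `p exp (b s Y)` is at least as far from `p` as the upper bound `Ku ‖X‖ s` for
  -- `p exp (s X)`, so the distortion compares their images.
  set b : ℝ := Kl * Ku * ‖X‖ / ‖Y‖ with hb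
  have hb0 : 0 < b := by positivity
  have hscale : Tendsto (fun s : ℝ => Ku * ‖X‖ * s) (𝓝[>] 0) (𝓝[>] 0) := by
    refine tendsto_nhdsWithin_iff.2 ⟨?_, ?_⟩
    · have h1 : Continuous fun s : ℝ => Ku * ‖X‖ * s := by fun_prop
      have h2 := (h1.tendsto 0).mono_left (nhdsWithin_le_nhds (s := Ioi 0))
      rwa [mul_zero] at h2
    · filter_upwards [self_mem_nhdsWithin] with s hs
      exact mul_pos (by positivity : (0 : ℝ) < Ku * ‖X‖) hs
  have hDcont : ∀ t : ℝ, Continuous fun x : ℝ × ℝ =>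
      ‖differential f (p * exp ((x.2 * (b * x.1)) • Y)) Y‖ := fun _ => by
    have h3 : Continuous fun x : ℝ × ℝ => bch C.step p.log ((x.2 * (b * x.1)) • Y) :=
      continuous_const.bch C.step (by fun_prop)
    have h4 := hf.continuous_differential.comp h3
    have h5 := (h4.clm_apply (continuous_const (y := Y))).norm
    exact h5
  have hunif : ∀ᶠ s in 𝓝[>] (0 : ℝ), ∀ t ∈ Icc (0 : ℝ) 1,
      ‖differential f (p * exp ((t * (b * s)) • Y)) Y‖ ≤ R := by
    refine Eventually.filter_mono nhdsWithin_le_nhds ?_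
    refine isCompact_Icc.eventually_forall_of_forall_eventually fun t _ => ?_
    have h0 : ‖differential f (p * exp ((t * (b * 0)) • Y)) Y‖ < R := by
      rw [mul_zero, mul_zero, zero_smul, exp_zero, mul_one, hR]
      linarith
    filter_upwards [(hDcont t).continuousAt.eventually_lt
      (continuousAt_const (x := ((0 : ℝ), t)) (y := R)) h0] with x hx
    exact hx.le
  have key : ∀ᶠ s in 𝓝[>] (0 : ℝ),
      ‖C.proj 1 ((f p)⁻¹ * f (p * exp (s • X))).log‖ ≤ Kl * (H * (M * (b * s * R))) := by
    filter_upwards [hunif, hscale.eventually (hq p), self_mem_nhdsWithin] with s hs1 hs2 hs0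
    have hs0 : (0 : ℝ) < s := hs0
    have hx : C.dist (p * exp (s • X)) p ≤ Ku * ‖X‖ * s := by
      rw [mul_assoc]
      refine hup _ _ _ (by positivity) fun j => ?_
      rw [inv_mul_cancel_left]
      change ‖C.proj j (s • X)‖ ≤ _
      rw [C.proj_of_mem (Submodule.smul_mem _ _ hX)]
      split_ifs with hj
      · rw [hj, pow_one, norm_smul, Real.norm_eq_abs, abs_of_pos hs0, mul_comm]
      · rw [norm_zero]; positivity
    have hy : Ku * ‖X‖ * s ≤ C.dist (p * exp ((b * s) • Y)) p := by
      have h1 := hlow p (p * exp ((b * s) • Y)) 1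
      rw [inv_mul_cancel_left] at h1
      change ‖C.proj 1 ((b * s) • Y)‖ ≤ _ at h1
      rw [C.proj_same (Submodule.smul_mem _ _ hY), norm_smul, Real.norm_eq_abs,
        abs_of_pos (by positivity), pow_one, hb] at h1
      have h2 : Kl * Ku * ‖X‖ / ‖Y‖ * s * ‖Y‖ = Kl * (Ku * ‖X‖ * s) := by
        field_simp
      rw [h2] at h1
      exact le_of_mul_le_mul_left h1 hKl
    have hfy : C.dist (f (p * exp ((b * s) • Y))) (f p) ≤ M * (b * s * R) := by
      have h1 := (hvel (fun t => f (p * exp ((t * (b * s)) • Y)))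
        (fun t => (b * s) • differential f (p * exp ((t * (b * s)) • Y)) Y) (b * s * R)
        (by positivity) (fun t _ => ?_) (fun t _ => Submodule.smul_mem _ _ (hc _ _ hY)) ?_
        fun t ht => ?_).2
      · simpa [exp_zero] using h1
      · have h1 : HasDerivAt (fun t : ℝ => t * (b * s)) (b * s) t := by
          simpa using (hasDerivAt_id t).mul_const (b * s)
        have h2 := (((hasVelocity_exp_smul (S := C.toStratification) Y univ (t * (b * s))).scomp
          (φ := fun t => t * (b * s)) h1.hasDerivWithinAt
          (mapsTo_univ (s := Icc (0 : ℝ) 1) _)).const_mul p).comp hf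
        rw [map_smul] at h2
        exact h2
      · have h3 : Continuous fun t : ℝ => bch C.step p.log ((t * (b * s)) • Y) :=
          continuous_const.bch C.step (by fun_prop)
        have h4 := hf.continuous_differential.comp h3
        have h5 := ((h4.clm_apply (continuous_const (y := Y))).const_smul (b * s)).continuousOn
          (s := Icc 0 1)
        exact h5
      · rw [norm_smul, Real.norm_eq_abs, abs_of_pos (by positivity)]
        gcongr
        exact hs1 t ht
    have hfx := (hs2 _ _ hx hy).1
    refine (hlow _ _ 1).trans ?_
    rw [pow_one]
    gcongr
    exact hfx.trans (by gcongr)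
  have hlim := tendsto_smul_log hf p le_rfl (C.layer_le_ge le_rfl hX)
  simp only [pow_one, C.dil_of_mem _ hX, C.proj_same hX] at hlim
  have h1 := (((C.continuous_proj 1).tendsto _).comp hlim).norm
  rw [C.proj_same (hc p X hX)] at h1
  have h2 : ‖differential f p X‖ ≤ Kl * (H * (M * (b * R))) := by
    refine le_of_tendsto h1 ?_
    filter_upwards [key, self_mem_nhdsWithin] with s hs hs0
    have hs0 : (0 : ℝ) < s := hs0
    rw [Function.comp_apply, map_smul, norm_smul, norm_inv, Real.norm_eq_abs, abs_of_pos hs0,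
      inv_mul_le_iff₀ hs0]
    refine hs.trans (le_of_eq ?_)
    ring
  calc ‖differential f p X‖ * ‖Y‖ ≤ Kl * (H * (M * (b * R))) * ‖Y‖ := by gcongr
    _ = Kl * H * M * Kl * Ku * (R * ‖X‖) := by rw [hb]; field_simp

end CarnotStructure

/-! ### Decompositions into homogeneous ideals -/

namespace Stratification

variable {g : Type*} [LieRing g] [LieAlgebra ℝ g] (S : Stratification g)

/-- A homomorphism of Lie algebras which vanishes on the first layer is zero. -/
theorem lieHom_eq_zero {T : g →ₗ⁅ℝ⁆ g} (h : ∀ X ∈ S.layer 1, T X = 0) (X : g) : T X = 0 := by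
  have key : ∀ k, 1 ≤ k → ∀ X ∈ S.layer k, T X = 0 := by
    intro k hk
    induction k, hk using Nat.le_induction with
    | base => exact h
    | succ k hk ih =>
      intro X hX
      rw [S.layer_succ k hk] at hX
      induction hX using Submodule.span_induction with
      | mem z hz =>
        obtain ⟨x, hx, y, hy, rfl⟩ := hz
        rw [LieHom.map_lie, h y hy, lie_zero]
      | zero => exact map_zero T
      | add a b _ _ ha hb => rw [map_add, ha, hb, add_zero]
      | smul c a _ ha => rw [map_smul, ha, smul_zero]
  induction X using S.layer_induction with
  | add a b ha hb => rw [map_add, ha, hb, add_zero]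
  | mem k X hX =>
    rcases Nat.eq_zero_or_pos k with rfl | hk
    · have : X = 0 := by simpa [S.layer_zero] using hX
      rw [this, map_zero]
    · exact key k hk X hX

/-- A homomorphism of Lie algebras whose range contains the first layer is surjective. -/
theorem lieHom_surjective {T : g →ₗ⁅ℝ⁆ g} (h : ∀ X ∈ S.layer 1, ∃ Y, T Y = X) :
    Function.Surjective T := by
  have key : ∀ k, 1 ≤ k → ∀ X ∈ S.layer k, ∃ Y, T Y = X := by
    intro k hk
    induction k, hk using Nat.le_induction with
    | base => exact h
    | succ k hk ih =>
      intro X hX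
      rw [S.layer_succ k hk] at hX
      induction hX using Submodule.span_induction with
      | mem z hz =>
        obtain ⟨x, hx, y, hy, rfl⟩ := hz
        obtain ⟨x', rfl⟩ := ih x hx
        obtain ⟨y', rfl⟩ := h y hy
        exact ⟨⁅x', y'⁆, LieHom.map_lie _ _ _⟩
      | zero => exact ⟨0, map_zero T⟩
      | add a b _ _ ha hb =>
        obtain ⟨a', rfl⟩ := ha
        obtain ⟨b', rfl⟩ := hb
        exact ⟨a' + b', map_add _ _ _⟩
      | smul c a _ ha =>
        obtain ⟨a', rfl⟩ := ha
        exact ⟨c • a', map_smul _ _ _⟩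
  intro X
  induction X using S.layer_induction with
  | add a b ha hb =>
    obtain ⟨a', rfl⟩ := ha
    obtain ⟨b', rfl⟩ := hb
    exact ⟨a' + b', map_add _ _ _⟩
  | mem k X hX =>
    rcases Nat.eq_zero_or_pos k with rfl | hk
    · have : X = 0 := by simpa [S.layer_zero] using hX
      exact ⟨0, by rw [this, map_zero]⟩
    · exact key k hk X hX

theorem isHomogeneous_iff {J : LieIdeal ℝ g} :
    S.IsHomogeneous J ↔ ∀ X ∈ J, ∀ i, S.proj i X ∈ J := by
  constructor
  · intro h X hX i
    have hX' : X ∈ ⨆ j, J.toSubmodule ⊓ S.layer j := by rw [← h]; exact hX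
    refine Submodule.iSup_induction _ (motive := fun X => S.proj i X ∈ J) hX' (fun j x hx => ?_)
      (by rw [map_zero]; exact zero_mem J) fun x y hx hy => by rw [map_add]; exact add_mem hx hy
    rw [S.proj_of_mem hx.2]
    split_ifs
    · exact hx.1
    · exact zero_mem J
  · intro h
    refine le_antisymm (fun X hX => ?_) (iSup_le fun j => inf_le_left)
    rw [← S.sum_proj X]
    exact Submodule.sum_mem _ fun j _ =>
      Submodule.mem_iSup_of_mem j ⟨h X hX j, S.proj_mem j X⟩

namespace IsDecomposition

variable {S} {m : ℕ} {I : Fin m → LieIdeal ℝ g}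

theorem bijective_coeLinearMap (hI : S.IsDecomposition I) :
    Function.Bijective (DirectSum.coeLinearMap fun j => (I j).toSubmodule) :=
  hI.isInternal

variable (hI : S.IsDecomposition I)

/-- The projection onto a summand, as a linear map. -/
noncomputable def componentₗ (j : Fin m) : g →ₗ[ℝ] g :=
  (I j).toSubmodule.subtype ∘ₗ DirectSum.component ℝ (Fin m) (fun i => (I i).toSubmodule) j ∘ₗ
    (LinearEquiv.ofBijective (DirectSum.coeLinearMap fun j => (I j).toSubmodule)
      hI.bijective_coeLinearMap).symm.toLinearMap

theorem componentₗ_mem (j : Fin m) (X : g) : hI.componentₗ j X ∈ I j := Submodule.coe_mem _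

theorem componentₗ_of_mem {j : Fin m} {X : g} (h : X ∈ I j) (i : Fin m) :
    hI.componentₗ i X = if i = j then X else 0 := by
  have : (LinearEquiv.ofBijective (DirectSum.coeLinearMap fun j => (I j).toSubmodule)
      hI.bijective_coeLinearMap).symm X =
      DirectSum.lof ℝ (Fin m) (fun i => (I i).toSubmodule) j ⟨X, h⟩ := by
    rw [LinearEquiv.symm_apply_eq, LinearEquiv.ofBijective_apply, DirectSum.coeLinearMap_lof]
  simp only [componentₗ, LinearMap.comp_apply, LinearEquiv.coe_coe, this]
  split_ifs with hij
  · subst hij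
    rw [DirectSum.component.lof_self]; rfl
  · rw [DirectSum.component.of, dif_neg (Ne.symm hij)]; rfl

@[elab_as_elim]
theorem induction (hI : S.IsDecomposition I) {p : g → Prop} (X : g)
    (mem : ∀ j, ∀ x ∈ I j, p x) (zero : p 0) (add : ∀ x y, p x → p y → p (x + y)) : p X :=
  Submodule.iSup_induction (fun j => (I j).toSubmodule) (motive := p)
    (by rw [hI.isInternal.submodule_iSup_eq_top]; trivial) mem zero add

theorem lie_eq_zero (hI : S.IsDecomposition I) {i j : Fin m} (hij : i ≠ j) {X Y : g}
    (hX : X ∈ I i) (hY : Y ∈ I j) : ⁅X, Y⁆ = 0 := by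
  have h1 : ⁅X, Y⁆ ∈ I j := lie_mem_right ℝ g (I j) X Y hY
  have h2 : ⁅X, Y⁆ ∈ I i := lie_mem_left ℝ g (I i) X Y hX
  have h3 := hI.componentₗ_of_mem h1 i
  rw [if_neg hij, hI.componentₗ_of_mem h2 i, if_pos rfl] at h3
  exact h3

/-- The projection onto a summand. -/
noncomputable def component (j : Fin m) : g →ₗ⁅ℝ⁆ g :=
  { hI.componentₗ j with
    map_lie' := by
      intro X Y
      change hI.componentₗ j ⁅X, Y⁆ = ⁅hI.componentₗ j X, hI.componentₗ j Y⁆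
      induction X using hI.induction with
      | zero => simp
      | add a b ha hb => simp only [add_lie, map_add, ha, hb]
      | mem a X hX =>
      induction Y using hI.induction with
      | zero => simp
      | add a b ha hb => simp only [lie_add, map_add, ha, hb]
      | mem b Y hY =>
      have h1 : ⁅X, Y⁆ ∈ I b := lie_mem_right ℝ g (I b) X Y hY
      have h2 : ⁅X, Y⁆ ∈ I a := lie_mem_left ℝ g (I a) X Y hX
      by_cases hab : a = b
      · subst hab
        rw [hI.componentₗ_of_mem h1, hI.componentₗ_of_mem hX, hI.componentₗ_of_mem hY]
        split_ifs <;> simp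
      · rw [hI.lie_eq_zero hab hX hY, map_zero, hI.componentₗ_of_mem hX, hI.componentₗ_of_mem hY]
        split_ifs with h3 h4
        · exact absurd (h3.symm.trans h4) hab
        all_goals simp }

theorem component_mem (j : Fin m) (X : g) : hI.component j X ∈ I j := hI.componentₗ_mem j X

theorem component_of_mem {j : Fin m} {X : g} (h : X ∈ I j) (i : Fin m) :
    hI.component i X = if i = j then X else 0 := hI.componentₗ_of_mem h i

theorem component_same {j : Fin m} {X : g} (h : X ∈ I j) : hI.component j X = X := by
  rw [component_of_mem hI h, if_pos rfl]

theorem component_ne {i j : Fin m} (hij : i ≠ j) {X : g} (h : X ∈ I j) :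
    hI.component i X = 0 := by
  rw [component_of_mem hI h, if_neg hij]

theorem sum_component (X : g) : ∑ j, hI.component j X = X := by
  induction X using hI.induction with
  | zero => simp
  | add a b ha hb => simp only [map_add, Finset.sum_add_distrib, ha, hb]
  | mem j X hX => simp [hI.component_of_mem hX]

theorem ext_component {X Y : g} (h : ∀ j, hI.component j X = hI.component j Y) : X = Y := by
  rw [← hI.sum_component X, ← hI.sum_component Y]; simp only [h]

theorem component_mem_layer (j : Fin m) {i : ℕ} {X : g} (hX : X ∈ S.layer i) :
    hI.component j X ∈ S.layer i := by
  have h1 : ∀ k, S.proj i (hI.component k X) ∈ I k := fun k =>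
    S.isHomogeneous_iff.1 (hI.homogeneous k) _ (hI.component_mem k X) i
  have h2 : X = ∑ k, S.proj i (hI.component k X) := by
    rw [← map_sum, hI.sum_component, S.proj_same hX]
  have h3 : hI.component j X = S.proj i (hI.component j X) := by
    conv_lhs => rw [h2]
    rw [map_sum, Finset.sum_eq_single j (fun k _ hk => hI.component_ne hk.symm (h1 k)) (by simp),
      hI.component_same (h1 j)]
  rw [h3]
  exact S.proj_mem _ _

/-- The projection onto the sum of the summands other than `I j`. -/
noncomputable def cocomponent (j : Fin m) : g →ₗ⁅ℝ⁆ g :=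
  { LinearMap.id - hI.componentₗ j with
    map_lie' := by
      intro X Y
      change ⁅X, Y⁆ - hI.component j ⁅X, Y⁆ =
        ⁅X - hI.component j X, Y - hI.component j Y⁆
      have h : ∀ U ∈ I j, ∀ V, ⁅U, V - hI.component j V⁆ = 0 := fun U hU V => by
        induction V using hI.induction with
        | zero => simp
        | add a b ha hb =>
          rw [map_add, add_sub_add_comm, lie_add, ha, hb, add_zero]
        | mem k V hV =>
          rw [hI.component_of_mem hV]
          split_ifs with hk
          · simp
          · rw [sub_zero]; exact hI.lie_eq_zero hk hU hV
      rw [sub_lie, h _ (hI.component_mem j X), sub_zero, lie_sub, LieHom.map_lie]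
      congr 1
      have h2 := h _ (hI.component_mem j Y) X
      rw [lie_sub, sub_eq_zero] at h2
      rw [← lie_skew, ← h2, lie_skew] }

theorem cocomponent_apply (j : Fin m) (X : g) : hI.cocomponent j X = X - hI.component j X := rfl

theorem component_cocomponent (j : Fin m) (X : g) : hI.component j (hI.cocomponent j X) = 0 := by
  rw [cocomponent_apply, map_sub, hI.component_same (hI.component_mem j X), sub_self]

theorem lie_cocomponent {j : Fin m} {X : g} (hX : X ∈ I j) (Y : g) :
    ⁅X, hI.cocomponent j Y⁆ = 0 := by
  have h : hI.cocomponent j ⁅X, Y⁆ = 0 := by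
    rw [cocomponent_apply, hI.component_same (lie_mem_left ℝ g (I j) X Y hX), sub_self]
  have h1 : ⁅X, hI.cocomponent j Y⁆ ∈ I j := lie_mem_left ℝ g (I j) _ _ hX
  rw [← hI.component_same h1, LieHom.map_lie, component_cocomponent, lie_zero]

/-- Otherwise the projection onto the summand would vanish on the first layer, hence everywhere, by
`lieHom_eq_zero`. -/
theorem exists_mem_layer_one (hI : S.IsDecomposition I) {j : Fin m} (hj : I j ≠ ⊥) :
    ∃ X ∈ I j, X ∈ S.layer 1 ∧ X ≠ 0 := by
  by_contra! h
  refine hj ((LieSubmodule.eq_bot_iff _).2 fun X hX => ?_)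
  rw [← hI.component_same hX]
  exact S.lieHom_eq_zero (fun Y hY => h _ (hI.component_mem j Y) (hI.component_mem_layer j hY)) X

end IsDecomposition

/-- A strata-preserving automorphism permutes the summands of the finest decomposition. -/
theorem IsFinestDecomposition.exists_perm {S : Stratification g} {m : ℕ}
    {I : Fin m → LieIdeal ℝ g} (hI : S.IsFinestDecomposition I) (T : g ≃ₗ⁅ℝ⁆ g)
    (hT : ∀ j, ∀ X ∈ S.layer j, T X ∈ S.layer j) :
    ∃ σ : Equiv.Perm (Fin m), ∀ j X, T X ∈ I (σ j) ↔ X ∈ I j := by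
  have hproj : ∀ i X, S.proj i (T X) = T (S.proj i X) := fun i X => by
    induction X using S.layer_induction with
    | add a b ha hb => simp only [map_add, ha, hb]
    | mem j X hX =>
      rw [S.proj_of_mem hX, S.proj_of_mem (hT j X hX)]
      split_ifs <;> simp
  -- The images of the summands under `T` form another decomposition, so each of them is a sum of
  -- summands `I j`.
  let J : Fin m → LieIdeal ℝ g := fun l => (I l).comap (T.symm : g →ₗ⁅ℝ⁆ g)
  have hJ : ∀ l X, X ∈ J l ↔ T.symm X ∈ I l := fun l X => Iff.rfl
  have hdec : S.IsDecomposition J := by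
    refine ⟨fun l => S.isHomogeneous_iff.2 fun X hX i => ?_, ?_⟩
    · rw [hJ] at hX ⊢
      have h1 := S.isHomogeneous_iff.1 (hI.isDecomposition.homogeneous l) _ hX i
      have h2 : T.symm (S.proj i X) = S.proj i (T.symm X) := by
        have h3 := hproj i (T.symm X)
        rw [T.apply_symm_apply] at h3
        rw [h3, T.symm_apply_apply]
      rwa [h2]
    · have h := hI.isDecomposition.isInternal
      rw [DirectSum.isInternal_submodule_iff_iSupIndep_and_iSup_eq_top] at h ⊢
      let e := Submodule.orderIsoMapComap (T.toLinearEquiv)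
      have he : (fun l => (J l).toSubmodule) = fun l => e (I l).toSubmodule := by
        funext l
        ext X
        simp only [e, Submodule.orderIsoMapComap_apply]
        constructor
        · intro hX
          exact ⟨T.symm X, hX, T.apply_symm_apply X⟩
        · rintro ⟨Y, hY, rfl⟩
          have : T.symm (T Y) ∈ I l := by rw [T.symm_apply_apply]; exact hY
          exact this
      rw [he]
      refine ⟨h.1.map_orderIso e, ?_⟩
      rw [← e.map_iSup, h.2, map_top]
  obtain ⟨c, hc⟩ := hI.finest m J hdec
  -- No image is zero, so no group is empty; as both index sets have `m` elements, every group is a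
  -- single summand.
  have hsurj : Function.Surjective c := by
    intro l
    by_contra! h
    refine hI.ne_bot l ((LieSubmodule.eq_bot_iff _).2 fun X hX => ?_)
    have h1 : T X ∈ J l := by rw [hJ, T.symm_apply_apply]; exact hX
    have h2 : J l = ⊥ := by
      rw [hc l]
      simp [h]
    rw [h2, LieSubmodule.mem_bot] at h1
    exact T.injective (h1.trans (map_zero T).symm)
  let σ : Equiv.Perm (Fin m) := 
    Equiv.ofBijective c ⟨Finite.injective_iff_surjective.2 hsurj, hsurj⟩
  refine ⟨σ.symm, fun j X => ?_⟩
  have h1 : J j = I (σ.symm j) := by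
    rw [hc j]
    refine le_antisymm (iSup₂_le fun i hi => ?_) ?_
    · rw [← hi]
      exact le_of_eq (congrArg I (σ.symm_apply_apply i).symm)
    · exact le_iSup₂_of_le (σ.symm j) (σ.apply_symm_apply j) le_rfl
  rw [← h1, hJ, T.symm_apply_apply]

end Stratification

namespace StratifiedGroup

variable {g : Type*} [LieRing g] [LieAlgebra ℝ g] [FiniteDimensional ℝ g] {S : Stratification g}

open Stratification

theorem prod_exp_of_pairwise (l : List g) (h : l.Pairwise fun X Y => ⁅X, Y⁆ = 0) :
    (l.map fun X => (exp X : StratifiedGroup S)).prod = exp l.sum := by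
  induction l with
  | nil => rfl
  | cons X l ih =>
    rw [List.pairwise_cons] at h
    rw [List.map_cons, List.prod_cons, List.sum_cons, ih h.2, exp_mul_of_lie_eq_zero]
    have : ∀ l' : List g, (∀ Y ∈ l', ⁅X, Y⁆ = 0) → ⁅X, l'.sum⁆ = 0 := by
      intro l' hl'
      induction l' with
      | nil => simp
      | cons Y l' ih' =>
        rw [List.sum_cons, lie_add, hl' Y (by simp), ih' fun Z hZ => hl' Z (by simp [hZ]), add_zero]
    exact this l h.1

theorem prod_ofFn_of_mem {m : ℕ} {I : Fin m → LieIdeal ℝ g} (hI : S.IsDecomposition I)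
    (p : Fin m → StratifiedGroup S) (hp : ∀ j, (p j).log ∈ I j) :
    (List.ofFn p).prod = exp (∑ j, (p j).log) := by
  have h := prod_exp_of_pairwise (S := S) (List.ofFn fun j => (p j).log)
    (List.pairwise_ofFn.2 fun i j hij => hI.lie_eq_zero hij.ne (hp i) (hp j))
  rw [List.map_ofFn, List.sum_ofFn] at h
  exact h

/-- The group is generated by the exponentials of the elements of the first layer which lie in one
of the summands. -/
@[elab_as_elim]
theorem exp_induction_component {m : ℕ} {I : Fin m → LieIdeal ℝ g} (hI : S.IsDecomposition I)
    {P : StratifiedGroup S → Prop} (p : StratifiedGroup S) (one : P 1)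
    (mul_exp : ∀ q, P q → ∀ j, ∀ X ∈ I j, X ∈ S.layer 1 → P (q * exp X)) : P p := by
  induction p using exp_induction with
  | one => exact one
  | mul_exp q hq X hX =>
    have key : ∀ s : Finset (Fin m), P (q * exp (∑ j ∈ s, hI.component j X)) := by
      intro s
      induction s using Finset.induction_on with
      | empty => rwa [Finset.sum_empty, exp_zero, mul_one]
      | insert j s hj ih =>
        have h1 : ⁅∑ i ∈ s, hI.component i X, hI.component j X⁆ = 0 := by
          rw [sum_lie]
          refine Finset.sum_eq_zero fun i hi => hI.lie_eq_zero ?_ (hI.component_mem i X)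
            (hI.component_mem j X)
          rintro rfl
          exact hj hi
        rw [Finset.sum_insert hj, add_comm, ← exp_mul_of_lie_eq_zero h1, ← mul_assoc]
        exact mul_exp _ ih j _ (hI.component_mem j X) (hI.component_mem_layer j hX)
    have := key Finset.univ
    rwa [hI.sum_component] at this

end StratifiedGroup

/-! ### The differential of a quasiconformal map along the factors -/

namespace StratifiedGroup

variable {g : Type*} [LieRing g] [LieAlgebra ℝ g] [FiniteDimensional ℝ g] {S : Stratification g}
variable {f : StratifiedGroup S → StratifiedGroup S}

open Set Filter

theorem HasVelocity.eq_of_zero {c : ℝ → StratifiedGroup S} {a b : ℝ}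
    (h : ∀ t ∈ Icc a b, HasVelocity c 0 (Icc a b) t) : ∀ t ∈ Icc a b, c t = c a := by
  have h' : ∀ t ∈ Icc a b, HasDerivWithinAt (fun t => (c t).log) 0 (Icc a b) t := fun t ht => by
    have := h t ht
    rwa [HasVelocity, map_zero] at this
  intro t ht
  refine ext_log (constant_of_derivWithin_zero (f := fun t => (c t).log)
    (fun x hx => (h' x hx).differentiableWithinAt) (fun x hx => ?_) t ht)
  exact (h' x (Ico_subset_Icc_self hx)).derivWithin
    (uniqueDiffOn_Icc (hx.1.trans_lt hx.2) x (Ico_subset_Icc_self hx))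

theorem continuous_log_mul {E : Type*} [TopologicalSpace E] {c c' : E → StratifiedGroup S}
    (h : Continuous fun e => (c e).log) (h' : Continuous fun e => (c' e).log) :
    Continuous fun e => (c e * c' e).log :=
  h.bch S.step h'

theorem IsC1.continuous_differential_comp {E : Type*} [TopologicalSpace E] (hf : IsC1 f)
    {c : E → StratifiedGroup S} (h : Continuous fun e => (c e).log) :
    Continuous fun e => differential f (c e) := by
  have := hf.continuous_differential.comp h
  exact this

theorem hasVelocity_mul_exp_smul (p : StratifiedGroup S) (X : g) (s : Set ℝ) (t : ℝ) :
    HasVelocity (fun t => p * exp (t • X)) X s t :=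
  (hasVelocity_exp_smul X s t).const_mul p

end StratifiedGroup

namespace CarnotStructure

variable {g : Type*} [LieRing g] [LieAlgebra ℝ g] [FiniteDimensional ℝ g] {C : CarnotStructure g}
variable {f : C.Group → C.Group} {m : ℕ} {I : Fin m → LieIdeal ℝ g}

open Set StratifiedGroup Filter Stratification

/-- By comparability of the stretching factors, a differential which kills one nonzero horizontal
vector kills them all. -/
theorem IsQuasiconformal.eq_zero_of_differential (hf : IsC1 f) (hq : C.IsQuasiconformal f)
    {p : C.Group} (hp : ∃ X ∈ C.layer 1, differential f p X ≠ 0) {Y : g} (hY : Y ∈ C.layer 1)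
    (h : differential f p Y = 0) : Y = 0 := by
  obtain ⟨K, hK, hconf⟩ := hq.exists_conformal hf
  obtain ⟨X, hX, hX0⟩ := hp
  have h1 := hconf p X hX Y hY
  rw [h, norm_zero, zero_mul, mul_zero] at h1
  have h2 := norm_pos_iff.2 hX0
  by_contra hY0
  have h3 := mul_pos h2 (norm_pos_iff.2 hY0)
  linarith

/-- At a point where it does not vanish, the differential of a quasiconformal map is injective, and
its diagonal part is a strata-preserving automorphism. -/
theorem IsQuasiconformal.exists_lieEquiv (hf : IsC1 f) (hq : C.IsQuasiconformal f)
    {p : C.Group} (hp : ∃ X ∈ C.layer 1, differential f p X ≠ 0) :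
    Function.Injective (differential f p) ∧ ∃ T : g ≃ₗ⁅ℝ⁆ g,
      (∀ j, ∀ X ∈ C.layer j, T X ∈ C.layer j) ∧ ∀ X ∈ C.layer 1, T X = differential f p X := by
  obtain ⟨T, hT, hT1, hT2⟩ := exists_lieHom_differential hf (hq.isContact hf) p
  have hinj1 : ∀ X ∈ C.layer 1, T X = 0 → X = 0 := fun X hX h =>
    hq.eq_zero_of_differential hf hp hX ((hT1 X hX).symm.trans h)
  have hsurj1 : ∀ X ∈ C.layer 1, ∃ Y, T Y = X := by
    let R : C.layer 1 →ₗ[ℝ] C.layer 1 := (T : g →ₗ[ℝ] g).restrict (hT 1)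
    have hR : Function.Injective R := by
      refine (injective_iff_map_eq_zero R).2 fun X hX => ?_
      exact Subtype.ext (hinj1 X X.2 (congrArg Subtype.val hX))
    intro X hX
    obtain ⟨Y, hY⟩ := LinearMap.injective_iff_surjective.1 hR ⟨X, hX⟩
    exact ⟨Y, congrArg Subtype.val hY⟩
  have hsurj : Function.Surjective T := C.lieHom_surjective hsurj1
  have hinj : Function.Injective T :=
    (LinearMap.injective_iff_surjective (f := (T : g →ₗ[ℝ] g))).2 hsurj
  refine ⟨(injective_iff_map_eq_zero (differential f p)).2 fun Z hZ => ?_,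
    LieEquiv.ofBijective T ⟨hinj, hsurj⟩, fun j X hX => hT j X hX, fun X hX => hT1 X hX⟩
  -- The differential is block triangular, with no component in higher layers, and its diagonal `T`
  -- is injective; a vector of the kernel vanishes layer by layer from the last one down.
  have key : ∀ n k, C.step + 1 ≤ k + n → C.proj k Z = 0 := by
    intro n
    induction n with
    | zero => exact fun k hk => C.proj_of_lt (by omega) Z
    | succ n ih =>
      intro k hk
      have h1 : ∑ j ∈ Finset.range (C.step + 1), C.proj k (differential f p (C.proj j Z)) = 0 := by
        rw [← map_sum, ← map_sum, C.sum_proj, hZ, map_zero]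
      rcases lt_or_ge C.step k with hk' | hk'
      · exact C.proj_of_lt hk' Z
      rw [Finset.sum_eq_single k, hT2 k _ (C.proj_mem k Z) k le_rfl, if_pos rfl] at h1
      · exact hinj (h1.trans (map_zero T).symm)
      · intro j _ hjk
        rcases lt_or_gt_of_ne hjk with h | h
        · rw [hT2 j _ (C.proj_mem j Z) k h.le, if_neg h.ne']
        · rw [ih j (by omega), map_zero, map_zero]
      · intro h
        simp at h
        omega
  exact C.eq_of_proj fun k => by rw [key (C.step + 1) k (by omega), map_zero]

theorem IsQuasiconformal.exists_perm (hf : IsC1 f) (hq : C.IsQuasiconformal f)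
    (hI : C.IsFinestDecomposition I) {p : C.Group}
    (hp : ∃ X ∈ C.layer 1, differential f p X ≠ 0) : ∃ σ : Equiv.Perm (Fin m),
      ∀ j, ∀ X ∈ I j, X ∈ C.layer 1 → differential f p X ∈ I (σ j) := by
  obtain ⟨-, T, hT, hT1⟩ := hq.exists_lieEquiv hf hp
  obtain ⟨σ, hσ⟩ := hI.exists_perm T hT
  exact ⟨σ, fun j X hX hX1 => by rw [← hT1 X hX1, hσ]; exact hX⟩

/-- The permutation may depend on the point. The nonvanishing hypothesis says that it sends `j` to
`k`, and this condition is open in the point. -/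
theorem IsQuasiconformal.component_differential (hf : IsC1 f) (hq : C.IsQuasiconformal f)
    (hI : C.IsFinestDecomposition I) {p : C.Group} {j k : Fin m} {Y : g} (hY : Y ∈ I j)
    (hY1 : Y ∈ C.layer 1) (h : hI.isDecomposition.component k (differential f p Y) ≠ 0) {X : g}
    (hX : X ∈ C.layer 1) : hI.isDecomposition.component k (differential f p X) =
      differential f p (hI.isDecomposition.component j X) := by
  set dec := hI.isDecomposition
  have hp : ∃ X ∈ C.layer 1, differential f p X ≠ 0 :=
    ⟨Y, hY1, fun h0 => h (by rw [h0, map_zero])⟩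
  obtain ⟨σ, hσ⟩ := hq.exists_perm hf hI hp
  have hk : k = σ j := by
    by_contra hne
    exact h (dec.component_ne hne (hσ j Y hY hY1))
  subst hk
  conv_lhs => rw [← dec.sum_component X]
  rw [map_sum, map_sum, Finset.sum_eq_single j]
  · exact dec.component_same (hσ j _ (dec.component_mem j X) (dec.component_mem_layer j hX))
  · intro i _ hij
    exact dec.component_ne (fun h => hij (σ.injective h).symm)
      (hσ i _ (dec.component_mem i X) (dec.component_mem_layer i hX))
  · simp

/-- Let `k` be the image of `j` at `p`; this persists nearby by continuity. The component `k` of `f`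
has velocity zero along `X`, since `X` has no component in the summand `j`. As `exp (t X)` commutes
with `exp (s Y)`, the component `k` takes the same values along `p exp (t X) exp (s Y)` and `p exp
(s Y)`. Differentiating at `s = 0` gives the claim. -/
theorem IsQuasiconformal.differential_mul_exp_local (hf : IsC1 f) (hq : C.IsQuasiconformal f)
    (hI : C.IsFinestDecomposition I) {p : C.Group}
    (hp : ∃ X ∈ C.layer 1, differential f p X ≠ 0) (j : Fin m) {X : g} (hX : X ∈ C.layer 1)
    (hXj : hI.isDecomposition.component j X = 0) : ∃ ε : ℝ, 0 < ε ∧ ∀ t ∈ Icc 0 ε, ∀ Y ∈ I j,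
      Y ∈ C.layer 1 → differential f (p * exp (t • X)) Y = differential f p Y := by
  set dec := hI.isDecomposition with hdec
  obtain ⟨σ, hσ⟩ := hq.exists_perm hf hI hp
  set k := σ j
  obtain ⟨Y₀, hY₀, hY₀1, hY₀0⟩ := dec.exists_mem_layer_one (hI.ne_bot j)
  have h0 : dec.component k (differential f p Y₀) ≠ 0 := by
    rw [dec.component_same (hσ j Y₀ hY₀ hY₀1)]
    exact fun h => hY₀0 (hq.eq_zero_of_differential hf hp hY₀1 h)
  let q : ℝ × g → C.Group := fun x => p * exp x.2 * exp (x.1 • X)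
  have hcont : Continuous fun x : ℝ × g => dec.component k (differential f (q x) Y₀) := by
    have h1 : Continuous fun x : ℝ × g => (q x).log :=
      continuous_log_mul (c := fun x : ℝ × g => p * exp x.2) (c' := fun x : ℝ × g => exp (x.1 • X))
        (continuous_log_mul (c := fun _ => p) (c' := fun x : ℝ × g => exp x.2) continuous_const
          continuous_snd) (continuous_fst.smul continuous_const)
    have h2 : Continuous (dec.component k) :=
      LinearMap.continuous_of_finiteDimensional (dec.component k : g →ₗ[ℝ] g)
    exact h2.comp ((hf.continuous_differential_comp h1).clm_apply continuous_const)
  have hopen := hcont.continuousAt.eventually_ne (x := ((0 : ℝ), (0 : g))) (y := 0) (by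
    simpa only [q, exp_zero, zero_smul, mul_one] using h0)
  obtain ⟨δ, hδ, hball⟩ := Metric.eventually_nhds_iff.1 hopen
  have hV : ∀ t ∈ Icc 0 (δ / 2), ∀ Z : g, ‖Z‖ < δ → ∀ W ∈ C.layer 1,
      dec.component k (differential f (p * exp Z * exp (t • X)) W) =
        differential f (p * exp Z * exp (t • X)) (dec.component j W) := by
    intro t ht Z hZ W hW
    refine hq.component_differential hf hI hY₀ hY₀1 ?_ hW
    refine hball (y := (t, Z)) ?_
    rw [Prod.dist_eq, max_lt_iff, dist_zero_right, dist_zero_right, Real.norm_eq_abs,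
      abs_of_nonneg ht.1]
    exact ⟨by linarith [ht.2], hZ⟩
  refine ⟨δ / 2, by positivity, fun t ht Y hY hY1 => ?_⟩
  have hcomm : ∀ s : ℝ, (exp (s • Y) : C.Group) * exp (t • X) = exp (t • X) * exp (s • Y) := by
    intro s
    have hX' : dec.cocomponent j X = X := by rw [dec.cocomponent_apply, hXj, sub_zero]
    have h1 : ⁅Y, X⁆ = 0 := by
      have := dec.lie_cocomponent hY X
      rwa [hX'] at this
    have h2 : ⁅s • Y, t • X⁆ = 0 := by rw [smul_lie, lie_smul, h1, smul_zero, smul_zero]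
    have h3 : ⁅t • X, s • Y⁆ = 0 := by rw [← lie_skew, h2, neg_zero]
    rw [exp_mul_of_lie_eq_zero h2, exp_mul_of_lie_eq_zero h3, add_comm]
  have heq : ∀ᶠ s in 𝓝 (0 : ℝ), mapHom C.toStratification (dec.component k)
      (f (p * exp (t • X) * exp (s • Y))) =
        mapHom C.toStratification (dec.component k) (f (p * exp (s • Y))) := by
    have hsmall : ∀ᶠ s in 𝓝 (0 : ℝ), ‖s • Y‖ < δ := by
      have h1 : Continuous fun s : ℝ => ‖s • Y‖ := by fun_prop
      exact h1.continuousAt.eventually_lt continuousAt_const (by simpa using hδ)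
    filter_upwards [hsmall] with s hs
    have h1 := HasVelocity.eq_of_zero (c := fun τ => mapHom C.toStratification (dec.component k)
      (f (p * exp (s • Y) * exp (τ • X)))) (a := 0) (b := δ / 2) (fun τ hτ => by
        have h2 := ((hasVelocity_mul_exp_smul (p * exp (s • Y)) X (Icc 0 (δ / 2)) τ).comp
          hf).mapHom (dec.component k)
        rwa [hV τ hτ _ hs X hX, hXj, map_zero] at h2) t ht
    rw [mul_assoc p, ← hcomm, ← mul_assoc, h1, zero_smul, exp_zero, mul_one]
  have hv1 := ((hasVelocity_mul_exp_smul (p * exp (t • X)) Y univ 0).comp hf).mapHom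
    (dec.component k)
  have hv2 := ((hasVelocity_mul_exp_smul p Y univ 0).comp hf).mapHom (dec.component k)
  have hv3 := hv2.congr (c' := fun s => mapHom C.toStratification (dec.component k)
    (f (p * exp (t • X) * exp (s • Y)))) (by rw [nhdsWithin_univ]; exact heq) heq.self_of_nhds
  have hv4 := hv1.unique hv3 uniqueDiffWithinAt_univ
  have h5 := hV t ht 0 (by simpa using hδ) Y hY1
  have h6 := hV 0 ⟨le_rfl, by positivity⟩ 0 (by simpa using hδ) Y hY1
  simp only [zero_smul, exp_zero, mul_one, dec.component_same hY] at h6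
  simp only [exp_zero, mul_one, dec.component_same hY] at h5
  simp only [zero_smul, exp_zero, mul_one] at hv4
  rw [← h5, hv4, h6]

/-- The differential of a quasiconformal map on a factor does not change along the other
factors. -/
theorem IsQuasiconformal.differential_mul_exp (hf : IsC1 f) (hq : C.IsQuasiconformal f)
    (hI : C.IsFinestDecomposition I) {p : C.Group}
    (hp : ∃ X ∈ C.layer 1, differential f p X ≠ 0) (j : Fin m) {X : g} (hX : X ∈ C.layer 1)
    (hXj : hI.isDecomposition.component j X = 0) {Y : g} (hY : Y ∈ I j) (hY1 : Y ∈ C.layer 1) :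
    differential f (p * exp X) Y = differential f p Y := by
  obtain ⟨Y₀, hY₀, hY₀1, hY₀0⟩ := hI.isDecomposition.exists_mem_layer_one (hI.ne_bot j)
  let s : Set ℝ := {t | ∀ Y ∈ I j, Y ∈ C.layer 1 →
    differential f (p * exp (t • X)) Y = differential f p Y}
  have hcont : Continuous fun t : ℝ => (p * exp (t • X)).log :=
    continuous_log_mul (c := fun _ => p) (c' := fun t : ℝ => exp (t • X)) continuous_const
      (continuous_id.smul continuous_const)
  have hclosed : IsClosed s := by
    simp only [s, ofPred_forall]
    refine isClosed_iInter fun Y => isClosed_iInter fun _ => isClosed_iInter fun _ => ?_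
    exact isClosed_eq ((hf.continuous_differential_comp hcont).clm_apply continuous_const)
      continuous_const
  -- Continuous induction: as long as the differential on the summand is unchanged it is not zero,
  -- so the local statement applies again.
  have hsub : Icc (0 : ℝ) 1 ⊆ s := by
    refine (hclosed.inter isClosed_Icc).Icc_subset_of_forall_exists_gt ?_ ?_
    · intro Y _ _
      rw [zero_smul, exp_zero, mul_one]
    · rintro x ⟨hx, -⟩ y hy
      have hp' : ∃ Z ∈ C.layer 1, differential f (p * exp (x • X)) Z ≠ 0 :=
        ⟨Y₀, hY₀1, by
          rw [hx Y₀ hY₀ hY₀1]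
          exact fun h => hY₀0 (hq.eq_zero_of_differential hf hp hY₀1 h)⟩
      obtain ⟨ε, hε, h⟩ := hq.differential_mul_exp_local hf hI hp' j hX hXj
      have hy : x < y := hy
      refine ⟨min (x + ε) y, fun Y hY hY1 => ?_, lt_min (by linarith) hy, min_le_right _ _⟩
      have h1 := h (min (x + ε) y - x) ⟨by
        rw [sub_nonneg]; exact (lt_min (by linarith) hy).le, by
        rw [sub_le_iff_le_add']; exact min_le_left _ _⟩ Y hY hY1
      have h2 : (exp (x • X) : C.Group) * exp ((min (x + ε) y - x) • X) =
          exp (min (x + ε) y • X) := by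
        rw [exp_mul_of_lie_eq_zero (by rw [smul_lie, lie_smul, lie_self, smul_zero, smul_zero]),
          ← add_smul, add_sub_cancel]
      rw [mul_assoc, h2] at h1
      rw [h1, hx Y hY hY1]
  have := hsub (right_mem_Icc.2 zero_le_one) Y hY hY1
  rwa [one_smul] at this

end CarnotStructure

/-! ### Global rigidity of the differential -/

namespace Stratification.IsDecomposition

variable {g : Type*} [LieRing g] [LieAlgebra ℝ g] {S : Stratification g} {m : ℕ}
  {I : Fin m → LieIdeal ℝ g} (hI : S.IsDecomposition I)

theorem index_eq (hI : S.IsDecomposition I) {i j : Fin m} {X : g} (hi : X ∈ I i) (hj : X ∈ I j)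
    (hX : X ≠ 0) : i = j := by
  by_contra hij
  exact hX ((hI.component_same hi).symm.trans (hI.component_ne hij hj))

theorem cocomponent_mem_layer (j : Fin m) {i : ℕ} {X : g} (hX : X ∈ S.layer i) :
    hI.cocomponent j X ∈ S.layer i :=
  sub_mem hX (hI.component_mem_layer j hX)

theorem cocomponent_eq_self {j : Fin m} {X : g} (hX : hI.component j X = 0) :
    hI.cocomponent j X = X := by
  rw [cocomponent_apply, hX, sub_zero]

variable [FiniteDimensional ℝ g]

/-- The subgroup of the elements without component in a given factor is generated by the
exponentials of the elements of the first layer which it contains. -/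
theorem kernel_induction (hI : S.IsDecomposition I) (j : Fin m) {P : StratifiedGroup S → Prop}
    {r : StratifiedGroup S} (hr : hI.component j r.log = 0) (one : P 1)
    (mul_exp : ∀ q, P q → ∀ X ∈ S.layer 1, hI.component j X = 0 → P (q * .exp X)) : P r := by
  have key : ∀ r, P (StratifiedGroup.mapHom S (hI.cocomponent j) r) := fun r => by
    induction r using StratifiedGroup.exp_induction with
    | one => rwa [map_one]
    | mul_exp q hq X hX =>
      rw [map_mul, StratifiedGroup.mapHom_exp]
      exact mul_exp _ hq _ (hI.cocomponent_mem_layer j hX) (hI.component_cocomponent j X)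
  have h1 : StratifiedGroup.mapHom S (hI.cocomponent j) r = r :=
    StratifiedGroup.ext_log (hI.cocomponent_eq_self hr)
  rw [← h1]
  exact key r

theorem component_log_inv_mul (j : Fin m) {p q : StratifiedGroup S}
    (h : hI.component j p.log = hI.component j q.log) : hI.component j (p⁻¹ * q).log = 0 := by
  rw [← StratifiedGroup.log_mapHom, map_mul, map_inv]
  have : StratifiedGroup.mapHom S (hI.component j) p = StratifiedGroup.mapHom S (hI.component j) q :=
    StratifiedGroup.ext_log h
  rw [this, inv_mul_cancel, StratifiedGroup.log_one]

end Stratification.IsDecomposition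

namespace CarnotStructure

variable {g : Type*} [LieRing g] [LieAlgebra ℝ g] [FiniteDimensional ℝ g] {C : CarnotStructure g}
variable {f : C.Group → C.Group} {m : ℕ} {I : Fin m → LieIdeal ℝ g}

open Set StratifiedGroup Filter Stratification

/-- Otherwise `f` would be constant along horizontal segments, hence constant, against injectivity
on a nontrivial group. -/
theorem exists_differential_ne_zero (hf : IsC1 f) (hinj : Function.Injective f) :
    ∃ p, ∃ X ∈ C.layer 1, differential f p X ≠ 0 := by
  by_contra! h
  have hconst : ∀ p, f p = f 1 := fun p => by
    induction p using exp_induction with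
    | one => rfl
    | mul_exp q hq X hX =>
      have h1 := HasVelocity.eq_of_zero (c := fun τ => f (q * exp (τ • X))) (a := 0) (b := 1)
        (fun τ _ => by
          have h2 := (hasVelocity_mul_exp_smul q X (Icc 0 1) τ).comp hf
          rwa [h _ X hX] at h2) 1 (right_mem_Icc.2 zero_le_one)
      rwa [one_smul, zero_smul, exp_zero, mul_one, hq] at h1
  obtain ⟨Z, -, hZ⟩ := (Submodule.ne_bot_iff _).1 C.layer_step
  exact hZ (congrArg log (hinj (hconst (exp Z))))

/-- If there are at least two factors, then the differential of a quasiconformal map vanishes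
nowhere. -/
theorem IsQuasiconformal.differential_ne_zero (hf : IsC1 f) (hq : C.IsQuasiconformal f)
    (hI : C.IsFinestDecomposition I) (hm : 1 < m) (p : C.Group) :
    ∃ X ∈ C.layer 1, differential f p X ≠ 0 := by
  have : Nontrivial (Fin m) := Fin.nontrivial_iff_two_le.2 hm
  set dec := hI.isDecomposition
  obtain ⟨p₀, hp₀⟩ := exists_differential_ne_zero hf hq.injective
  have key : ∀ q, ∃ X ∈ C.layer 1, differential f (p₀ * q) X ≠ 0 := fun q => by
    induction q using exp_induction_component dec with
    | one => rwa [mul_one]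
    | mul_exp q hpq j X hXj hX =>
      -- A second factor is essential: moving in the factor `j` leaves the differential on the
      -- factor `i` unchanged, so it stays nonzero.
      obtain ⟨i, hi⟩ := exists_ne j
      obtain ⟨Y, hY, hY1, hY0⟩ := dec.exists_mem_layer_one (hI.ne_bot i)
      refine ⟨Y, hY1, ?_⟩
      rw [← mul_assoc, hq.differential_mul_exp hf hI hpq i hX (dec.component_ne hi hXj) hY hY1]
      exact fun h => hY0 (hq.eq_zero_of_differential hf hpq hY1 h)
  have := key (p₀⁻¹ * p)
  rwa [mul_inv_cancel_left] at this

theorem IsQuasiconformal.differential_mul (hf : IsC1 f) (hq : C.IsQuasiconformal f)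
    (hI : C.IsFinestDecomposition I) (hm : 1 < m) (p : C.Group) {r : C.Group} {j : Fin m}
    (hr : hI.isDecomposition.component j r.log = 0) {Y : g} (hY : Y ∈ I j) (hY1 : Y ∈ C.layer 1) :
    differential f (p * r) Y = differential f p Y := by
  refine hI.isDecomposition.kernel_induction j
    (P := fun r => differential f (p * r) Y = differential f p Y) hr (by rw [mul_one]) ?_
  intro q ih X hX hXj
  rw [← mul_assoc, hq.differential_mul_exp hf hI (hq.differential_ne_zero hf hI hm _) j hX hXj hY
    hY1, ih]

/-- The permutation of the factors does not depend on the point. -/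
theorem IsQuasiconformal.exists_perm_forall (hf : IsC1 f) (hq : C.IsQuasiconformal f)
    (hI : C.IsFinestDecomposition I) (hm : 1 < m) : ∃ σ : Equiv.Perm (Fin m),
      ∀ p j, ∀ X ∈ I j, X ∈ C.layer 1 → differential f p X ∈ I (σ j) := by
  set dec := hI.isDecomposition
  have hne := hq.differential_ne_zero hf hI hm
  obtain ⟨σ, hσ⟩ := hq.exists_perm hf hI (hne 1)
  refine ⟨σ, fun p => ?_⟩
  induction p using exp_induction_component dec with
  | one => exact hσ
  | mul_exp q ih i X hXi hX =>
    obtain ⟨σ', hσ'⟩ := hq.exists_perm hf hI (hne (q * exp X))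
    -- Moving in the factor `i` does not change the differential on the other factors; two
    -- permutations which agree off one index agree there too.
    have h1 : ∀ j, j ≠ i → σ' j = σ j := fun j hj => by
      obtain ⟨Y, hY, hY1, hY0⟩ := dec.exists_mem_layer_one (hI.ne_bot j)
      have h2 := hσ' j Y hY hY1
      rw [hq.differential_mul_exp hf hI (hne q) j hX (dec.component_ne hj hXi) hY hY1] at h2
      exact dec.index_eq h2 (ih j Y hY hY1) fun h =>
        hY0 (hq.eq_zero_of_differential hf (hne q) hY1 h)
    have h2 : σ' i = σ i := by
      obtain ⟨l, hl⟩ := σ.surjective (σ' i)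
      rcases eq_or_ne l i with rfl | hli
      · exact hl.symm
      · exact absurd (σ'.injective ((h1 l hli).trans hl)) hli
    intro j
    have h3 : σ' j = σ j := by
      rcases eq_or_ne j i with rfl | hj
      · exact h2
      · exact h1 j hj
    rw [← h3]
    exact hσ' j

theorem IsQuasiconformal.component_differential_perm (hf : IsC1 f) (hq : C.IsQuasiconformal f)
    (hI : C.IsFinestDecomposition I) (hm : 1 < m) {σ : Equiv.Perm (Fin m)}
    (hσ : ∀ p j, ∀ X ∈ I j, X ∈ C.layer 1 → differential f p X ∈ I (σ j)) (p : C.Group)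
    (j : Fin m) {X : g} (hX : X ∈ C.layer 1) :
    hI.isDecomposition.component (σ j) (differential f p X) =
      differential f p (hI.isDecomposition.component j X) := by
  obtain ⟨Y, hY, hY1, hY0⟩ := hI.isDecomposition.exists_mem_layer_one (hI.ne_bot j)
  refine hq.component_differential hf hI hY hY1 ?_ hX
  rw [hI.isDecomposition.component_same (hσ p j Y hY hY1)]
  exact fun h => hY0 (hq.eq_zero_of_differential hf (hq.differential_ne_zero hf hI hm p) hY1 h)

/-- The zero-velocity argument now holds at every point, because the permutation is constant. This
is the product structure of `f`. -/
theorem IsQuasiconformal.mapHom_component_mul (hf : IsC1 f) (hq : C.IsQuasiconformal f)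
    (hI : C.IsFinestDecomposition I) (hm : 1 < m) {σ : Equiv.Perm (Fin m)}
    (hσ : ∀ p j, ∀ X ∈ I j, X ∈ C.layer 1 → differential f p X ∈ I (σ j)) (p : C.Group)
    {j : Fin m} {r : C.Group} (hr : hI.isDecomposition.component j r.log = 0) :
    mapHom C.toStratification (hI.isDecomposition.component (σ j)) (f (p * r)) =
      mapHom C.toStratification (hI.isDecomposition.component (σ j)) (f p) := by
  refine hI.isDecomposition.kernel_induction j (P := fun r =>
    mapHom C.toStratification (hI.isDecomposition.component (σ j)) (f (p * r)) =
      mapHom C.toStratification (hI.isDecomposition.component (σ j)) (f p)) hr (by rw [mul_one]) ?_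
  intro q ih X hX hXj
  have h1 := HasVelocity.eq_of_zero (c := fun τ => mapHom C.toStratification
    (hI.isDecomposition.component (σ j)) (f (p * q * exp (τ • X)))) (a := 0) (b := 1)
    (fun τ _ => by
      have h2 := ((hasVelocity_mul_exp_smul (p * q) X (Icc 0 1) τ).comp hf).mapHom
        (hI.isDecomposition.component (σ j))
      rwa [hq.component_differential_perm hf hI hm hσ _ j hX, hXj, map_zero] at h2)
    1 (right_mem_Icc.2 zero_le_one)
  rw [one_smul, zero_smul, exp_zero, mul_one] at h1
  rw [← mul_assoc, h1, ih]

/-- The differential of a quasiconformal map is bounded from above and from below. -/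
theorem IsQuasiconformal.exists_differential_bounds (hf : IsC1 f) (hq : C.IsQuasiconformal f)
    (hI : C.IsFinestDecomposition I) (hm : 1 < m) : ∃ a b : ℝ, 0 < a ∧ 0 < b ∧
      ∀ p, ∀ X ∈ C.layer 1, a * ‖X‖ ≤ ‖differential f p X‖ ∧ ‖differential f p X‖ ≤ b * ‖X‖ := by
  have : Nontrivial (Fin m) := Fin.nontrivial_iff_two_le.2 hm
  set dec := hI.isDecomposition
  obtain ⟨i, k, hik⟩ := exists_pair_ne (Fin m)
  obtain ⟨Y, hY, hY1, hY0⟩ := dec.exists_mem_layer_one (hI.ne_bot i)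
  obtain ⟨Z, hZ, hZ1, hZ0⟩ := dec.exists_mem_layer_one (hI.ne_bot k)
  obtain ⟨K, hK, hconf⟩ := hq.exists_conformal hf
  have hYn := norm_pos_iff.2 hY0
  have hZn := norm_pos_iff.2 hZ0
  have hn : 0 < ‖differential f 1 Z‖ := norm_pos_iff.2 fun h =>
    hZ0 (hq.eq_zero_of_differential hf (hq.differential_ne_zero hf hI hm 1) hZ1 h)
  set n := ‖differential f 1 Z‖
  refine ⟨n / (K * K * ‖Z‖), K * K * n / ‖Z‖, by positivity, by positivity, fun p X hX => ?_⟩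
  -- `q` is the part of `p` in the factor `i`. On `Y`, in the summand `i`, the differentials at `p`
  -- and `q` agree; on `Z`, in the summand `k`, those at `q` and `1` agree. Comparing `X` with `Y`
  -- at `p` and `Y` with `Z` at `q` bounds everything by the fixed number `n`; hence the factor `K *
  -- K`.
  let q : C.Group := mapHom C.toStratification (dec.component i) p
  have hqY : differential f p Y = differential f q Y := by
    have h1 := hq.differential_mul hf hI hm q (dec.component_log_inv_mul i (p := q) (q := p)
      (dec.component_same (dec.component_mem i p.log))) hY hY1
    rwa [mul_inv_cancel_left] at h1
  have hqZ : differential f q Z = differential f 1 Z := by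
    have h1 := hq.differential_mul hf hI hm 1 (r := q)
      (dec.component_ne hik.symm (dec.component_mem i p.log)) hZ hZ1
    rwa [one_mul] at h1
  have c1 := hconf p X hX Y hY1
  have c2 := hconf p Y hY1 X hX
  have c3 := hconf q Y hY1 Z hZ1
  have c4 := hconf q Z hZ1 Y hY1
  rw [hqY] at c1 c2
  rw [hqZ] at c3 c4
  constructor
  · rw [div_mul_eq_mul_div, div_le_iff₀ (by positivity)]
    refine le_of_mul_le_mul_right ?_ hYn
    calc n * ‖X‖ * ‖Y‖ = n * ‖Y‖ * ‖X‖ := by ring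
      _ ≤ K * (‖differential f q Y‖ * ‖Z‖) * ‖X‖ := by gcongr
      _ = K * ‖Z‖ * (‖differential f q Y‖ * ‖X‖) := by ring
      _ ≤ K * ‖Z‖ * (K * (‖differential f p X‖ * ‖Y‖)) := by gcongr
      _ = ‖differential f p X‖ * (K * K * ‖Z‖) * ‖Y‖ := by ring
  · rw [div_mul_eq_mul_div, le_div_iff₀ hZn]
    refine le_of_mul_le_mul_right ?_ hYn
    calc ‖differential f p X‖ * ‖Z‖ * ‖Y‖ = ‖differential f p X‖ * ‖Y‖ * ‖Z‖ := by ring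
      _ ≤ K * (‖differential f q Y‖ * ‖X‖) * ‖Z‖ := by gcongr
      _ = K * ‖X‖ * (‖differential f q Y‖ * ‖Z‖) := by ring
      _ ≤ K * ‖X‖ * (K * (n * ‖Y‖)) := by gcongr
      _ = K * K * n * ‖X‖ * ‖Y‖ := by ring

end CarnotStructure

/-! ### Lipschitz estimates and lifts of curves -/

namespace StratifiedGroup

variable {g : Type*} [LieRing g] [LieAlgebra ℝ g] [FiniteDimensional ℝ g] {S : Stratification g}
variable {f : StratifiedGroup S → StratifiedGroup S}

open Set Filter

theorem fderiv_log_leftDeriv (hf : IsC1 f) (p : StratifiedGroup S) (u : g) :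
    fderiv ℝ (fun X => (f (exp X)).log) p.log (S.leftDeriv p.log u) =
      S.leftDeriv (f p).log (differential f p u) := by
  have h1 := hasVelocity_mul_exp_smul p u univ 0
  have h2 := h1.comp hf
  rw [HasVelocity, hasDerivWithinAt_univ] at h1 h2
  simp only [zero_smul, exp_zero, mul_one] at h1 h2
  have h3 : HasFDerivAt (fun X => (f (exp X)).log) (fderiv ℝ (fun X => (f (exp X)).log) p.log)
      (p * exp ((0 : ℝ) • u)).log := by
    rw [zero_smul, exp_zero, mul_one]
    exact (hf.contDiff.differentiable one_ne_zero p.log).hasFDerivAt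
  have h4 := h3.comp_hasDerivAt (0 : ℝ) h1
  exact h4.unique h2

theorem leftDeriv_surjective (X : g) : Function.Surjective (S.leftDeriv X) :=
  (LinearMap.injective_iff_surjective (f := (S.leftDeriv X : g →ₗ[ℝ] g))).1
    (S.leftDeriv_injective X)

theorem exists_fderiv_equiv (hf : IsC1 f) (hD : ∀ p, Function.Injective (differential f p)) :
    ∃ e : g → g ≃L[ℝ] g, ∀ X,
      HasStrictFDerivAt (fun X => (f (exp X)).log) (e X : g →L[ℝ] g) X := by
  have hinj : ∀ X, Function.Injective (fderiv ℝ (fun X => (f (exp X)).log) X) := fun X => by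
    refine (injective_iff_map_eq_zero _).2 fun w hw => ?_
    obtain ⟨u, rfl⟩ := leftDeriv_surjective (S := S) X w
    have h1 := fderiv_log_leftDeriv hf (exp X) u
    change fderiv ℝ (fun X => (f (exp X)).log) X (S.leftDeriv X u) = _ at h1
    rw [hw] at h1
    have h2 := S.leftDeriv_injective _ (h1.symm.trans (map_zero _).symm)
    rw [hD _ (h2.trans (map_zero _).symm), map_zero]
  refine ⟨fun X => (LinearEquiv.ofInjectiveEndo
    (fderiv ℝ (fun X => (f (exp X)).log) X : g →ₗ[ℝ] g) (hinj X)).toContinuousLinearEquiv,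
    fun X => ?_⟩
  have h := hf.contDiff.contDiffAt.hasStrictFDerivAt (x := X) one_ne_zero
  have hcoe : ((LinearEquiv.ofInjectiveEndo
      (fderiv ℝ (fun X => (f (exp X)).log) X : g →ₗ[ℝ] g) (hinj X)).toContinuousLinearEquiv :
        g →L[ℝ] g) = fderiv ℝ (fun X => (f (exp X)).log) X := ContinuousLinearMap.ext fun _ => rfl
  beta_reduce
  rw [hcoe]
  exact h

theorem isOpenMap_log (hf : IsC1 f) (hD : ∀ p, Function.Injective (differential f p)) :
    IsOpenMap fun X => (f (exp X)).log := by
  obtain ⟨e, he⟩ := exists_fderiv_equiv hf hD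
  exact isOpenMap_of_hasStrictFDerivAt_equiv he

/-- A left inverse of `f` in exponential coordinates is differentiable on the range of `f`. -/
theorem differentiableAt_leftInverse (hf : IsC1 f)
    (hD : ∀ p, Function.Injective (differential f p)) {G : g → g}
    (hG : ∀ X, G (f (exp X)).log = X) (X : g) : DifferentiableAt ℝ G (f (exp X)).log := by
  obtain ⟨e, he⟩ := exists_fderiv_equiv hf hD
  have hmap := (isOpenMap_log hf hD).nhds_le X
  have hcont : ContinuousAt G (f (exp X)).log := by
    refine Tendsto.mono_left ?_ hmap
    rw [tendsto_map'_iff, hG]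
    have : G ∘ (fun X => (f (exp X)).log) = id := funext hG
    rw [this]
    exact tendsto_id
  have hder := (he X).hasFDerivAt
  have hX : HasFDerivAt (fun X => (f (exp X)).log) (e X : g →L[ℝ] g) (G (f (exp X)).log) := by
    rw [hG]; exact hder
  refine (HasFDerivAt.of_local_left_inverse hcont hX ?_).differentiableAt
  refine hmap ?_
  rw [mem_map]
  exact Eventually.of_forall fun Y => congrArg (fun Z => (f (exp Z)).log) (hG Y)

/-- A horizontal curve in the range of `f` is the image of a horizontal curve. -/
theorem exists_lift (hf : IsC1 f) (hfinj : Function.Injective f)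
    (hD : ∀ p, Function.Injective (differential f p)) (hc : IsContact f) {a : ℝ} (ha : 0 < a)
    (hab : ∀ p, ∀ X ∈ S.layer 1, a * ‖X‖ ≤ ‖differential f p X‖) {c : ℝ → StratifiedGroup S}
    {v : ℝ → g} (hcv : ∀ t ∈ Icc (0 : ℝ) 1, HasVelocity c (v t) (Icc 0 1) t)
    (hv1 : ∀ t ∈ Icc (0 : ℝ) 1, v t ∈ S.layer 1) (hvc : ContinuousOn v (Icc 0 1))
    (hr : ∀ t ∈ Icc (0 : ℝ) 1, ∃ x, f x = c t) : ∃ (γ : ℝ → StratifiedGroup S) (u : ℝ → g),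
      (∀ t ∈ Icc (0 : ℝ) 1, f (γ t) = c t) ∧
      (∀ t ∈ Icc (0 : ℝ) 1, HasVelocity γ (u t) (Icc 0 1) t) ∧
      (∀ t ∈ Icc (0 : ℝ) 1, u t ∈ S.layer 1) ∧ ContinuousOn u (Icc 0 1) ∧
      ∀ t ∈ Icc (0 : ℝ) 1, a * ‖u t‖ ≤ ‖v t‖ := by
  have hFinj : Function.Injective fun X => (f (exp X)).log := fun X Y h =>
    congrArg log (hfinj (ext_log h))
  obtain ⟨G, hG⟩ := hFinj.hasLeftInverse
  replace hG : ∀ X, G (f (exp X)).log = X := hG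
  let γ : ℝ → StratifiedGroup S := fun t => exp (G (c t).log)
  have hγ : ∀ t ∈ Icc (0 : ℝ) 1, f (γ t) = c t := fun t ht => by
    obtain ⟨x, hx⟩ := hr t ht
    simp only [γ, ← hx]
    rw [show G (f x).log = x.log from hG x.log]
  have hex : ∀ t ∈ Icc (0 : ℝ) 1, ∃ u, HasVelocity γ u (Icc 0 1) t ∧ u ∈ S.layer 1 ∧
      differential f (γ t) u = v t := fun t ht => by
    have h1 : DifferentiableAt ℝ G (c t).log := by
      rw [← hγ t ht]
      exact differentiableAt_leftInverse hf hD hG (G (c t).log)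
    have h2 := h1.hasFDerivAt.comp_hasDerivWithinAt t (hcv t ht)
    obtain ⟨u, hu⟩ := leftDeriv_surjective (S := S) (γ t).log
      (fderiv ℝ G (c t).log (S.leftDeriv (c t).log (v t)))
    have h3 : HasVelocity γ u (Icc 0 1) t := by
      rw [HasVelocity, hu]
      exact h2
    have h4 : HasVelocity c (differential f (γ t) u) (Icc 0 1) t :=
      (h3.comp hf).congr (by
        filter_upwards [self_mem_nhdsWithin] with x hx
        exact (hγ x hx).symm) (hγ t ht).symm
    have h5 : differential f (γ t) u = v t :=
      h4.unique (hcv t ht) (uniqueDiffOn_Icc zero_lt_one t ht)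
    refine ⟨u, h3, ?_, h5⟩
    -- The differential is injective on the finite-dimensional first layer and maps it to itself, so
    -- the horizontal vector `v t` has a horizontal preimage, which must be `u`.
    let R : S.layer 1 →ₗ[ℝ] S.layer 1 :=
      (differential f (γ t) : g →ₗ[ℝ] g).restrict (hc (γ t))
    have hR : Function.Injective R := fun X Y h =>
      Subtype.ext (hD (γ t) (congrArg Subtype.val h))
    obtain ⟨Y, hY⟩ := LinearMap.injective_iff_surjective.1 hR ⟨v t, hv1 t ht⟩
    have h6 : differential f (γ t) Y = v t := congrArg Subtype.val hY
    rw [hD (γ t) (h5.trans h6.symm)]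
    exact Y.2
  choose! u hu using hex
  refine ⟨γ, u, hγ, fun t ht => (hu t ht).1, fun t ht => (hu t ht).2.1, fun t ht => ?_,
    fun t ht => ?_⟩
  · have hγc : ContinuousOn (fun t => (γ t).log) (Icc 0 1) := fun t ht =>
      HasDerivWithinAt.continuousWithinAt (hu t ht).1
    -- Continuity of `u`: `a ‖u τ - u t‖` is at most the norm of `v τ - differential f (γ τ) (u t)`,
    -- which tends to zero as `τ` tends to `t`.
    have h1 : ContinuousOn (fun τ => differential f (γ τ) (u t)) (Icc 0 1) := by
      have := hf.continuous_differential.comp_continuousOn hγc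
      exact this.clm_apply continuousOn_const
    have h2 : Tendsto (fun τ => ‖v τ - differential f (γ τ) (u t)‖) (𝓝[Icc 0 1] t)
        (𝓝 ‖v t - differential f (γ t) (u t)‖) := ((hvc.sub h1) t ht).norm
    rw [(hu t ht).2.2, sub_self, norm_zero] at h2
    rw [ContinuousWithinAt, tendsto_iff_norm_sub_tendsto_zero]
    have h3 := h2.const_mul a⁻¹
    rw [mul_zero] at h3
    refine squeeze_zero_norm' ?_ h3
    filter_upwards [self_mem_nhdsWithin] with τ hτ
    rw [norm_norm, le_inv_mul_iff₀ ha]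
    have h4 := hab (γ τ) (u τ - u t) (sub_mem (hu τ hτ).2.1 (hu t ht).2.1)
    rwa [map_sub, (hu τ hτ).2.2] at h4
  · rw [← (hu t ht).2.2]
    exact hab _ _ (hu t ht).2.1

/-- As long as a horizontal curve starting on the range of `f` remains in the range of `f`, its
preimage remains bounded. -/
theorem exists_bound_lift (hf : IsC1 f) (hfinj : Function.Injective f)
    (hD : ∀ p, Function.Injective (differential f p)) (hc : IsContact f) {a : ℝ} (ha : 0 < a)
    (hab : ∀ p, ∀ X ∈ S.layer 1, a * ‖X‖ ≤ ‖differential f p X‖) {c : ℝ → StratifiedGroup S}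
    {v : ℝ → g} (hcv : ∀ t ∈ Icc (0 : ℝ) 1, HasVelocity c (v t) (Icc 0 1) t)
    (hv1 : ∀ t ∈ Icc (0 : ℝ) 1, v t ∈ S.layer 1) (hvc : ContinuousOn v (Icc 0 1))
    {p : StratifiedGroup S} (hp : f p = c 0) : ∃ B : ℝ, 0 ≤ B ∧ ∀ t ∈ Icc (0 : ℝ) 1,
      (∀ τ ∈ Icc 0 t, ∃ x, f x = c τ) → ∃ x, f x = c t ∧ ‖(p⁻¹ * x).log‖ ≤ B := by
  obtain ⟨M, hM⟩ := isCompact_Icc.exists_bound_of_continuousOn hvc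
  obtain ⟨K, hK, hgrow⟩ := exists_norm_proj_log_le S
  have hM0 : 0 ≤ M := (norm_nonneg _).trans (hM 0 (left_mem_Icc.2 zero_le_one))
  -- The lift over `[0, t]`, rescaled to unit time, has speed at most `M / a`; the added `1` keeps
  -- the radius positive.
  set r : ℝ := M / a + 1
  have hr0 : 0 < r := by positivity
  refine ⟨∑ j ∈ Finset.range (S.step + 1), K * r ^ j,
    Finset.sum_nonneg fun j _ => by positivity, fun t ht hτ => ?_⟩
  have hmaps : MapsTo (fun τ : ℝ => t * τ) (Icc 0 1) (Icc 0 1) := fun τ hτ =>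
    ⟨mul_nonneg ht.1 hτ.1, mul_le_one₀ ht.2 hτ.1 hτ.2⟩
  have hlin : ∀ τ : ℝ, HasDerivAt (fun τ : ℝ => t * τ) t τ := fun τ => by
    simpa using (hasDerivAt_id τ).const_mul t
  obtain ⟨γ, u, h1, h2, h3, h4, h5⟩ := exists_lift hf hfinj hD hc ha hab
    (c := fun τ => c (t * τ)) (v := fun τ => t • v (t * τ))
    (fun τ hτ => (hcv _ (hmaps hτ)).scomp (φ := fun τ => t * τ) (hlin τ).hasDerivWithinAt hmaps)
    (fun τ hτ => Submodule.smul_mem _ _ (hv1 _ (hmaps hτ)))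
    ((hvc.comp (by fun_prop) hmaps).const_smul t)
    (fun τ hτ' => hτ _ ⟨mul_nonneg ht.1 hτ'.1, mul_le_of_le_one_right ht.1 hτ'.2⟩)
  have hγ0 : γ 0 = p := hfinj (by
    rw [h1 0 (left_mem_Icc.2 zero_le_one), mul_zero, hp])
  have hu : ∀ τ ∈ Icc (0 : ℝ) 1, ‖u τ‖ ≤ r := fun τ hτ => by
    have h6 := h5 τ hτ
    have h7 : ‖t • v (t * τ)‖ ≤ M := by
      rw [norm_smul, Real.norm_eq_abs, abs_of_nonneg ht.1]
      calc t * ‖v (t * τ)‖ ≤ 1 * M := by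
            gcongr
            · exact ht.2
            · exact hM _ (hmaps hτ)
        _ = M := one_mul M
    have h8 : ‖u τ‖ ≤ M / a := by
      rw [le_div_iff₀ ha, mul_comm]; exact h6.trans h7
    linarith
  have hint : ∫ τ in (0 : ℝ)..1, ‖u τ‖ ≤ r := by
    have := intervalIntegral.norm_integral_le_of_norm_le_const (a := (0 : ℝ)) (b := 1)
      (C := r) (f := fun t => ‖u t‖) (fun t ht => by
        rw [norm_norm]
        rw [uIoc_of_le zero_le_one] at ht
        exact hu t (Ioc_subset_Icc_self ht))
    rw [sub_zero, abs_one, mul_one] at this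
    exact (le_abs_self _).trans this
  have h6 := hgrow (fun t => (γ 0)⁻¹ * γ t) u r hr0 (fun t ht => (h2 t ht).const_mul _) h3 h4
    (inv_mul_cancel _) hint
  refine ⟨γ 1, ?_, ?_⟩
  · rw [h1 1 (right_mem_Icc.2 zero_le_one), mul_one]
  · rw [← hγ0]
    exact (S.norm_le_sum_proj _).trans (Finset.sum_le_sum fun j _ => h6 j)

/-- By the inverse function theorem `f` is open. The statement keeps the preimages in a fixed ball,
as the continuity argument along a curve requires. -/
theorem image_closedBall_mem_nhds (hf : IsC1 f)
    (hD : ∀ p, Function.Injective (differential f p)) (p x : StratifiedGroup S) {R : ℝ}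
    (hx : ‖(p⁻¹ * x).log‖ < R) :
    (fun Z => (f (p * exp Z)).log) '' Metric.closedBall 0 R ∈ 𝓝 (f x).log := by
  have hcont : Continuous fun X : g => (p⁻¹ * exp X : StratifiedGroup S).log :=
    continuous_log_mul (c := fun _ => p⁻¹) (c' := fun Z => exp Z) continuous_const continuous_id
  have hev : ∀ᶠ X in 𝓝 x.log, ‖(p⁻¹ * exp X : StratifiedGroup S).log‖ < R :=
    hcont.norm.continuousAt.eventually_lt continuousAt_const hx
  have himage := (isOpenMap_log hf hD).image_mem_nhds hev
  refine mem_of_superset himage ?_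
  rintro _ ⟨X, hX, rfl⟩
  have hX' : ‖(p⁻¹ * exp X : StratifiedGroup S).log‖ < R := hX
  obtain ⟨q, hq⟩ : ∃ q : StratifiedGroup S, q = p⁻¹ * exp X := ⟨_, rfl⟩
  rw [← hq] at hX'
  have h : p * q = exp X := by rw [hq, mul_inv_cancel_left]
  exact ⟨q.log, mem_closedBall_zero_iff.2 hX'.le, congrArg (fun q => (f q).log) h⟩

/-- A horizontal curve starting on the range of `f` remains in the range of `f`. -/
theorem forall_mem_range (hf : IsC1 f) (hfinj : Function.Injective f)
    (hD : ∀ p, Function.Injective (differential f p)) (hc : IsContact f) {a : ℝ} (ha : 0 < a)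
    (hab : ∀ p, ∀ X ∈ S.layer 1, a * ‖X‖ ≤ ‖differential f p X‖) {c : ℝ → StratifiedGroup S}
    {v : ℝ → g} (hcv : ∀ t ∈ Icc (0 : ℝ) 1, HasVelocity c (v t) (Icc 0 1) t)
    (hv1 : ∀ t ∈ Icc (0 : ℝ) 1, v t ∈ S.layer 1) (hvc : ContinuousOn v (Icc 0 1))
    {p : StratifiedGroup S} (hp : f p = c 0) : ∀ t ∈ Icc (0 : ℝ) 1, ∃ x, f x = c t := by
  have hproper : ProperSpace g := FiniteDimensional.proper ℝ g
  obtain ⟨B, hB0, hbound⟩ := exists_bound_lift hf hfinj hD hc ha hab hcv hv1 hvc hp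
  let F : g → g := fun Z => (f (p * exp Z)).log
  have hFcont : Continuous F := by
    have h1 : Continuous fun Z : g => (p * exp Z : StratifiedGroup S).log :=
      continuous_log_mul (c := fun _ => p) (c' := fun Z => exp Z) continuous_const continuous_id
    exact hf.contDiff.continuous.comp h1
  have hcc : ContinuousOn (fun t => (c t).log) (Icc 0 1) := fun t ht =>
    HasDerivWithinAt.continuousWithinAt (hcv t ht)
  let k : ℝ → g := fun t => (c (projIcc 0 1 zero_le_one t)).log
  have hk : Continuous k := by
    have h1 : Continuous fun t : Icc (0 : ℝ) 1 => (c t).log :=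
      continuousOn_iff_continuous_domRestrict.1 hcc
    exact h1.comp continuous_projIcc
  have hk' : ∀ t ∈ Icc (0 : ℝ) 1, k t = (c t).log := fun t ht => by
    simp only [k, projIcc_of_mem zero_le_one ht]
  have hcompact : IsClosed (F '' Metric.closedBall 0 (B + 1)) :=
    ((isCompact_closedBall 0 (B + 1)).image hFcont).isClosed
  -- The times up to which the curve has preimages in the ball of radius `B + 1`. The minimum
  -- expresses "up to `t`" by conditions closed in `t`.
  let s : Set ℝ := {t | ∀ τ : ℝ, k (min τ t) ∈ F '' Metric.closedBall 0 (B + 1)}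
  have hs : IsClosed s := by
    simp only [s, ofPred_forall]
    exact isClosed_iInter fun τ => hcompact.preimage (hk.comp (continuous_const.min continuous_id))
  have h0 : (0 : ℝ) ∈ s := fun τ => by
    have h1 : k (min τ 0) = (c 0).log := by
      simp only [k, projIcc_of_le_left zero_le_one (min_le_right τ 0)]
    rw [h1]
    refine ⟨0, by simp; linarith, ?_⟩
    simp only [F, exp_zero, mul_one, hp]
  have hsub : Icc (0 : ℝ) 1 ⊆ s := by
    refine (hs.inter isClosed_Icc).Icc_subset_of_forall_exists_gt h0 ?_
    rintro t ⟨hts, ht⟩ y hy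
    have ht' : t ∈ Icc (0 : ℝ) 1 := Ico_subset_Icc_self ht
    -- The a priori bound `B` is smaller than the radius `B + 1`, so the preimage is interior and
    -- the curve can be followed a little further.
    obtain ⟨x, hx, hxB⟩ := hbound t ht' fun τ hτ => by
      obtain ⟨Z, -, hZ⟩ := hts τ
      rw [min_eq_left hτ.2, hk' τ ⟨hτ.1, hτ.2.trans ht'.2⟩] at hZ
      exact ⟨_, ext_log hZ⟩
    have hnhds : F '' Metric.closedBall 0 (B + 1) ∈ 𝓝 (k t) := by
      rw [hk' t ht', ← hx]
      exact image_closedBall_mem_nhds hf hD p x (by linarith)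
    obtain ⟨ε, hε, hball⟩ := Metric.mem_nhds_iff.1 (hk.continuousAt.preimage_mem_nhds hnhds)
    have hy : t < y := hy
    refine ⟨min (t + ε / 2) y, fun τ => ?_, lt_min (by linarith) hy, min_le_right _ _⟩
    rcases le_or_gt τ t with hτ | hτ
    · have := hts τ
      rw [min_eq_left hτ] at this
      rwa [min_eq_left (hτ.trans (le_min (by linarith) hy.le))]
    · refine hball ?_
      have h1 : t ≤ min τ (min (t + ε / 2) y) := le_min hτ.le (le_min (by linarith) hy.le)
      have h2 : min τ (min (t + ε / 2) y) ≤ t + ε / 2 := (min_le_right _ _).trans (min_le_left _ _)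
      rw [Metric.mem_ball, Real.dist_eq, abs_of_nonneg (by linarith)]
      linarith
  intro t ht
  obtain ⟨Z, -, hZ⟩ := hsub ht t
  rw [min_self, hk' t ht] at hZ
  exact ⟨_, ext_log hZ⟩

end StratifiedGroup

/-! ### From bounds on the differential to bi-Lipschitz estimates. -/

namespace CarnotStructure

variable {g : Type*} [LieRing g] [LieAlgebra ℝ g] [FiniteDimensional ℝ g] (C : CarnotStructure g)
variable {f : C.Group → C.Group}

open Set StratifiedGroup Filter

/-- Any two points are joined by a horizontal curve whose speed is bounded by a multiple of their
distance. -/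
theorem exists_curve : ∃ M : ℝ, 0 < M ∧ ∀ p q : C.Group, p ≠ q → 0 < C.dist p q ∧
    ∃ (c : ℝ → C.Group) (u : ℝ → g), c 0 = p ∧ c 1 = q ∧
      (∀ t ∈ Icc (0 : ℝ) 1, HasVelocity c (u t) (Icc 0 1) t) ∧
      (∀ t ∈ Icc (0 : ℝ) 1, u t ∈ C.layer 1) ∧ ContinuousOn u (Icc 0 1) ∧
      ∀ t ∈ Icc (0 : ℝ) 1, ‖u t‖ ≤ M * C.dist p q := by
  obtain ⟨K, hK, hreach⟩ := exists_isReachable_of_norm_proj_le C.toStratification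
  obtain ⟨Kl, hKl, hlow⟩ := C.exists_norm_proj_le_dist
  refine ⟨K * (Kl + 1), by positivity, fun p q hpq => ?_⟩
  have hd : 0 < C.dist p q :=
    (C.dist_nonneg p q).lt_of_ne fun h => hpq (C.eq_of_dist_eq_zero h.symm)
  refine ⟨hd, ?_⟩
  obtain ⟨γ, u, h, hu⟩ := C.isHorizontalCurve_of_isReachable (hreach (p⁻¹ * q).log
    ((Kl + 1) * C.dist p q) (by positivity) (C.norm_proj_le_pow hKl hd (hlow p q)))
  have hcont := C.continuousOn_of_isHorizontalCurve h
  obtain ⟨-, h2, h3, h4⟩ := C.isHorizontalCurve_iff.1 h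
  refine ⟨fun t => p * γ t, fun t => (u t : g), ?_, ?_, fun t ht => (h2 t ht).const_mul p,
    fun t _ => (u t).2, hcont, fun t _ => ?_⟩
  · simp only [h3, mul_one]
  · simp only [h4, exp_log, mul_inv_cancel_left]
  · rw [mul_assoc]; exact hu t

theorem exists_dist_map_le (hf : IsC1 f) (hc : IsContact f) {b : ℝ} (hb : 0 < b)
    (hbd : ∀ p, ∀ X ∈ C.layer 1, ‖differential f p X‖ ≤ b * ‖X‖) :
    ∃ K : ℝ, 0 < K ∧ ∀ p q, C.dist (f p) (f q) ≤ K * C.dist p q := by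
  obtain ⟨M, hM, hcurve⟩ := C.exists_curve
  obtain ⟨K, hK, hvel⟩ := C.exists_dist_le_of_velocity
  refine ⟨K * (b * M), by positivity, fun p q => ?_⟩
  rcases eq_or_ne p q with rfl | hpq
  · rw [C.dist_self, C.dist_self, mul_zero]
  obtain ⟨hd, c, u, h0, h1, h2, h3, h4, h5⟩ := hcurve p q hpq
  have hcc : ContinuousOn (fun t => (c t).log) (Icc 0 1) := fun t ht =>
    HasDerivWithinAt.continuousWithinAt (h2 t ht)
  have := (hvel (fun t => f (c t)) (fun t => differential f (c t) (u t)) (b * (M * C.dist p q))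
    (by positivity) (fun t ht => (h2 t ht).comp hf) (fun t ht => hc _ _ (h3 t ht))
    ((hf.continuous_differential.comp_continuousOn hcc).clm_apply h4)
    fun t ht => (hbd _ _ (h3 t ht)).trans (by gcongr; exact h5 t ht)).1
  rw [h0, h1] at this
  refine this.trans (le_of_eq ?_)
  ring

/-- A horizontal curve from `f p` to `f q` with speed controlled by their distance stays in the
range of `f`. Its lift joins `p` to `q`, with speed larger by a factor of at most `a⁻¹`. -/
theorem exists_dist_le_map (hf : IsC1 f) (hfinj : Function.Injective f)
    (hD : ∀ p, Function.Injective (differential f p)) (hc : IsContact f) {a : ℝ} (ha : 0 < a)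
    (hab : ∀ p, ∀ X ∈ C.layer 1, a * ‖X‖ ≤ ‖differential f p X‖) :
    ∃ K : ℝ, 0 < K ∧ ∀ p q, C.dist p q ≤ K * C.dist (f p) (f q) := by
  obtain ⟨M, hM, hcurve⟩ := C.exists_curve
  obtain ⟨K, hK, hvel⟩ := C.exists_dist_le_of_velocity
  refine ⟨K * (a⁻¹ * M), by positivity, fun p q => ?_⟩
  rcases eq_or_ne p q with rfl | hpq
  · rw [C.dist_self, C.dist_self, mul_zero]
  obtain ⟨hd, c, v, h0, h1, h2, h3, h4, h5⟩ := hcurve (f p) (f q) (hfinj.ne hpq)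
  obtain ⟨γ, u, k1, k2, k3, k4, k5⟩ := exists_lift hf hfinj hD hc ha hab h2 h3 h4
    (forall_mem_range hf hfinj hD hc ha hab h2 h3 h4 h0.symm)
  have := (hvel γ u (a⁻¹ * (M * C.dist (f p) (f q))) (by positivity) k2 k3 k4 fun t ht => by
    rw [le_inv_mul_iff₀ ha]
    exact (k5 t ht).trans (h5 t ht)).1
  rw [hfinj ((k1 0 (left_mem_Icc.2 zero_le_one)).trans h0),
    hfinj ((k1 1 (right_mem_Icc.2 zero_le_one)).trans h1)] at this
  refine this.trans (le_of_eq ?_)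
  ring

/-- A layer-preserving linear map changes the size of each layer by a bounded factor, and by the
ball-box estimates these sizes control the distance. -/
theorem exists_dist_mapHom_le (T : g →ₗ⁅ℝ⁆ g) (hT : ∀ j, ∀ X ∈ C.layer j, T X ∈ C.layer j) :
    ∃ K : ℝ, 0 < K ∧ ∀ p q, C.dist (mapHom C.toStratification T p) (mapHom C.toStratification T q) ≤
      K * C.dist p q := by
  obtain ⟨b, hb, hbT⟩ := (LinearMap.toContinuousLinearMap (T : g →ₗ[ℝ] g)).bound
  replace hbT : ∀ X, ‖T X‖ ≤ b * ‖X‖ := hbT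
  obtain ⟨Kl, hKl, hlow⟩ := C.exists_norm_proj_le_dist
  obtain ⟨Ku, hKu, hup⟩ := C.exists_dist_le
  have hproj : ∀ i X, C.proj i (T X) = T (C.proj i X) := fun i X => by
    induction X using C.layer_induction with
    | add a b ha hb => simp only [map_add, ha, hb]
    | mem j X hX =>
      rw [C.proj_of_mem hX, C.proj_of_mem (hT j X hX)]
      split_ifs <;> simp
  refine ⟨Ku * (b * Kl + 1), by positivity, fun p q => ?_⟩
  rcases eq_or_ne p q with rfl | hpq
  · rw [C.dist_self, C.dist_self, mul_zero]
  have hd : 0 < C.dist p q :=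
    (C.dist_nonneg p q).lt_of_ne fun h => hpq (C.eq_of_dist_eq_zero h.symm)
  rw [mul_assoc]
  refine hup _ _ _ (by positivity) (C.norm_proj_le_pow (by positivity) hd fun j => ?_)
  rw [← map_inv, ← map_mul, log_mapHom, hproj, mul_assoc]
  exact (hbT _).trans (by gcongr; exact hlow p q j)

end CarnotStructure

/-! ### Product maps and the main theorem -/

namespace Stratification

variable {g : Type*} [LieRing g] [LieAlgebra ℝ g] {S : Stratification g}

theorem symm_mem_layer {T : g ≃ₗ⁅ℝ⁆ g} (hT : ∀ j, ∀ X ∈ S.layer j, T X ∈ S.layer j) (j : ℕ) {X : g}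
    (hX : X ∈ S.layer j) : T.symm X ∈ S.layer j := by
  have hproj : ∀ Y, S.proj j (T Y) = T (S.proj j Y) := fun Y => by
    induction Y using S.layer_induction with
    | add a b ha hb => simp only [map_add, ha, hb]
    | mem i Y hY =>
      rw [S.proj_of_mem hY, S.proj_of_mem (hT i Y hY)]
      split_ifs <;> simp
  have h := hproj (T.symm X)
  rw [T.apply_symm_apply, S.proj_same hX] at h
  rw [h, T.symm_apply_apply]
  exact S.proj_mem j _

theorem isStrataPreserving_of_mem {T : g ≃ₗ⁅ℝ⁆ g}
    (hT : ∀ j, ∀ X ∈ S.layer j, T X ∈ S.layer j) : S.IsStrataPreserving T := by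
  intro j
  refine le_antisymm (Submodule.map_le_iff_le_comap.2 fun X hX => hT j X hX) fun X hX => ?_
  exact ⟨T.symm X, symm_mem_layer hT j hX, T.apply_symm_apply X⟩

theorem IsDecomposition.component_map {m : ℕ} {I : Fin m → LieIdeal ℝ g}
    (hI : S.IsDecomposition I) {T : g ≃ₗ⁅ℝ⁆ g} {σ : Equiv.Perm (Fin m)}
    (hσ : ∀ j X, T X ∈ I (σ j) ↔ X ∈ I j) (j : Fin m) (X : g) :
    hI.component (σ j) (T X) = T (hI.component j X) := by
  induction X using hI.induction with
  | zero => simp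
  | add a b ha hb => simp only [map_add, ha, hb]
  | mem i X hX =>
    rw [hI.component_of_mem hX, hI.component_of_mem ((hσ i X).2 hX)]
    simp only [σ.injective.eq_iff]
    split_ifs <;> simp

theorem IsDecomposition.component_symm {m : ℕ} {I : Fin m → LieIdeal ℝ g}
    (hI : S.IsDecomposition I) {T : g ≃ₗ⁅ℝ⁆ g} {σ : Equiv.Perm (Fin m)}
    (hσ : ∀ j X, T X ∈ I (σ j) ↔ X ∈ I j) (j : Fin m) (X : g) :
    hI.component j (T.symm X) = T.symm (hI.component (σ j) X) := by
  have h := hI.component_map hσ j (T.symm X)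
  rw [T.apply_symm_apply] at h
  rw [h, T.symm_apply_apply]

end Stratification

namespace StratifiedGroup

variable {g : Type*} [LieRing g] [LieAlgebra ℝ g] [FiniteDimensional ℝ g] {S : Stratification g}

/-- The automorphism of the group given by an automorphism of the Lie algebra. -/
noncomputable def mapEquiv (S : Stratification g) (T : g ≃ₗ⁅ℝ⁆ g) :
    StratifiedGroup S ≃* StratifiedGroup S where
  toFun := mapHom S (T : g →ₗ⁅ℝ⁆ g)
  invFun := mapHom S (T.symm : g →ₗ⁅ℝ⁆ g)
  left_inv p := ext_log (T.symm_apply_apply p.log)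
  right_inv p := ext_log (T.apply_symm_apply p.log)
  map_mul' := map_mul _

theorem mapEquiv_image_factor {m : ℕ} {I : Fin m → LieIdeal ℝ g} {T : g ≃ₗ⁅ℝ⁆ g}
    {σ : Equiv.Perm (Fin m)} (hσ : ∀ j X, T X ∈ I (σ j) ↔ X ∈ I j) (j : Fin m) :
    mapEquiv S T '' factor S (I j) = factor S (I (σ j)) := by
  ext p
  constructor
  · rintro ⟨q, hq, rfl⟩
    exact (hσ j q.log).2 hq
  · intro hp
    refine ⟨mapHom S (T.symm : g →ₗ⁅ℝ⁆ g) p, (hσ j _).1 ?_, (mapEquiv S T).apply_symm_apply p⟩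
    change T (T.symm p.log) ∈ I (σ j)
    rw [T.apply_symm_apply]
    exact hp

variable {m : ℕ} {I : Fin m → LieIdeal ℝ g} (hI : S.IsDecomposition I)
  {Φ : StratifiedGroup S → StratifiedGroup S}

theorem mapHom_component_mul_cocomponent (j : Fin m) (p : StratifiedGroup S) :
    mapHom S (hI.component j) p * mapHom S (hI.cocomponent j) p = p := by
  have h := exp_mul_of_lie_eq_zero (S := S) (hI.lie_cocomponent (hI.component_mem j p.log) p.log)
  rw [hI.cocomponent_apply, add_sub_cancel] at h
  exact h

/-- A map is a product map if its components do not change along the other factors. -/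
theorem isProductMap_of_component (h : ∀ j p r, hI.component j r.log = 0 →
      mapHom S (hI.component j) (Φ (p * r)) = mapHom S (hI.component j) (Φ p)) :
    IsProductMap I Φ fun j p => mapHom S (hI.component j) (Φ p) := by
  refine ⟨fun j p _ => hI.component_mem j _, fun p hp => ?_⟩
  have hP := prod_ofFn_of_mem hI p hp
  have hcomp : ∀ j, mapHom S (hI.component j) (Φ (List.ofFn p).prod) =
      mapHom S (hI.component j) (Φ (p j)) := fun j => by
    have h1 : hI.component j ((p j)⁻¹ * (List.ofFn p).prod).log = 0 := by
      refine hI.component_log_inv_mul j ?_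
      rw [hP]
      change _ = hI.component j (∑ i, (p i).log)
      rw [map_sum, Finset.sum_eq_single j (fun i _ hij => hI.component_ne hij.symm (hp i))
        (by simp)]
    have h2 := h j (p j) _ h1
    rwa [mul_inv_cancel_left] at h2
  rw [prod_ofFn_of_mem hI (fun j => mapHom S (hI.component j) (Φ (p j)))
    fun j => hI.component_mem j _]
  refine ext_log ?_
  change _ = ∑ j, (mapHom S (hI.component j) (Φ (p j))).log
  simp only [← hcomp]
  exact (hI.sum_component _).symm

/-- Two points of the factor `j` have the same trivial component in every other factor, so the other
components of `Φ` agree. -/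
theorem mapHom_cocomponent_eq (h : ∀ j p r, hI.component j r.log = 0 →
      mapHom S (hI.component j) (Φ (p * r)) = mapHom S (hI.component j) (Φ p)) {j : Fin m}
    {p q : StratifiedGroup S} (hp : p.log ∈ I j) (hq : q.log ∈ I j) :
    mapHom S (hI.cocomponent j) (Φ p) = mapHom S (hI.cocomponent j) (Φ q) := by
  refine ext_log (hI.ext_component fun i => ?_)
  rw [log_mapHom, log_mapHom]
  rcases eq_or_ne i j with rfl | hij
  · rw [hI.component_cocomponent, hI.component_cocomponent]
  · rw [hI.cocomponent_apply, hI.cocomponent_apply, map_sub, map_sub,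
      hI.component_ne hij (hI.component_mem j _), hI.component_ne hij (hI.component_mem j _),
      sub_zero, sub_zero]
    have h1 : hI.component i (p⁻¹ * q).log = 0 := hI.component_log_inv_mul i (by
      rw [hI.component_ne hij hp, hI.component_ne hij hq])
    have h2 := h i p _ h1
    rw [mul_inv_cancel_left] at h2
    exact (congrArg log h2).symm

end StratifiedGroup

namespace CarnotStructure

variable {g : Type*} [LieRing g] [LieAlgebra ℝ g] [FiniteDimensional ℝ g] (C : CarnotStructure g)
variable {m : ℕ} {I : Fin m → LieIdeal ℝ g} (hI : C.IsDecomposition I) {Φ : C.Group → C.Group}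

open StratifiedGroup

/-- On the factor `j`, the map `Φ` is its own component times an element of the other factors which
does not depend on the point. This element commutes with the factor, so it acts as a left
translation, which is an isometry. Hence each component inherits the constants of `Φ`. -/
theorem dist_mapHom_component (h : ∀ j p r, hI.component j r.log = 0 →
      mapHom C.toStratification (hI.component j) (Φ (p * r)) =
        mapHom C.toStratification (hI.component j) (Φ p)) {j : Fin m}
    {p q : C.Group} (hp : p.log ∈ I j) (hq : q.log ∈ I j) :
    C.dist (mapHom C.toStratification (hI.component j) (Φ p))
      (mapHom C.toStratification (hI.component j) (Φ q)) = C.dist (Φ p) (Φ q) := by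
  have h1 := mapHom_component_mul_cocomponent hI j (Φ p)
  have h2 := mapHom_component_mul_cocomponent hI j (Φ q)
  rw [← mapHom_cocomponent_eq hI h hp hq] at h2
  have hcomm : ∀ x : C.Group, mapHom C.toStratification (hI.component j) x *
      mapHom C.toStratification (hI.cocomponent j) (Φ p) =
      mapHom C.toStratification (hI.cocomponent j) (Φ p) *
        mapHom C.toStratification (hI.component j) x := fun x => by
    have h3 := hI.lie_cocomponent (hI.component_mem j x.log) (Φ p).log
    have h4 : ⁅hI.cocomponent j (Φ p).log, hI.component j x.log⁆ = 0 := by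
      rw [← lie_skew, h3, neg_zero]
    have h5 := exp_mul_of_lie_eq_zero (S := C.toStratification) h3
    have h6 := exp_mul_of_lie_eq_zero (S := C.toStratification) h4
    rw [add_comm, ← h5] at h6
    exact h6.symm
  rw [hcomm] at h1 h2
  conv_rhs => rw [← h1, ← h2]
  rw [C.dist_mul_left]

theorem isBiLipschitzOn_of_le {φ : C.Group → C.Group} {s : Set C.Group} {K K' : ℝ} (hK : 0 < K)
    (hK' : 0 < K') (h : ∀ p ∈ s, ∀ q ∈ s, C.dist p q ≤ K * C.dist (φ p) (φ q))
    (h' : ∀ p ∈ s, ∀ q ∈ s, C.dist (φ p) (φ q) ≤ K' * C.dist p q) : C.IsBiLipschitzOn φ s := by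
  refine ⟨K + K', by positivity, fun p hp q hq => ⟨?_, ?_⟩⟩
  · rw [inv_mul_le_iff₀ (by positivity)]
    refine (h p hp q hq).trans ?_
    have := C.dist_nonneg (φ p) (φ q)
    gcongr
    linarith
  · refine (h' p hp q hq).trans ?_
    have := C.dist_nonneg p q
    gcongr
    linarith

end CarnotStructure

theorem mainTheorem3 {g : Type*} [LieRing g] [LieAlgebra ℝ g] [FiniteDimensional ℝ g]
    (C : CarnotStructure g) (hC : C.IsTotallyNonabelian)
    {m : ℕ} (hm : 1 < m) (I : Fin m → LieIdeal ℝ g) (hI : C.IsFinestDecomposition I)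
    (f : C.Group → C.Group) (hf : StratifiedGroup.IsC1 f) (hqc : C.IsQuasiconformal f) :
    ∃ (A : C.Group ≃* C.Group) (T : g ≃ₗ⁅ℝ⁆ g) (σ : Equiv.Perm (Fin m))
      (Φ : C.Group → C.Group) (φ : Fin m → C.Group → C.Group),
      C.IsStrataPreserving T ∧
      (∀ X, A (StratifiedGroup.exp X) = StratifiedGroup.exp (T X)) ∧
      (∀ j, A '' StratifiedGroup.factor C.toStratification (I j) =
        StratifiedGroup.factor C.toStratification (I (σ j))) ∧
      StratifiedGroup.IsProductMap I Φ φ ∧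
      (∀ j, C.IsBiLipschitzOn (φ j) (StratifiedGroup.factor C.toStratification (I j))) ∧
      C.IsBiLipschitzOn Φ Set.univ ∧
      f = A ∘ Φ := by
  have hdec := hI.isDecomposition
  obtain ⟨σ, hσ⟩ := hqc.exists_perm_forall hf hI hm
  obtain ⟨a, b, ha, hb, hab⟩ := hqc.exists_differential_bounds hf hI hm
  have hne := hqc.differential_ne_zero hf hI hm
  have hc := hqc.isContact hf
  have hD : ∀ p, Function.Injective (StratifiedGroup.differential f p) := fun p =>
    (hqc.exists_lieEquiv hf (hne p)).1
  -- Since the permutation is constant, the automorphism at any single point serves as `A`; the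
  -- identity is chosen.
  obtain ⟨-, T, hT, hT1⟩ := hqc.exists_lieEquiv hf (hne 1)
  -- `T` agrees with the differential at `1` on the first layer, and one nonzero horizontal vector
  -- per summand determines the permutation.
  have hσT : ∀ j X, T X ∈ I (σ j) ↔ X ∈ I j := by
    obtain ⟨σ', hσ'⟩ := hI.exists_perm T hT
    have : σ' = σ := Equiv.ext fun j => by
      obtain ⟨Y, hY, hY1, hY0⟩ := hdec.exists_mem_layer_one (hI.ne_bot j)
      refine hdec.index_eq ((hσ' j Y).2 hY) ?_ fun h => hY0 (T.injective (h.trans (map_zero T).symm))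
      rw [hT1 Y hY1]
      exact hσ 1 j Y hY hY1
    rwa [this] at hσ'
  let A := StratifiedGroup.mapEquiv C.toStratification T
  let Φ : C.Group → C.Group := fun p => A.symm (f p)
  have hΦ : ∀ j p r, hdec.component j r.log = 0 →
      StratifiedGroup.mapHom C.toStratification (hdec.component j) (Φ (p * r)) =
        StratifiedGroup.mapHom C.toStratification (hdec.component j) (Φ p) := by
    intro j p r hr
    refine StratifiedGroup.ext_log ?_
    change hdec.component j (T.symm (f (p * r)).log) = hdec.component j (T.symm (f p).log)
    rw [hdec.component_symm hσT, hdec.component_symm hσT]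
    have := hqc.mapHom_component_mul hf hI hm hσ p hr
    exact congrArg T.symm (congrArg StratifiedGroup.log this)
  obtain ⟨K₁, hK₁, h₁⟩ := C.exists_dist_map_le hf hc hb fun p X hX => (hab p X hX).2
  obtain ⟨K₂, hK₂, h₂⟩ := C.exists_dist_le_map hf hqc.injective hD hc ha fun p X hX => (hab p X hX).1
  obtain ⟨K₃, hK₃, h₃⟩ := C.exists_dist_mapHom_le (T : g →ₗ⁅ℝ⁆ g) hT
  obtain ⟨K₄, hK₄, h₄⟩ := C.exists_dist_mapHom_le (T.symm : g →ₗ⁅ℝ⁆ g)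
    fun j X hX => Stratification.symm_mem_layer hT j hX
  have hfA : ∀ p, A (Φ p) = f p := fun p => A.apply_symm_apply (f p)
  have hlow : ∀ p q, C.dist p q ≤ K₂ * K₃ * C.dist (Φ p) (Φ q) := fun p q => by
    have h5 : C.dist (f p) (f q) ≤ K₃ * C.dist (Φ p) (Φ q) := by
      rw [← hfA p, ← hfA q]
      exact h₃ (Φ p) (Φ q)
    calc C.dist p q ≤ K₂ * C.dist (f p) (f q) := h₂ p q
      _ ≤ K₂ * (K₃ * C.dist (Φ p) (Φ q)) := by gcongr
      _ = _ := by ring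
  have hup : ∀ p q, C.dist (Φ p) (Φ q) ≤ K₄ * K₁ * C.dist p q := fun p q => by
    calc C.dist (Φ p) (Φ q) ≤ K₄ * C.dist (f p) (f q) := h₄ (f p) (f q)
      _ ≤ K₄ * (K₁ * C.dist p q) := by gcongr; exact h₁ p q
      _ = _ := by ring
  refine ⟨A, T, σ, Φ, fun j p => StratifiedGroup.mapHom C.toStratification (hdec.component j) (Φ p),
    Stratification.isStrataPreserving_of_mem hT, fun X => rfl,
    StratifiedGroup.mapEquiv_image_factor hσT,
    StratifiedGroup.isProductMap_of_component hdec hΦ, fun j => ?_, ?_, ?_⟩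
  · refine C.isBiLipschitzOn_of_le (K := K₂ * K₃) (K' := K₄ * K₁) (by positivity) (by positivity)
      (fun p hp q hq => ?_) fun p hp q hq => ?_
    · rw [C.dist_mapHom_component hdec hΦ hp hq]
      exact hlow p q
    · rw [C.dist_mapHom_component hdec hΦ hp hq]
      exact hup p q
  · exact C.isBiLipschitzOn_of_le (K := K₂ * K₃) (K' := K₄ * K₁) (by positivity) (by positivity)
      (fun p _ q _ => hlow p q) fun p _ q _ => hup p q
  · exact funext fun p => (hfA p).symm
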